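/- Let $\mathcal L$ be a braided strongly fusion 2-category over $\mathbb C$: a $\mathbb C$-linear braided monoidal bicategory which is finite semisimple, has left and right duals for objects and a simple unit object $\mathbb 1$, and satisfies $\mathrm{End}_{\mathcal L}(\mathbb 1)\simeq\mathbf{Vec}$. Write $b_{x|y}:x\otimes y\to y\otimes x$ for the braiding and $\pi,R,S$ for the pentagonator and the hexagonators. Suppose that $\mathcal L$ is trivially braided: the equivalence classes of simple objects form an abelian group $L$ under $\otimes$ with representatives $e_g$ ($g\in L$) and equivalences $\chi_{g,h}:e_g\otimes e_h\to e_{gh}$, and there are invertible 2-morphisms $\omega_{g,h,k}$ (comparing the two ways of fusing $(e_g\otimes e_h)\otimes e_k$ to $e_{ghk}$) and $u_{g,h}:\chi_{h,g}\circ b_{e_g|e_h}\Rightarrow\chi_{g,h}$ which trivialise the braided cocycle $(\pi,R,S)$, so that $[\pi,R,S]=0$ in $H^5(K(L,2);\mathbb C^\times)$. The sylleptic centre $\mathcal Z_{(2)}(\mathcal L)$ is the following bicategory. Its objects are pairs $(x,v_{x||-})$, where $x$ is an object of $\mathcal L$ and $v_{x||y}:b_{y|x}\circ b_{x|y}\Rightarrow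 \mathrm{id}_{x\otimes y}$ are invertible 2-morphisms, natural in $y$, such that $v_{x||y\otimes z}$ is the composite of $v_{x||y}$ and $v_{x||z}$ through $R_{(x|y,z)}$ and $S_{(y,z|x)}$. Its 1-morphisms are the 1-morphisms $f$ of $\mathcal L$ that commute with the $v$'s through the naturality 2-morphisms $b_{f|y},b_{y|f}$. Its 2-morphisms are all 2-morphisms of $\mathcal L$. The tensor product is $(x,v_{x||-})\otimes(y,v_{y||-})=(x\otimes y,v_{x\otimes y||-})$, where $v_{x\otimes y||z}$ is the composite of $v_{x||z}$ and $v_{y||z}$ through $S_{(x,y|z)}$ and $R_{(z|x,y)}$. Then $\mathcal Z_{(2)}(\mathcal L)$ is $\widehat L\times L$, where $\widehat L=\mathrm{Hom}(L,\mathbb C^\times)$, and its sylleptic form is the canonical one. Precisely: (0) $\mathcal Z_{(2)}(\mathcal L)$ inherits the braided monoidal structure of $\mathcal L$: it is closed under tensor products of objects and 1-morphisms, contains the associators and braidings, and the unit object has a half syllepsis $v_{\mathbb 1||-}$ for which the unitors are 1-morphisms of $\mathcal Z_{(2)}(\mathcal L)$. Moreover, for each $(f,g)\in\widehat L\times L$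 there is an object $E_{(f,g)}=(e_g,v^{f}_{e_g||-})$ of $\mathcal Z_{(2)}(\mathcal L)$ such that: (1) the $E_m$, $m\in\widehat L\times L$, exhibit $\mathcal Z_{(2)}(\mathcal L)$ as $2\mathbf{Vec}[\widehat L\times L]$: finite direct sums of objects and of 1-morphisms exist, each $E_m$ is simple with every endomorphism a finite direct sum of copies of the identity, every 1-morphism $E_m\to E_n$ with $m\neq n$ is zero, and every object is a finite direct sum of objects $E_m$; (2) for $m=(f,g)$ and $n=(f',g')$, the equivalence $\chi_{g,g'}$ is an equivalence $E_m\otimes E_n\to E_{mn}$ in $\mathcal Z_{(2)}(\mathcal L)$, where $mn=(ff',gg')$; (3) under the identifications $\chi,u$, the syllepsis $v^{f}_{e_g||e_h}$ is the scalar $f(h)$, that is, after composing with $\chi_{g,h}$ it equals $f(h)$ times the composite of $u_{h,g}$ and $u_{g,h}$; (4) the antisymmetric pairing $v_{x||y}\,v_{y||x}^{-1}$ of $x=E_{(f,g)}$ and $y=E_{(f',g')}$, where $v_{x||y}$ and $v_{y||x}$ are both regarded as 2-morphisms $b_{x|y}\circ b_{y|x}\circ b_{x|y}\Rightarrow b_{x|y}$,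 is the scalar $f(g')\,f'(g)^{-1}$. -/

import Mathlib

open CategoryTheory Bicategory

universe w v u w' v' u' w'' v'' u''

namespace SylCentre

/-! ### Pseudofunctors used to form tensor products -/

section Pairing

variable {A : Type u} [Bicategory.{w, v} A] {C : Type u'} [Bicategory.{w', v'} C]
  {D : Type u''} [Bicategory.{w'', v''} D]

/-- The pseudofunctor `a ↦ (F a, G a)`. -/
def pairing (F : A ⥤ᵖ C) (G : A ⥤ᵖ D) : A ⥤ᵖ (C × D) where
  obj a := (F.obj a, G.obj a)
  map f := Prod.mkHom (F.map f) (G.map f)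
  map₂ η := Prod.mkHom (F.map₂ η) (G.map₂ η)
  mapId a := Iso.prod (F.mapId a) (G.mapId a)
  mapComp f g := Iso.prod (F.mapComp f g) (G.mapComp f g)

/-- The constant pseudofunctor. -/
def constant (A : Type u) [Bicategory.{w, v} A] (c : C) : A ⥤ᵖ C where
  obj _ := c
  map _ := 𝟙 c
  map₂ _ := 𝟙 _
  mapId _ := Iso.refl _
  mapComp _ _ := (λ_ _).symm

/-- The pointwise tensor product of two pseudofunctors, for a tensor pseudofunctor `T`. -/
abbrev ptens (T : (C × C) ⥤ᵖ C) (F G : A ⥤ᵖ C) : A ⥤ᵖ C := (pairing F G).comp T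

end Pairing

section Projections

variable (B : Type u) [Bicategory.{w, v} B]

/-- First projection from `B × B`. -/
abbrev pr₁ : (B × B) ⥤ᵖ B := (Bicategory.Prod.fst B B).toPseudofunctor

/-- Second projection from `B × B`. -/
abbrev pr₂ : (B × B) ⥤ᵖ B := (Bicategory.Prod.snd B B).toPseudofunctor

/-- First projection from `B × B × B`. -/
abbrev tr₁ : (B × B × B) ⥤ᵖ B := (Bicategory.Prod.fst B (B × B)).toPseudofunctor

/-- Second projection from `B × B × B`. -/
abbrev tr₂ : (B × B × B) ⥤ᵖ B := (Bicategory.Prod.snd B (B × B)).toPseudofunctor.comp (pr₁ B)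

/-- Third projection from `B × B × B`. -/
abbrev tr₃ : (B × B × B) ⥤ᵖ B := (Bicategory.Prod.snd B (B × B)).toPseudofunctor.comp (pr₂ B)

end Projections

/-! ### Adjoint inverses, equivalences and squares in a bicategory -/

section General

variable {B : Type u} [Bicategory.{w, v} B]

/-- An adjoint inverse of a 1-morphism. -/
structure AdjointInverse {a b : B} (f : a ⟶ b) where
  /-- the inverse 1-morphism -/
  inv : b ⟶ a
  /-- the unit -/
  unit : 𝟙 a ≅ f ≫ inv
  /-- the counit -/
  counit : inv ≫ f ≅ 𝟙 b
  left_triangle : leftZigzagIso unit counit = λ_ f ≪≫ (ρ_ f).symm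

/-- A 1-morphism is an equivalence if it is invertible up to 2-isomorphism. -/
def IsEquiv {a b : B} (f : a ⟶ b) : Prop :=
  ∃ g : b ⟶ a, Nonempty (f ≫ g ≅ 𝟙 a) ∧ Nonempty (g ≫ f ≅ 𝟙 b)

/-- Two objects are equivalent if there is an equivalence between them. -/
def Equivalent (a b : B) : Prop := ∃ f : a ⟶ b, IsEquiv f

/-- A square of 1-morphisms filled with an invertible 2-morphism. -/
abbrev Sq {a a' b b' : B} (f : a ⟶ a') (p : a ⟶ b) (p' : a' ⟶ b') (g : b ⟶ b') : Type w :=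
  f ≫ p' ≅ p ≫ g

namespace Sq

variable {a a' b b' c c' : B}

/-- The square with identity sides. -/
def refl (f : a ⟶ a') : Sq f (𝟙 a) (𝟙 a') f := ρ_ f ≪≫ (λ_ f).symm

/-- Pasting of squares. -/
def comp {f : a ⟶ a'} {g : b ⟶ b'} {h : c ⟶ c'} {p : a ⟶ b} {p' : a' ⟶ b'} {q : b ⟶ c}
    {q' : b' ⟶ c'} (s : Sq f p p' g) (t : Sq g q q' h) : Sq f (p ≫ q) (p' ≫ q') h :=
  (α_ f p' q').symm ≪≫ whiskerRightIso s q' ≪≫ α_ p g q' ≪≫ whiskerLeftIso p t ≪≫ (α_ p q h).symm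

/-- The mate of a square whose sides have adjoint inverses. -/
def inv {f : a ⟶ a'} {g : b ⟶ b'} {p : a ⟶ b} {p' : a' ⟶ b'} (s : Sq f p p' g)
    (e : AdjointInverse p) (e' : AdjointInverse p') : Sq g e.inv e'.inv f :=
  (λ_ _).symm ≪≫ whiskerRightIso e.counit.symm (g ≫ e'.inv) ≪⊗≫
    whiskerLeftIso e.inv (whiskerRightIso s.symm e'.inv) ≪⊗≫
    whiskerLeftIso (e.inv ≫ f) e'.unit.symm ≪≫ ρ_ _

/-- Compatibility of two squares with 2-isomorphisms between their sides: the naturality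
condition for a modification. -/
def Compat {f : a ⟶ a'} {g : b ⟶ b'} {p q : a ⟶ b} {p' q' : a' ⟶ b'}
    (s : Sq f p p' g) (t : Sq f q q' g) (m : p ≅ q) (m' : p' ≅ q') : Prop :=
  whiskerLeftIso f m' ≪≫ t = s ≪≫ whiskerRightIso m g

end Sq

end General

/-! ### Tensor products, associators and unitors -/

/-- A bicategory with a tensor product pseudofunctor, a unit object, and associator and unitor
pseudonatural adjoint equivalences. -/
class TensorBicategory (B : Type u) [Bicategory.{w, v} B] where
  /-- the tensor product -/
  tensor : (B × B) ⥤ᵖ B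
  /-- the unit object -/
  unit : B
  /-- the associator `(x ⊗ y) ⊗ z ⟶ x ⊗ (y ⊗ z)` -/
  assoc : Pseudofunctor.StrongTrans
    (ptens tensor (ptens tensor (tr₁ B) (tr₂ B)) (tr₃ B))
    (ptens tensor (tr₁ B) (ptens tensor (tr₂ B) (tr₃ B)))
  /-- the left unitor `1 ⊗ x ⟶ x` -/
  left : Pseudofunctor.StrongTrans
    (ptens tensor (constant B unit) (Pseudofunctor.id B)) (Pseudofunctor.id B)
  /-- the right unitor `x ⊗ 1 ⟶ x` -/
  right : Pseudofunctor.StrongTrans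
    (ptens tensor (Pseudofunctor.id B) (constant B unit)) (Pseudofunctor.id B)
  /-- the associator is an adjoint equivalence -/
  assocInverse (x y z : B) : AdjointInverse (assoc.app (x, y, z))
  /-- the left unitor is an adjoint equivalence -/
  leftInverse (x : B) : AdjointInverse (left.app x)
  /-- the right unitor is an adjoint equivalence -/
  rightInverse (x : B) : AdjointInverse (right.app x)

section Tensor

variable {B : Type u} [Bicategory.{w, v} B] [TensorBicategory B]

/-- The unit object. -/
def tunit (B : Type u) [Bicategory.{w, v} B] [TensorBicategory B] : B := TensorBicategory.unit

/-- Tensor product of objects. -/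
def ten (x y : B) : B := TensorBicategory.tensor.obj (x, y)

local infixr:83 " ⊠ " => ten

/-- Tensor product of 1-morphisms. -/
def tenH {x x' y y' : B} (f : x ⟶ x') (g : y ⟶ y') : x ⊠ y ⟶ x' ⊠ y' :=
  TensorBicategory.tensor.map (Prod.mkHom f g)

local infixr:83 " ⊠₁ " => tenH

/-- Tensor product of 2-morphisms. -/
def ten₂ {x x' y y' : B} {f f' : x ⟶ x'} {g g' : y ⟶ y'} (η : f ⟶ f') (θ : g ⟶ g') :
    f ⊠₁ g ⟶ f' ⊠₁ g' :=
  TensorBicategory.tensor.map₂ (f := Prod.mkHom f g) (g := Prod.mkHom f' g') (Prod.mkHom η θ)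

/-- Tensor product of 2-isomorphisms. -/
def tenIso {x x' y y' : B} {f f' : x ⟶ x'} {g g' : y ⟶ y'} (η : f ≅ f') (θ : g ≅ g') :
    f ⊠₁ g ≅ f' ⊠₁ g' :=
  TensorBicategory.tensor.map₂Iso (f := Prod.mkHom f g) (g := Prod.mkHom f' g') (Iso.prod η θ)

/-- The tensor product of identities is the identity. -/
def tenId (x y : B) : 𝟙 x ⊠₁ 𝟙 y ≅ 𝟙 (x ⊠ y) := TensorBicategory.tensor.mapId (x, y)

/-- The tensor product is compatible with composition. -/
def tenComp {x x' x'' y y' y'' : B} (f : x ⟶ x') (f' : x' ⟶ x'') (g : y ⟶ y') (g' : y' ⟶ y'') :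
    (f ≫ f') ⊠₁ (g ≫ g') ≅ f ⊠₁ g ≫ f' ⊠₁ g' :=
  TensorBicategory.tensor.mapComp (Prod.mkHom f g) (Prod.mkHom f' g')

/-- Tensor product of squares. -/
def tenSq {a a' b b' c c' d d' : B} {f : a ⟶ a'} {p : a ⟶ b} {p' : a' ⟶ b'} {g : b ⟶ b'}
    {h : c ⟶ c'} {q : c ⟶ d} {q' : c' ⟶ d'} {k : d ⟶ d'} (s : Sq f p p' g) (t : Sq h q q' k) :
    Sq (f ⊠₁ h) (p ⊠₁ q) (p' ⊠₁ q') (g ⊠₁ k) :=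
  (tenComp f p' h q').symm ≪≫ tenIso s t ≪≫ tenComp p g q k

/-- Left whiskering `x ⊗ f`. -/
def wl (x : B) {y y' : B} (f : y ⟶ y') : x ⊠ y ⟶ x ⊠ y' := 𝟙 x ⊠₁ f

/-- Right whiskering `f ⊗ y`. -/
def wr {x x' : B} (f : x ⟶ x') (y : B) : x ⊠ y ⟶ x' ⊠ y := f ⊠₁ 𝟙 y

local infixr:85 " ◃ " => wl
local infixl:85 " ▹ " => wr

/-- `x ⊗ -` on 2-isomorphisms. -/
def wlIso (x : B) {y y' : B} {f g : y ⟶ y'} (θ : f ≅ g) : x ◃ f ≅ x ◃ g := tenIso (Iso.refl _) θ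

/-- `- ⊗ y` on 2-isomorphisms. -/
def wrIso {x x' : B} {f g : x ⟶ x'} (θ : f ≅ g) (y : B) : f ▹ y ≅ g ▹ y := tenIso θ (Iso.refl _)

/-- `x ⊗ -` preserves identities. -/
def wlId (x y : B) : x ◃ 𝟙 y ≅ 𝟙 (x ⊠ y) := tenId x y

/-- `- ⊗ y` preserves identities. -/
def wrId (x y : B) : 𝟙 x ▹ y ≅ 𝟙 (x ⊠ y) := tenId x y

/-- `x ⊗ -` preserves composition. -/
def wlComp (x : B) {y y' y'' : B} (f : y ⟶ y') (g : y' ⟶ y'') : x ◃ (f ≫ g) ≅ x ◃ f ≫ x ◃ g :=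
  tenIso (λ_ (𝟙 x)).symm (Iso.refl _) ≪≫ tenComp (𝟙 x) (𝟙 x) f g

/-- `- ⊗ y` preserves composition. -/
def wrComp {x x' x'' : B} (f : x ⟶ x') (g : x' ⟶ x'') (y : B) : (f ≫ g) ▹ y ≅ f ▹ y ≫ g ▹ y :=
  tenIso (Iso.refl _) (λ_ (𝟙 y)).symm ≪≫ tenComp f g (𝟙 y) (𝟙 y)

/-- `x ⊗ -` preserves triple composition. -/
def wlComp₃ (x : B) {y y' y'' y₃ : B} (f : y ⟶ y') (g : y' ⟶ y'') (h : y'' ⟶ y₃) :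
    x ◃ (f ≫ g ≫ h) ≅ x ◃ f ≫ x ◃ g ≫ x ◃ h :=
  wlComp x f (g ≫ h) ≪≫ whiskerLeftIso (x ◃ f) (wlComp x g h)

/-- `- ⊗ y` preserves triple composition. -/
def wrComp₃ {x x' x'' x₃ : B} (f : x ⟶ x') (g : x' ⟶ x'') (h : x'' ⟶ x₃) (y : B) :
    (f ≫ g ≫ h) ▹ y ≅ f ▹ y ≫ g ▹ y ≫ h ▹ y :=
  wrComp f (g ≫ h) y ≪≫ whiskerLeftIso (f ▹ y) (wrComp g h y)

/-- `x ⊗ -` preserves composition of five 1-morphisms. -/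
def wlComp₅ (x : B) {y₀ y₁ y₂ y₃ y₄ y₅ : B} (f : y₀ ⟶ y₁) (g : y₁ ⟶ y₂) (h : y₂ ⟶ y₃)
    (k : y₃ ⟶ y₄) (l : y₄ ⟶ y₅) :
    x ◃ (f ≫ g ≫ h ≫ k ≫ l) ≅ x ◃ f ≫ x ◃ g ≫ x ◃ h ≫ x ◃ k ≫ x ◃ l :=
  wlComp x f _ ≪≫ whiskerLeftIso (x ◃ f) (wlComp x g _ ≪≫ whiskerLeftIso (x ◃ g) (wlComp₃ x h k l))

/-- `- ⊗ y` preserves composition of five 1-morphisms. -/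
def wrComp₅ {x₀ x₁ x₂ x₃ x₄ x₅ : B} (f : x₀ ⟶ x₁) (g : x₁ ⟶ x₂) (h : x₂ ⟶ x₃)
    (k : x₃ ⟶ x₄) (l : x₄ ⟶ x₅) (y : B) :
    (f ≫ g ≫ h ≫ k ≫ l) ▹ y ≅ f ▹ y ≫ g ▹ y ≫ h ▹ y ≫ k ▹ y ≫ l ▹ y :=
  wrComp f _ y ≪≫ whiskerLeftIso (f ▹ y) (wrComp g _ y ≪≫ whiskerLeftIso (g ▹ y) (wrComp₃ h k l y))

/-- Interchange of `f ⊗ -` and `- ⊗ g`. -/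
def interchange {x x' y y' : B} (f : x ⟶ x') (g : y ⟶ y') :
    x ◃ g ≫ f ▹ y' ≅ f ▹ y ≫ x' ◃ g :=
  (tenComp (𝟙 x) f g (𝟙 y')).symm ≪≫ tenIso (λ_ f ≪≫ (ρ_ f).symm) (ρ_ g ≪≫ (λ_ g).symm) ≪≫
    tenComp f (𝟙 x') (𝟙 y) g

/-- The associator. -/
def asc (x y z : B) : (x ⊠ y) ⊠ z ⟶ x ⊠ (y ⊠ z) := TensorBicategory.assoc.app (x, y, z)

/-- The inverse associator. -/
def isc (x y z : B) : x ⊠ (y ⊠ z) ⟶ (x ⊠ y) ⊠ z := (TensorBicategory.assocInverse x y z).inv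

/-- The associator followed by its inverse. -/
def ascIsc (x y z : B) : asc x y z ≫ isc x y z ≅ 𝟙 ((x ⊠ y) ⊠ z) :=
  (TensorBicategory.assocInverse x y z).unit.symm

/-- The inverse associator followed by the associator. -/
def iscAsc (x y z : B) : isc x y z ≫ asc x y z ≅ 𝟙 (x ⊠ (y ⊠ z)) :=
  (TensorBicategory.assocInverse x y z).counit

/-- The left unitor. -/
def lun (x : B) : tunit B ⊠ x ⟶ x := TensorBicategory.left.app x

/-- The right unitor. -/
def run (x : B) : x ⊠ tunit B ⟶ x := TensorBicategory.right.app x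

/-- The inverse left unitor. -/
def lunInv (x : B) : x ⟶ tunit B ⊠ x := (TensorBicategory.leftInverse x).inv

/-- The inverse right unitor. -/
def runInv (x : B) : x ⟶ x ⊠ tunit B := (TensorBicategory.rightInverse x).inv

/-- Naturality of the associator. -/
def ascSq {x x' y y' z z' : B} (f : x ⟶ x') (g : y ⟶ y') (h : z ⟶ z') :
    Sq ((f ⊠₁ g) ⊠₁ h) (asc x y z) (asc x' y' z') (f ⊠₁ (g ⊠₁ h)) :=
  TensorBicategory.assoc.naturality (a := (x, y, z)) (b := (x', y', z'))
    (Prod.mkHom f (Prod.mkHom g h))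

/-- Naturality of the inverse associator. -/
def iscSq {x x' y y' z z' : B} (f : x ⟶ x') (g : y ⟶ y') (h : z ⟶ z') :
    Sq (f ⊠₁ (g ⊠₁ h)) (isc x y z) (isc x' y' z') ((f ⊠₁ g) ⊠₁ h) :=
  Sq.inv (ascSq f g h) (TensorBicategory.assocInverse x y z)
    (TensorBicategory.assocInverse x' y' z')

/-- Naturality of the left unitor. -/
def lunSq {x x' : B} (f : x ⟶ x') : Sq (𝟙 (tunit B) ⊠₁ f) (lun x) (lun x') f :=
  TensorBicategory.left.naturality f

/-- Naturality of the right unitor. -/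
def runSq {x x' : B} (f : x ⟶ x') : Sq (f ⊠₁ 𝟙 (tunit B)) (run x) (run x') f :=
  TensorBicategory.right.naturality f

/-! Naturality of the associator in each variable separately. -/

/-- Naturality of the associator in the first variable. -/
def asc₁ {x x' : B} (f : x ⟶ x') (y z : B) :
    f ▹ y ▹ z ≫ asc x' y z ≅ asc x y z ≫ f ▹ (y ⊠ z) :=
  ascSq f (𝟙 y) (𝟙 z) ≪≫ whiskerLeftIso (asc x y z) (tenIso (Iso.refl f) (tenId y z))

/-- Naturality of the associator in the second variable. -/
def asc₂ (x : B) {y y' : B} (f : y ⟶ y') (z : B) :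
    (x ◃ f) ▹ z ≫ asc x y' z ≅ asc x y z ≫ x ◃ (f ▹ z) :=
  ascSq (𝟙 x) f (𝟙 z)

/-- Naturality of the associator in the third variable. -/
def asc₃ (x y : B) {z z' : B} (f : z ⟶ z') :
    (x ⊠ y) ◃ f ≫ asc x y z' ≅ asc x y z ≫ x ◃ y ◃ f :=
  whiskerRightIso (tenIso (tenId x y).symm (Iso.refl f)) (asc x y z') ≪≫ ascSq (𝟙 x) (𝟙 y) f

/-- Naturality of the inverse associator in the first variable. -/
def isc₁ {x x' : B} (f : x ⟶ x') (y z : B) :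
    f ▹ (y ⊠ z) ≫ isc x' y z ≅ isc x y z ≫ f ▹ y ▹ z :=
  Sq.inv (asc₁ f y z) (TensorBicategory.assocInverse x y z)
    (TensorBicategory.assocInverse x' y z)

/-- Naturality of the inverse associator in the second variable. -/
def isc₂ (x : B) {y y' : B} (f : y ⟶ y') (z : B) :
    x ◃ (f ▹ z) ≫ isc x y' z ≅ isc x y z ≫ (x ◃ f) ▹ z :=
  Sq.inv (asc₂ x f z) (TensorBicategory.assocInverse x y z)
    (TensorBicategory.assocInverse x y' z)

/-- Naturality of the inverse associator in the third variable. -/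
def isc₃ (x y : B) {z z' : B} (f : z ⟶ z') :
    x ◃ y ◃ f ≫ isc x y z' ≅ isc x y z ≫ (x ⊠ y) ◃ f :=
  Sq.inv (asc₃ x y f) (TensorBicategory.assocInverse x y z)
    (TensorBicategory.assocInverse x y z')

/-! Cancellation of whiskered associators. -/

/-- `x ⊗ -` preserves cancelling pairs. -/
def wlCancel (x : B) {y y' : B} {f : y ⟶ y'} {g : y' ⟶ y} (θ : f ≫ g ≅ 𝟙 y) :
    x ◃ f ≫ x ◃ g ≅ 𝟙 (x ⊠ y) :=
  (wlComp x f g).symm ≪≫ wlIso x θ ≪≫ wlId x y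

/-- `- ⊗ y` preserves cancelling pairs. -/
def wrCancel {x x' : B} {f : x ⟶ x'} {g : x' ⟶ x} (θ : f ≫ g ≅ 𝟙 x) (y : B) :
    f ▹ y ≫ g ▹ y ≅ 𝟙 (x ⊠ y) :=
  (wrComp f g y).symm ≪≫ wrIso θ y ≪≫ wrId x y

/-- Removing a cancelling pair in the middle of a composite. -/
def cancelMid {a b c d : B} (p : a ⟶ b) {f : b ⟶ c} {g : c ⟶ b} (θ : f ≫ g ≅ 𝟙 b) (q : b ⟶ d) :
    p ≫ f ≫ g ≫ q ≅ p ≫ q :=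
  whiskerLeftIso p ((α_ f g q).symm ≪≫ whiskerRightIso θ q ≪≫ λ_ q)

/-- Removing a cancelling pair at the beginning of a composite. -/
def cancelFst {b c d : B} {f : b ⟶ c} {g : c ⟶ b} (θ : f ≫ g ≅ 𝟙 b) (q : b ⟶ d) :
    f ≫ g ≫ q ≅ q :=
  (α_ f g q).symm ≪≫ whiskerRightIso θ q ≪≫ λ_ q

/-- Removing a cancelling pair at the end of a composite. -/
def cancelLst {a b c : B} (p : a ⟶ b) {f : b ⟶ c} {g : c ⟶ b} (θ : f ≫ g ≅ 𝟙 b) :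
    p ≫ f ≫ g ≅ p :=
  whiskerLeftIso p θ ≪≫ ρ_ p

/-- Applying a 2-isomorphism in the middle of a composite. -/
abbrev mid {a b c d : B} (p : a ⟶ b) {f g : b ⟶ c} (θ : f ≅ g) (q : c ⟶ d) :
    p ≫ f ≫ q ≅ p ≫ g ≫ q :=
  whiskerLeftIso p (whiskerRightIso θ q)

end Tensor
end SylCentre

namespace SylCentre

local infixr:83 " ⊠ " => ten
local infixr:83 " ⊠₁ " => tenH
local infixr:85 " ◃ " => wl
local infixl:85 " ▹ " => wr

/-! ### Monoidal bicategories -/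

section Monoidal

variable {B : Type u} [Bicategory.{w, v} B] [TensorBicategory B]

/-- The type of a pentagonator 2-cell. -/
abbrev Pent (x y z t : B) : Type w :=
  asc x y z ▹ t ≫ asc x (y ⊠ z) t ≫ x ◃ asc y z t ≅ asc (x ⊠ y) z t ≫ asc x y (z ⊠ t)

/-- A pentagonator 2-cell tensored on the left with an object. -/
def pentL (s : B) {x y z t : B} (π : Pent x y z t) :
    s ◃ (asc x y z ▹ t) ≫ s ◃ asc x (y ⊠ z) t ≫ s ◃ x ◃ asc y z t ≅
      s ◃ asc (x ⊠ y) z t ≫ s ◃ asc x y (z ⊠ t) :=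
  (wlComp₃ s _ _ _).symm ≪≫ wlIso s π ≪≫ wlComp s _ _

/-- A pentagonator 2-cell tensored on the right with an object. -/
def pentR {x y z t : B} (π : Pent x y z t) (s : B) :
    asc x y z ▹ t ▹ s ≫ asc x (y ⊠ z) t ▹ s ≫ (x ◃ asc y z t) ▹ s ≅
      asc (x ⊠ y) z t ▹ s ≫ asc x y (z ⊠ t) ▹ s :=
  (wrComp₃ _ _ _ s).symm ≪≫ wrIso π s ≪≫ wrComp _ _ s

/-- One half of the associahedron. -/
def assocFst (π : ∀ x y z t : B, Pent x y z t) (s x y z t : B) :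
    asc s x y ▹ z ▹ t ≫ asc s (x ⊠ y) z ▹ t ≫ (s ◃ asc x y z) ▹ t ≫ asc s (x ⊠ y ⊠ z) t ≫
      s ◃ asc x (y ⊠ z) t ≫ s ◃ x ◃ asc y z t ≅
    asc ((s ⊠ x) ⊠ y) z t ≫ asc (s ⊠ x) y (z ⊠ t) ≫ asc s x (y ⊠ z ⊠ t) :=
  Iso.refl _ ≪⊗≫
  whiskerRightIso (pentR (π s x y z) t)
    (asc s (x ⊠ y ⊠ z) t ≫ s ◃ asc x (y ⊠ z) t ≫ s ◃ x ◃ asc y z t) ≪⊗≫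
  mid (asc (s ⊠ x) y z ▹ t) (π s x (y ⊠ z) t) (s ◃ x ◃ asc y z t) ≪⊗≫
  whiskerLeftIso (asc (s ⊠ x) y z ▹ t ≫ asc (s ⊠ x) (y ⊠ z) t) (asc₃ s x (asc y z t)).symm ≪⊗≫
  whiskerRightIso (π (s ⊠ x) y z t) (asc s x (y ⊠ z ⊠ t)) ≪⊗≫
  Iso.refl _

/-- The other half of the associahedron. -/
def assocSnd (π : ∀ x y z t : B, Pent x y z t) (s x y z t : B) :
    asc s x y ▹ z ▹ t ≫ asc s (x ⊠ y) z ▹ t ≫ (s ◃ asc x y z) ▹ t ≫ asc s (x ⊠ y ⊠ z) t ≫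
      s ◃ asc x (y ⊠ z) t ≫ s ◃ x ◃ asc y z t ≅
    asc ((s ⊠ x) ⊠ y) z t ≫ asc (s ⊠ x) y (z ⊠ t) ≫ asc s x (y ⊠ z ⊠ t) :=
  Iso.refl _ ≪⊗≫
  mid (asc s x y ▹ z ▹ t ≫ asc s (x ⊠ y) z ▹ t) (asc₂ s (asc x y z) t)
    (s ◃ asc x (y ⊠ z) t ≫ s ◃ x ◃ asc y z t) ≪⊗≫
  whiskerLeftIso (asc s x y ▹ z ▹ t ≫ asc s (x ⊠ y) z ▹ t ≫ asc s ((x ⊠ y) ⊠ z) t)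
    (pentL s (π x y z t)) ≪⊗≫
  mid (asc s x y ▹ z ▹ t) (π s (x ⊠ y) z t) (s ◃ asc x y (z ⊠ t)) ≪⊗≫
  whiskerRightIso (asc₁ (asc s x y) z t) (asc s (x ⊠ y) (z ⊠ t) ≫ s ◃ asc x y (z ⊠ t)) ≪⊗≫
  whiskerLeftIso (asc ((s ⊠ x) ⊠ y) z t) (π s x y (z ⊠ t))

end Monoidal

/-- A monoidal bicategory (tricategory with one object): pentagonator `π` and 2-unitors `lam`, `mu`,
`rho` are invertible modifications satisfying the associahedron and the two normalisation axioms. -/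
class MonoidalBicategory (B : Type u) [Bicategory.{w, v} B] extends TensorBicategory B where
  /-- the pentagonator -/
  pent (x y z t : B) : Pent x y z t
  /-- the left 2-unitor -/
  lam (x y : B) : lun x ▹ y ≅ asc (tunit B) x y ≫ lun (x ⊠ y)
  /-- the middle 2-unitor -/
  mu (x y : B) : run x ▹ y ≅ asc x (tunit B) y ≫ x ◃ lun y
  /-- the right 2-unitor -/
  rho (x y : B) : run (x ⊠ y) ≅ asc x y (tunit B) ≫ x ◃ run y
  pent_natural {x x' y y' z z' t t' : B} (f : x ⟶ x') (g : y ⟶ y') (h : z ⟶ z') (k : t ⟶ t') :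
    Sq.Compat
      (Sq.comp (tenSq (ascSq f g h) (Sq.refl k))
        (Sq.comp (ascSq f (g ⊠₁ h) k) (tenSq (Sq.refl f) (ascSq g h k))))
      (Sq.comp (ascSq (f ⊠₁ g) h k) (ascSq f g (h ⊠₁ k)))
      (pent x y z t) (pent x' y' z' t')
  lam_natural {x x' y y' : B} (f : x ⟶ x') (g : y ⟶ y') :
    Sq.Compat (tenSq (lunSq f) (Sq.refl g))
      (Sq.comp (ascSq (𝟙 (tunit B)) f g) (lunSq (f ⊠₁ g))) (lam x y) (lam x' y')
  mu_natural {x x' y y' : B} (f : x ⟶ x') (g : y ⟶ y') :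
    Sq.Compat (tenSq (runSq f) (Sq.refl g))
      (Sq.comp (ascSq f (𝟙 (tunit B)) g) (tenSq (Sq.refl f) (lunSq g))) (mu x y) (mu x' y')
  rho_natural {x x' y y' : B} (f : x ⟶ x') (g : y ⟶ y') :
    Sq.Compat (runSq (f ⊠₁ g))
      (Sq.comp (ascSq f g (𝟙 (tunit B))) (tenSq (Sq.refl f) (runSq g))) (rho x y) (rho x' y')
  associahedron (s x y z t : B) : assocFst pent s x y z t = assocSnd pent s x y z t
  left_normalisation (x y z : B) :
    (whiskerRightIso (wrIso (mu x y) z ≪≫ wrComp _ _ z) (asc x y z) ≪⊗≫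
      whiskerLeftIso (asc x (tunit B) y ▹ z) (asc₂ x (lun y) z) ≪⊗≫
      whiskerLeftIso (asc x (tunit B) y ▹ z ≫ asc x (tunit B ⊠ y) z)
        (wlIso x (lam y z) ≪≫ wlComp x _ _) ≪⊗≫
      whiskerRightIso (pent x (tunit B) y z) (x ◃ lun (y ⊠ z)) ≪⊗≫
      Iso.refl (asc (x ⊠ tunit B) y z ≫ asc x (tunit B) (y ⊠ z) ≫ x ◃ lun (y ⊠ z))) =
    asc₁ (run x) y z ≪≫ whiskerLeftIso (asc (x ⊠ tunit B) y z) (mu x (y ⊠ z))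
  right_normalisation (x y z : B) :
    (whiskerRightIso (wrIso (rho x y) z ≪≫ wrComp _ _ z) (asc x y z) ≪⊗≫
      whiskerLeftIso (asc x y (tunit B) ▹ z) (asc₂ x (run y) z) ≪⊗≫
      whiskerLeftIso (asc x y (tunit B) ▹ z ≫ asc x (y ⊠ tunit B) z)
        (wlIso x (mu y z) ≪≫ wlComp x _ _) ≪⊗≫
      whiskerRightIso (pent x y (tunit B) z) (x ◃ y ◃ lun z) ≪⊗≫
      Iso.refl (asc (x ⊠ y) (tunit B) z ≫ asc x y (tunit B ⊠ z) ≫ x ◃ y ◃ lun z)) =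
    (whiskerRightIso (mu (x ⊠ y) z) (asc x y z) ≪⊗≫
      whiskerLeftIso (asc (x ⊠ y) (tunit B) z) (asc₃ x y (lun z)))

end SylCentre

namespace SylCentre

local infixr:83 " ⊠ " => ten
local infixr:83 " ⊠₁ " => tenH
local infixr:85 " ◃ " => wl
local infixl:85 " ▹ " => wr

/-! ### Mates of the pentagonator -/

section PentMates

variable {B : Type u} [Bicategory.{w, v} B] [MonoidalBicategory B] (x y z t : B)

/-- The pentagonator. -/
def penta : Pent x y z t := MonoidalBicategory.pent x y z t

/-- The mate of the pentagonator for the inverse associators. -/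
def pentInv :
    x ◃ isc y z t ≫ isc x (y ⊠ z) t ≫ isc x y z ▹ t ≅ isc x y (z ⊠ t) ≫ isc (x ⊠ y) z t :=
  Iso.refl _ ≪⊗≫
  (cancelLst (x ◃ isc y z t ≫ isc x (y ⊠ z) t ≫ isc x y z ▹ t)
    (ascIsc (x ⊠ y) z t)).symm ≪⊗≫
  (cancelMid (x ◃ isc y z t ≫ isc x (y ⊠ z) t ≫ isc x y z ▹ t ≫ asc (x ⊠ y) z t)
    (ascIsc x y (z ⊠ t)) (isc (x ⊠ y) z t)).symm ≪⊗≫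
  mid (x ◃ isc y z t ≫ isc x (y ⊠ z) t ≫ isc x y z ▹ t) (penta x y z t).symm
    (isc x y (z ⊠ t) ≫ isc (x ⊠ y) z t) ≪⊗≫
  cancelMid (x ◃ isc y z t ≫ isc x (y ⊠ z) t) (wrCancel (iscAsc x y z) t)
    (asc x (y ⊠ z) t ≫ x ◃ asc y z t ≫ isc x y (z ⊠ t) ≫ isc (x ⊠ y) z t) ≪⊗≫
  cancelMid (x ◃ isc y z t) (iscAsc x (y ⊠ z) t)
    (x ◃ asc y z t ≫ isc x y (z ⊠ t) ≫ isc (x ⊠ y) z t) ≪⊗≫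
  cancelFst (wlCancel x (iscAsc y z t)) (isc x y (z ⊠ t) ≫ isc (x ⊠ y) z t)

/-- A mate of the pentagonator. -/
def pentM₁ :
    asc x y (z ⊠ t) ≫ x ◃ isc y z t ≅ isc (x ⊠ y) z t ≫ asc x y z ▹ t ≫ asc x (y ⊠ z) t :=
  (cancelFst (iscAsc (x ⊠ y) z t) (asc x y (z ⊠ t) ≫ x ◃ isc y z t)).symm ≪⊗≫
  mid (isc (x ⊠ y) z t) (penta x y z t).symm (x ◃ isc y z t) ≪⊗≫
  cancelLst (isc (x ⊠ y) z t ≫ asc x y z ▹ t ≫ asc x (y ⊠ z) t)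
    (wlCancel x (ascIsc y z t)) ≪⊗≫
  Iso.refl _

/-- A mate of the pentagonator. -/
def pentM₂ :
    asc x (y ⊠ z) t ≫ x ◃ asc y z t ≅ isc x y z ▹ t ≫ asc (x ⊠ y) z t ≫ asc x y (z ⊠ t) :=
  (cancelFst (wrCancel (iscAsc x y z) t) (asc x (y ⊠ z) t ≫ x ◃ asc y z t)).symm ≪≫
  whiskerLeftIso (isc x y z ▹ t) (penta x y z t)

/-- A mate of the pentagonator. -/
def pentM₃ :
    isc (x ⊠ y) z t ≫ asc x y z ▹ t ≅ asc x y (z ⊠ t) ≫ x ◃ isc y z t ≫ isc x (y ⊠ z) t :=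
  (cancelLst (isc (x ⊠ y) z t ≫ asc x y z ▹ t) (ascIsc x (y ⊠ z) t)).symm ≪⊗≫
  whiskerRightIso (pentM₁ x y z t).symm (isc x (y ⊠ z) t) ≪⊗≫
  Iso.refl _

/-- A mate of the pentagonator. -/
def pentM₄ :
    isc x (y ⊠ z) t ≫ isc x y z ▹ t ≫ asc (x ⊠ y) z t ≅ x ◃ asc y z t ≫ isc x y (z ⊠ t) :=
  (cancelLst (isc x (y ⊠ z) t ≫ isc x y z ▹ t ≫ asc (x ⊠ y) z t)
    (ascIsc x y (z ⊠ t))).symm ≪⊗≫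
  mid (isc x (y ⊠ z) t) (pentM₂ x y z t).symm (isc x y (z ⊠ t)) ≪⊗≫
  cancelFst (iscAsc x (y ⊠ z) t) (x ◃ asc y z t ≫ isc x y (z ⊠ t))

end PentMates

/-! ### Braidings -/

/-- A monoidal bicategory with a pseudonatural equivalence `x ⊗ y ⟶ y ⊗ x`. -/
class PrebraidedBicategory (B : Type u) [Bicategory.{w, v} B] extends MonoidalBicategory B where
  /-- the braiding `b_{x|y} : x ⊗ y ⟶ y ⊗ x` -/
  braid : Pseudofunctor.StrongTrans (ptens tensor (pr₁ B) (pr₂ B)) (ptens tensor (pr₂ B) (pr₁ B))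
  /-- the braiding is an equivalence -/
  braid_equiv (x y : B) : IsEquiv (braid.app (x, y))

section Hexagon

variable {B : Type u} [Bicategory.{w, v} B] [PrebraidedBicategory B]

/-- The braiding. -/
def br (x y : B) : x ⊠ y ⟶ y ⊠ x := PrebraidedBicategory.braid.app (x, y)

/-- The type of a hexagonator 2-cell `R_{(x|y,z)}`. -/
abbrev HexR (x y z : B) : Type w :=
  br x y ▹ z ≫ asc y x z ≫ y ◃ br x z ≅ asc x y z ≫ br x (y ⊠ z) ≫ asc y z x

/-- The type of a hexagonator 2-cell `S_{(x,y|z)}`. -/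
abbrev HexS (x y z : B) : Type w :=
  x ◃ br y z ≫ isc x z y ≫ br x z ▹ y ≅ isc x y z ≫ br (x ⊠ y) z ≫ isc z x y

/-- Naturality of the braiding. -/
def brSq {x x' y y' : B} (f : x ⟶ x') (g : y ⟶ y') :
    Sq (f ⊠₁ g) (br x y) (br x' y') (g ⊠₁ f) :=
  PrebraidedBicategory.braid.naturality (a := (x, y)) (b := (x', y')) (Prod.mkHom f g)

/-- Naturality of the braiding in the first variable. -/
def br₁ {x x' : B} (f : x ⟶ x') (y : B) : f ▹ y ≫ br x' y ≅ br x y ≫ y ◃ f := brSq f (𝟙 y)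

/-- Naturality of the braiding in the second variable. -/
def br₂ (x : B) {y y' : B} (f : y ⟶ y') : x ◃ f ≫ br x y' ≅ br x y ≫ f ▹ x := brSq (𝟙 x) f

end Hexagon

/-- A prebraided monoidal bicategory with hexagonator 2-isomorphisms `R` and `S`, before imposing
the axioms of a braiding. -/
class HexagonBicategory (B : Type u) [Bicategory.{w, v} B] extends PrebraidedBicategory B where
  /-- the hexagonator `R_{(x|y,z)}` -/
  R (x y z : B) : HexR x y z
  /-- the hexagonator `S_{(x,y|z)}` -/
  S (x y z : B) : HexS x y z

section Decomposition

variable {B : Type u} [Bicategory.{w, v} B] [HexagonBicategory B]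

/-- The hexagonator `R_{(x|y,z)}`. -/
def hexR (x y z : B) : HexR x y z := HexagonBicategory.R x y z

/-- The hexagonator `S_{(x,y|z)}`. -/
def hexS (x y z : B) : HexS x y z := HexagonBicategory.S x y z

/-- The decomposition of `b_{x|yz}` given by `R`. -/
def decompR (x y z : B) :
    br x (y ⊠ z) ≅ isc x y z ≫ br x y ▹ z ≫ asc y x z ≫ y ◃ br x z ≫ isc y z x :=
  (cancelFst (iscAsc x y z) (br x (y ⊠ z))).symm ≪⊗≫
  (cancelLst (isc x y z ≫ asc x y z ≫ br x (y ⊠ z)) (ascIsc y z x)).symm ≪⊗≫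
  mid (isc x y z) (hexR x y z).symm (isc y z x) ≪⊗≫
  Iso.refl _

/-- The decomposition of `b_{xy|z}` given by `S`. -/
def decompS (x y z : B) :
    br (x ⊠ y) z ≅ asc x y z ≫ x ◃ br y z ≫ isc x z y ≫ br x z ▹ y ≫ asc z x y :=
  (cancelFst (ascIsc x y z) (br (x ⊠ y) z)).symm ≪⊗≫
  (cancelLst (asc x y z ≫ isc x y z ≫ br (x ⊠ y) z) (iscAsc z x y)).symm ≪⊗≫
  mid (asc x y z) (hexS x y z).symm (asc z x y) ≪⊗≫
  Iso.refl _

/-- `R_{(x|y,z)}` tensored on the left with `s`. -/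
def hexRL (s x y z : B) :
    s ◃ (br x y ▹ z) ≫ s ◃ asc y x z ≫ s ◃ y ◃ br x z ≅
      s ◃ asc x y z ≫ s ◃ br x (y ⊠ z) ≫ s ◃ asc y z x :=
  (wlComp₃ s _ _ _).symm ≪≫ wlIso s (hexR x y z) ≪≫ wlComp₃ s _ _ _

/-- `R_{(x|y,z)}` tensored on the right with `s`. -/
def hexRR (x y z s : B) :
    br x y ▹ z ▹ s ≫ asc y x z ▹ s ≫ (y ◃ br x z) ▹ s ≅
      asc x y z ▹ s ≫ br x (y ⊠ z) ▹ s ≫ asc y z x ▹ s :=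
  (wrComp₃ _ _ _ s).symm ≪≫ wrIso (hexR x y z) s ≪≫ wrComp₃ _ _ _ s

/-- `S_{(x,y|z)}` tensored on the left with `s`. -/
def hexSL (s x y z : B) :
    s ◃ x ◃ br y z ≫ s ◃ isc x z y ≫ s ◃ (br x z ▹ y) ≅
      s ◃ isc x y z ≫ s ◃ br (x ⊠ y) z ≫ s ◃ isc z x y :=
  (wlComp₃ s _ _ _).symm ≪≫ wlIso s (hexS x y z) ≪≫ wlComp₃ s _ _ _

/-- `S_{(x,y|z)}` tensored on the right with `s`. -/
def hexSR (x y z s : B) :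
    (x ◃ br y z) ▹ s ≫ isc x z y ▹ s ≫ br x z ▹ y ▹ s ≅
      isc x y z ▹ s ≫ br (x ⊠ y) z ▹ s ≫ isc z x y ▹ s :=
  (wrComp₃ _ _ _ s).symm ≪≫ wrIso (hexS x y z) s ≪≫ wrComp₃ _ _ _ s

/-- `b_{x|(yz)t}` from `R_{(x|y,z)}` and `R_{(x|yz,t)}`. -/
def braidR₁ (x y z t : B) :
    br x y ▹ z ▹ t ≫ asc y x z ▹ t ≫ (y ◃ br x z) ▹ t ≫ asc y (z ⊠ x) t ≫ y ◃ asc z x t ≫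
      y ◃ z ◃ br x t ≅
    asc (x ⊠ y) z t ≫ asc x y (z ⊠ t) ≫ br x (y ⊠ z ⊠ t) ≫ asc y (z ⊠ t) x ≫ y ◃ asc z t x :=
  Iso.refl _ ≪⊗≫
  whiskerRightIso (hexRR x y z t) (asc y (z ⊠ x) t ≫ y ◃ asc z x t ≫ y ◃ z ◃ br x t) ≪⊗≫
  mid (asc x y z ▹ t ≫ br x (y ⊠ z) ▹ t) (penta y z x t) (y ◃ z ◃ br x t) ≪⊗≫
  whiskerLeftIso (asc x y z ▹ t ≫ br x (y ⊠ z) ▹ t ≫ asc (y ⊠ z) x t)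
    (asc₃ y z (br x t)).symm ≪⊗≫
  mid (asc x y z ▹ t) (hexR x (y ⊠ z) t) (asc y z (t ⊠ x)) ≪⊗≫
  whiskerLeftIso (asc x y z ▹ t ≫ asc x (y ⊠ z) t ≫ br x ((y ⊠ z) ⊠ t))
    (penta y z t x).symm ≪⊗≫
  mid (asc x y z ▹ t ≫ asc x (y ⊠ z) t) (br₂ x (asc y z t)).symm
    (asc y (z ⊠ t) x ≫ y ◃ asc z t x) ≪⊗≫
  whiskerRightIso (penta x y z t) (br x (y ⊠ z ⊠ t) ≫ asc y (z ⊠ t) x ≫ y ◃ asc z t x) ≪⊗≫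
  Iso.refl _

/-- `b_{x|y(zt)}` from `R_{(x|z,t)}` and `R_{(x|y,zt)}`. -/
def braidR₂ (x y z t : B) :
    br x y ▹ z ▹ t ≫ asc y x z ▹ t ≫ (y ◃ br x z) ▹ t ≫ asc y (z ⊠ x) t ≫ y ◃ asc z x t ≫
      y ◃ z ◃ br x t ≅
    asc (x ⊠ y) z t ≫ asc x y (z ⊠ t) ≫ br x (y ⊠ z ⊠ t) ≫ asc y (z ⊠ t) x ≫ y ◃ asc z t x :=
  Iso.refl _ ≪⊗≫
  mid (br x y ▹ z ▹ t ≫ asc y x z ▹ t) (asc₂ y (br x z) t)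
    (y ◃ asc z x t ≫ y ◃ z ◃ br x t) ≪⊗≫
  whiskerLeftIso (br x y ▹ z ▹ t ≫ asc y x z ▹ t ≫ asc y (x ⊠ z) t) (hexRL y x z t) ≪⊗≫
  mid (br x y ▹ z ▹ t) (penta y x z t) (y ◃ br x (z ⊠ t) ≫ y ◃ asc z t x) ≪⊗≫
  whiskerRightIso (asc₁ (br x y) z t)
    (asc y x (z ⊠ t) ≫ y ◃ br x (z ⊠ t) ≫ y ◃ asc z t x) ≪⊗≫
  mid (asc (x ⊠ y) z t) (hexR x y (z ⊠ t)) (y ◃ asc z t x) ≪⊗≫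
  Iso.refl _

/-- `b_{x(yz)|t}` from `S_{(y,z|t)}` and `S_{(x,yz|t)}`. -/
def braidS₁ (x y z t : B) :
    x ◃ y ◃ br z t ≫ x ◃ isc y t z ≫ x ◃ (br y t ▹ z) ≫ isc x (t ⊠ y) z ≫ isc x t y ▹ z ≫
      br x t ▹ y ▹ z ≅
    isc x y (z ⊠ t) ≫ isc (x ⊠ y) z t ≫ br ((x ⊠ y) ⊠ z) t ≫ isc t (x ⊠ y) z ≫ isc t x y ▹ z :=
  Iso.refl _ ≪⊗≫
  whiskerRightIso (hexSL x y z t) (isc x (t ⊠ y) z ≫ isc x t y ▹ z ≫ br x t ▹ y ▹ z) ≪⊗≫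
  mid (x ◃ isc y z t ≫ x ◃ br (y ⊠ z) t) (pentInv x t y z) (br x t ▹ y ▹ z) ≪⊗≫
  whiskerLeftIso (x ◃ isc y z t ≫ x ◃ br (y ⊠ z) t ≫ isc x t (y ⊠ z))
    (isc₁ (br x t) y z).symm ≪⊗≫
  mid (x ◃ isc y z t) (hexS x (y ⊠ z) t) (isc (t ⊠ x) y z) ≪⊗≫
  whiskerLeftIso (x ◃ isc y z t ≫ isc x (y ⊠ z) t ≫ br (x ⊠ y ⊠ z) t)
    (pentInv t x y z).symm ≪⊗≫
  mid (x ◃ isc y z t ≫ isc x (y ⊠ z) t) (br₁ (isc x y z) t).symm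
    (isc t (x ⊠ y) z ≫ isc t x y ▹ z) ≪⊗≫
  whiskerRightIso (pentInv x y z t)
    (br ((x ⊠ y) ⊠ z) t ≫ isc t (x ⊠ y) z ≫ isc t x y ▹ z) ≪⊗≫
  Iso.refl _

/-- `b_{(xy)z|t}` from `S_{(x,y|t)}` and `S_{(xy,z|t)}`. -/
def braidS₂ (x y z t : B) :
    x ◃ y ◃ br z t ≫ x ◃ isc y t z ≫ x ◃ (br y t ▹ z) ≫ isc x (t ⊠ y) z ≫ isc x t y ▹ z ≫
      br x t ▹ y ▹ z ≅
    isc x y (z ⊠ t) ≫ isc (x ⊠ y) z t ≫ br ((x ⊠ y) ⊠ z) t ≫ isc t (x ⊠ y) z ≫ isc t x y ▹ z :=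
  Iso.refl _ ≪⊗≫
  mid (x ◃ y ◃ br z t ≫ x ◃ isc y t z) (isc₂ x (br y t) z)
    (isc x t y ▹ z ≫ br x t ▹ y ▹ z) ≪⊗≫
  whiskerLeftIso (x ◃ y ◃ br z t ≫ x ◃ isc y t z ≫ isc x (y ⊠ t) z) (hexSR x y t z) ≪⊗≫
  mid (x ◃ y ◃ br z t) (pentInv x y t z) (br (x ⊠ y) t ▹ z ≫ isc t x y ▹ z) ≪⊗≫
  whiskerRightIso (isc₃ x y (br z t))
    (isc (x ⊠ y) t z ≫ br (x ⊠ y) t ▹ z ≫ isc t x y ▹ z) ≪⊗≫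
  mid (isc x y (z ⊠ t)) (hexS (x ⊠ y) z t) (isc t x y ▹ z) ≪⊗≫
  Iso.refl _

/-- Decomposition of `b_{xy|zt}` into four braidings, first by `R` and then by `S`. -/
def braidRS (x y z t : B) :
    br (x ⊠ y) (z ⊠ t) ≅
      isc (x ⊠ y) z t ≫ asc x y z ▹ t ≫ (x ◃ br y z) ▹ t ≫ isc x z y ▹ t ≫ br x z ▹ y ▹ t ≫
        asc z x y ▹ t ≫ asc z (x ⊠ y) t ≫ z ◃ asc x y t ≫ z ◃ x ◃ br y t ≫ z ◃ isc x t y ≫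
        z ◃ (br x t ▹ y) ≫ z ◃ asc t x y ≫ isc z t (x ⊠ y) :=
  decompR (x ⊠ y) z t ≪⊗≫
  mid (isc (x ⊠ y) z t) (wrIso (decompS x y z) t ≪≫ wrComp₅ _ _ _ _ _ t)
    (asc z (x ⊠ y) t ≫ z ◃ br (x ⊠ y) t ≫ isc z t (x ⊠ y)) ≪⊗≫
  mid (isc (x ⊠ y) z t ≫ asc x y z ▹ t ≫ (x ◃ br y z) ▹ t ≫ isc x z y ▹ t ≫ br x z ▹ y ▹ t ≫
      asc z x y ▹ t ≫ asc z (x ⊠ y) t)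
    (wlIso z (decompS x y t) ≪≫ wlComp₅ z _ _ _ _ _) (isc z t (x ⊠ y)) ≪⊗≫
  Iso.refl _

/-- Decomposition of `b_{xy|zt}` into four braidings, first by `S` and then by `R`. -/
def braidSR (x y z t : B) :
    br (x ⊠ y) (z ⊠ t) ≅
      isc (x ⊠ y) z t ≫ asc x y z ▹ t ≫ (x ◃ br y z) ▹ t ≫ isc x z y ▹ t ≫ br x z ▹ y ▹ t ≫
        asc z x y ▹ t ≫ asc z (x ⊠ y) t ≫ z ◃ asc x y t ≫ z ◃ x ◃ br y t ≫ z ◃ isc x t y ≫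
        z ◃ (br x t ▹ y) ≫ z ◃ asc t x y ≫ isc z t (x ⊠ y) :=
  decompS x y (z ⊠ t) ≪⊗≫
  mid (asc x y (z ⊠ t)) (wlIso x (decompR y z t) ≪≫ wlComp₅ x _ _ _ _ _)
    (isc x (z ⊠ t) y ≫ br x (z ⊠ t) ▹ y ≫ asc (z ⊠ t) x y) ≪⊗≫
  mid (asc x y (z ⊠ t) ≫ x ◃ isc y z t ≫ x ◃ (br y z ▹ t) ≫ x ◃ asc z y t ≫ x ◃ z ◃ br y t ≫
      x ◃ isc z t y ≫ isc x (z ⊠ t) y)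
    (wrIso (decompR x z t) y ≪≫ wrComp₅ _ _ _ _ _ y) (asc (z ⊠ t) x y) ≪⊗≫
  whiskerRightIso (pentM₁ x y z t)
    (x ◃ (br y z ▹ t) ≫ x ◃ asc z y t ≫ x ◃ z ◃ br y t ≫ x ◃ isc z t y ≫ isc x (z ⊠ t) y ≫
      isc x z t ▹ y ≫ br x z ▹ t ▹ y ≫ asc z x t ▹ y ≫ (z ◃ br x t) ▹ y ≫ isc z t x ▹ y ≫
      asc (z ⊠ t) x y) ≪⊗≫
  mid (isc (x ⊠ y) z t ≫ asc x y z ▹ t) (asc₂ x (br y z) t).symm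
    (x ◃ asc z y t ≫ x ◃ z ◃ br y t ≫ x ◃ isc z t y ≫ isc x (z ⊠ t) y ≫
      isc x z t ▹ y ≫ br x z ▹ t ▹ y ≫ asc z x t ▹ y ≫ (z ◃ br x t) ▹ y ≫ isc z t x ▹ y ≫
      asc (z ⊠ t) x y) ≪⊗≫
  mid (isc (x ⊠ y) z t ≫ asc x y z ▹ t ≫ (x ◃ br y z) ▹ t) (pentM₂ x z y t)
    (x ◃ z ◃ br y t ≫ x ◃ isc z t y ≫ isc x (z ⊠ t) y ≫
      isc x z t ▹ y ≫ br x z ▹ t ▹ y ≫ asc z x t ▹ y ≫ (z ◃ br x t) ▹ y ≫ isc z t x ▹ y ≫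
      asc (z ⊠ t) x y) ≪⊗≫
  mid (isc (x ⊠ y) z t ≫ asc x y z ▹ t ≫ (x ◃ br y z) ▹ t ≫ isc x z y ▹ t ≫ asc (x ⊠ z) y t ≫
      asc x z (y ⊠ t) ≫ x ◃ z ◃ br y t) (pentInv x z t y)
    (br x z ▹ t ▹ y ≫ asc z x t ▹ y ≫ (z ◃ br x t) ▹ y ≫ isc z t x ▹ y ≫ asc (z ⊠ t) x y) ≪⊗≫
  mid (isc (x ⊠ y) z t ≫ asc x y z ▹ t ≫ (x ◃ br y z) ▹ t ≫ isc x z y ▹ t ≫ asc (x ⊠ z) y t)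
    (asc₃ x z (br y t)).symm
    (isc x z (t ⊠ y) ≫ isc (x ⊠ z) t y ≫ br x z ▹ t ▹ y ≫ asc z x t ▹ y ≫ (z ◃ br x t) ▹ y ≫
      isc z t x ▹ y ≫ asc (z ⊠ t) x y) ≪⊗≫
  cancelMid (isc (x ⊠ y) z t ≫ asc x y z ▹ t ≫ (x ◃ br y z) ▹ t ≫ isc x z y ▹ t ≫
      asc (x ⊠ z) y t ≫ (x ⊠ z) ◃ br y t) (ascIsc x z (t ⊠ y))
    (isc (x ⊠ z) t y ≫ br x z ▹ t ▹ y ≫ asc z x t ▹ y ≫ (z ◃ br x t) ▹ y ≫ isc z t x ▹ y ≫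
      asc (z ⊠ t) x y) ≪⊗≫
  mid (isc (x ⊠ y) z t ≫ asc x y z ▹ t ≫ (x ◃ br y z) ▹ t ≫ isc x z y ▹ t ≫
      asc (x ⊠ z) y t ≫ (x ⊠ z) ◃ br y t) (isc₁ (br x z) t y).symm
    (asc z x t ▹ y ≫ (z ◃ br x t) ▹ y ≫ isc z t x ▹ y ≫ asc (z ⊠ t) x y) ≪⊗≫
  mid (isc (x ⊠ y) z t ≫ asc x y z ▹ t ≫ (x ◃ br y z) ▹ t ≫ isc x z y ▹ t ≫ asc (x ⊠ z) y t)
    (interchange (br x z) (br y t))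
    (isc (z ⊠ x) t y ≫ asc z x t ▹ y ≫ (z ◃ br x t) ▹ y ≫ isc z t x ▹ y ≫
      asc (z ⊠ t) x y) ≪⊗≫
  mid (isc (x ⊠ y) z t ≫ asc x y z ▹ t ≫ (x ◃ br y z) ▹ t ≫ isc x z y ▹ t)
    (asc₁ (br x z) y t).symm
    ((z ⊠ x) ◃ br y t ≫ isc (z ⊠ x) t y ≫ asc z x t ▹ y ≫ (z ◃ br x t) ▹ y ≫ isc z t x ▹ y ≫
      asc (z ⊠ t) x y) ≪⊗≫
  mid (isc (x ⊠ y) z t ≫ asc x y z ▹ t ≫ (x ◃ br y z) ▹ t ≫ isc x z y ▹ t ≫ br x z ▹ y ▹ t ≫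
      asc (z ⊠ x) y t ≫ (z ⊠ x) ◃ br y t) (pentM₃ z x t y)
    ((z ◃ br x t) ▹ y ≫ isc z t x ▹ y ≫ asc (z ⊠ t) x y) ≪⊗≫
  mid (isc (x ⊠ y) z t ≫ asc x y z ▹ t ≫ (x ◃ br y z) ▹ t ≫ isc x z y ▹ t ≫ br x z ▹ y ▹ t ≫
      asc (z ⊠ x) y t) (asc₃ z x (br y t))
    (z ◃ isc x t y ≫ isc z (x ⊠ t) y ≫ (z ◃ br x t) ▹ y ≫ isc z t x ▹ y ≫
      asc (z ⊠ t) x y) ≪⊗≫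
  mid (isc (x ⊠ y) z t ≫ asc x y z ▹ t ≫ (x ◃ br y z) ▹ t ≫ isc x z y ▹ t ≫ br x z ▹ y ▹ t)
    (penta z x y t).symm
    (z ◃ x ◃ br y t ≫ z ◃ isc x t y ≫ isc z (x ⊠ t) y ≫ (z ◃ br x t) ▹ y ≫ isc z t x ▹ y ≫
      asc (z ⊠ t) x y) ≪⊗≫
  mid (isc (x ⊠ y) z t ≫ asc x y z ▹ t ≫ (x ◃ br y z) ▹ t ≫ isc x z y ▹ t ≫ br x z ▹ y ▹ t ≫
      asc z x y ▹ t ≫ asc z (x ⊠ y) t ≫ z ◃ asc x y t ≫ z ◃ x ◃ br y t ≫ z ◃ isc x t y)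
    (isc₂ z (br x t) y).symm (isc z t x ▹ y ≫ asc (z ⊠ t) x y) ≪⊗≫
  whiskerLeftIso (isc (x ⊠ y) z t ≫ asc x y z ▹ t ≫ (x ◃ br y z) ▹ t ≫ isc x z y ▹ t ≫
      br x z ▹ y ▹ t ≫ asc z x y ▹ t ≫ asc z (x ⊠ y) t ≫ z ◃ asc x y t ≫ z ◃ x ◃ br y t ≫
      z ◃ isc x t y ≫ z ◃ (br x t ▹ y)) (pentM₄ z t x y) ≪⊗≫
  Iso.refl _

/-- The Yang-Baxter 2-cell built from `R`. -/
def yangBaxterR (x y z : B) :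
    br x y ▹ z ≫ asc y x z ≫ y ◃ br x z ≫ isc y z x ≫ br y z ▹ x ≫ asc z y x ≅
      asc x y z ≫ x ◃ br y z ≫ isc x z y ≫ br x z ▹ y ≫ asc z x y ≫ z ◃ br x y :=
  Iso.refl _ ≪⊗≫
  whiskerRightIso (hexR x y z) (isc y z x ≫ br y z ▹ x ≫ asc z y x) ≪⊗≫
  cancelMid (asc x y z ≫ br x (y ⊠ z)) (ascIsc y z x) (br y z ▹ x ≫ asc z y x) ≪⊗≫
  mid (asc x y z) (br₂ x (br y z)).symm (asc z y x) ≪⊗≫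
  (cancelMid (asc x y z ≫ x ◃ br y z) (iscAsc x z y) (br x (z ⊠ y) ≫ asc z y x)).symm ≪⊗≫
  whiskerLeftIso (asc x y z ≫ x ◃ br y z ≫ isc x z y) (hexR x z y).symm ≪⊗≫
  Iso.refl _

/-- The Yang-Baxter 2-cell built from `S`. -/
def yangBaxterS (x y z : B) :
    br x y ▹ z ≫ asc y x z ≫ y ◃ br x z ≫ isc y z x ≫ br y z ▹ x ≫ asc z y x ≅
      asc x y z ≫ x ◃ br y z ≫ isc x z y ≫ br x z ▹ y ≫ asc z x y ≫ z ◃ br x y :=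
  Iso.refl _ ≪⊗≫
  mid (br x y ▹ z ≫ asc y x z) (hexS y x z) (asc z y x) ≪⊗≫
  cancelMid (br x y ▹ z) (ascIsc y x z) (br (y ⊠ x) z ≫ isc z y x ≫ asc z y x) ≪⊗≫
  cancelLst (br x y ▹ z ≫ br (y ⊠ x) z) (iscAsc z y x) ≪⊗≫
  br₁ (br x y) z ≪⊗≫
  whiskerRightIso (decompS x y z) (z ◃ br x y) ≪⊗≫
  Iso.refl _

end Decomposition

/-- A braided monoidal bicategory: `R` and `S` are modifications and satisfy the axioms for the
braiding of one object with three, of three with one, of two with two, and the Yang-Baxter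
(Breen) axiom. -/
class BraidedBicategory (B : Type u) [Bicategory.{w, v} B] extends HexagonBicategory B where
  R_natural {x x' y y' z z' : B} (f : x ⟶ x') (g : y ⟶ y') (h : z ⟶ z') :
    Sq.Compat
      (Sq.comp (tenSq (brSq f g) (Sq.refl h))
        (Sq.comp (ascSq g f h) (tenSq (Sq.refl g) (brSq f h))))
      (Sq.comp (ascSq f g h) (Sq.comp (brSq f (g ⊠₁ h)) (ascSq g h f)))
      (hexR x y z) (hexR x' y' z')
  S_natural {x x' y y' z z' : B} (f : x ⟶ x') (g : y ⟶ y') (h : z ⟶ z') :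
    Sq.Compat
      (Sq.comp (tenSq (Sq.refl f) (brSq g h))
        (Sq.comp (iscSq f h g) (tenSq (brSq f h) (Sq.refl g))))
      (Sq.comp (iscSq f g h) (Sq.comp (brSq (f ⊠₁ g) h) (iscSq h f g)))
      (hexS x y z) (hexS x' y' z')
  one_three (x y z t : B) : braidR₁ x y z t = braidR₂ x y z t
  three_one (x y z t : B) : braidS₁ x y z t = braidS₂ x y z t
  two_two (x y z t : B) : braidSR x y z t = braidRS x y z t
  yang_baxter (x y z : B) : yangBaxterR x y z = yangBaxterS x y z

end SylCentre

namespace SylCentre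

local infixr:83 " ⊠ " => ten
local infixr:83 " ⊠₁ " => tenH
local infixr:85 " ◃ " => wl
local infixl:85 " ▹ " => wr

/-! ### The sylleptic centre -/

section Double

variable {B : Type u} [Bicategory.{w, v} B] [PrebraidedBicategory B]

theorem ptens_mapComp {x x' x'' y y' y'' : B} (f : x ⟶ x') (f' : x' ⟶ x'') (g : y ⟶ y')
    (g' : y' ⟶ y'') :
    (ptens TensorBicategory.tensor (pr₁ B) (pr₂ B)).mapComp (a := (x, y)) (b := (x', y'))
      (c := (x'', y'')) (Prod.mkHom f g) (Prod.mkHom f' g') = tenComp f f' g g' := by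
  apply Iso.ext
  refine (congrArg (· ≫ (tenComp f f' g g').hom)
    ((TensorBicategory.tensor (B := B)).map₂_id _)).trans (Category.id_comp _)
theorem ptens_mapComp' {x x' x'' y y' y'' : B} (f : x ⟶ x') (f' : x' ⟶ x'') (g : y ⟶ y')
    (g' : y' ⟶ y'') :
    (ptens TensorBicategory.tensor (pr₂ B) (pr₁ B)).mapComp (a := (x, y)) (b := (x', y'))
      (c := (x'', y'')) (Prod.mkHom f g) (Prod.mkHom f' g') = tenComp g g' f f' := by
  apply Iso.ext
  refine (congrArg (· ≫ (tenComp g g' f f').hom)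
    ((TensorBicategory.tensor (B := B)).map₂_id _)).trans (Category.id_comp _)
theorem ptens_mapId (x y : B) :
    (ptens TensorBicategory.tensor (pr₁ B) (pr₂ B)).mapId (x, y) = tenId x y := by
  apply Iso.ext
  refine (congrArg (· ≫ (tenId x y).hom)
    ((TensorBicategory.tensor (B := B)).map₂_id _)).trans (Category.id_comp _)
theorem ptens_mapId' (x y : B) :
    (ptens TensorBicategory.tensor (pr₂ B) (pr₁ B)).mapId (x, y) = tenId y x := by
  apply Iso.ext
  refine (congrArg (· ≫ (tenId y x).hom)
    ((TensorBicategory.tensor (B := B)).map₂_id _)).trans (Category.id_comp _)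

theorem brSq_comp {x x' x'' y y' y'' : B} (f : x ⟶ x') (f' : x' ⟶ x'') (g : y ⟶ y')
    (g' : y' ⟶ y'') :
    (brSq (f ≫ f') (g ≫ g')).hom =
      (tenComp f f' g g').hom ▷ br x'' y'' ≫ (α_ _ _ _).hom ≫ (f ⊠₁ g) ◁ (brSq f' g').hom ≫
      (α_ _ _ _).inv ≫ (brSq f g).hom ▷ (g' ⊠₁ f') ≫ (α_ _ _ _).hom ≫
      br x y ◁ (tenComp g g' f f').inv := by
  rw [← ptens_mapComp, ← ptens_mapComp']
  exact Pseudofunctor.StrongTrans.naturality_comp_hom (PrebraidedBicategory.braid (B := B))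
    (a := (x, y)) (b := (x', y')) (c := (x'', y'')) (Prod.mkHom f g) (Prod.mkHom f' g')
theorem brSq_natural {x x' y y' : B} {f f' : x ⟶ x'} {g g' : y ⟶ y'} (η : f ⟶ f')
    (θ : g ⟶ g') :
    ten₂ η θ ▷ br x' y' ≫ (brSq f' g').hom = (brSq f g).hom ≫ br x y ◁ ten₂ θ η :=
  (PrebraidedBicategory.braid (B := B)).naturality_naturality
    (a := (x, y)) (b := (x', y')) (f := Prod.mkHom f g) (g := Prod.mkHom f' g') (Prod.mkHom η θ)

theorem brSq_id (x y : B) :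
    (brSq (𝟙 x) (𝟙 y)).hom = (tenId x y).hom ▷ br x y ≫ (λ_ _).hom ≫ (ρ_ _).inv ≫
      br x y ◁ (tenId y x).inv := by
  rw [← ptens_mapId, ← ptens_mapId']
  exact Pseudofunctor.StrongTrans.naturality_id_hom (PrebraidedBicategory.braid (B := B)) (x, y)
/-- Naturality of the double braiding. -/
def doubleSq {x x' y y' : B} (f : x ⟶ x') (g : y ⟶ y') :
    Sq (f ⊠₁ g) (br x y ≫ br y x) (br x' y' ≫ br y' x') (f ⊠₁ g) :=
  Sq.comp (brSq f g) (brSq g f)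

/-- Compatibility of a pair of 1-morphisms with 2-isomorphisms from the double braiding to the
identity. -/
def PairCompat {x x' y y' : B} (f : x ⟶ x') (g : y ⟶ y') (m : br x y ≫ br y x ≅ 𝟙 (x ⊠ y))
    (m' : br x' y' ≫ br y' x' ≅ 𝟙 (x' ⊠ y')) : Prop :=
  Sq.Compat (doubleSq f g) (Sq.refl (f ⊠₁ g)) m m'

theorem doubleSq_hom {x x' y y' : B} (f : x ⟶ x') (g : y ⟶ y') :
    (doubleSq f g).hom = (α_ _ _ _).inv ≫ (brSq f g).hom ▷ br y' x' ≫ (α_ _ _ _).hom ≫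
      br x y ◁ (brSq g f).hom ≫ (α_ _ _ _).inv := by
  simp [doubleSq, Sq.comp]

theorem doubleSq_id (x y : B) : (doubleSq (𝟙 x) (𝟙 y)).hom =
   (tenId x y).hom ▷ _ ≫ (λ_ _).hom ≫ (ρ_ _).inv ≫ _ ◁ (tenId x y).inv := by
  rw [doubleSq_hom, brSq_id, brSq_id]
  simp

theorem doubleSq_comp {x x' x'' y y' y'' : B} (f : x ⟶ x') (f' : x' ⟶ x'') (g : y ⟶ y')
    (g' : y' ⟶ y'') :
    (doubleSq (f ≫ f') (g ≫ g')).hom =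
      (tenComp f f' g g').hom ▷ _ ≫ (α_ _ _ _).hom ≫ (f ⊠₁ g) ◁ (doubleSq f' g').hom ≫
      (α_ _ _ _).inv ≫ (doubleSq f g).hom ▷ (f' ⊠₁ g') ≫ (α_ _ _ _).hom ≫
      _ ◁ (tenComp f f' g g').inv := by
  simp only [doubleSq_hom, brSq_comp]
  have h := whisker_exchange (brSq f g).hom (brSq g' f').hom
  calc _ = (tenComp f f' g g').hom ▷ (br x'' y'' ≫ br y'' x'') ⊗≫
        (f ⊠₁ g) ◁ (brSq f' g').hom ▷ br y'' x'' ⊗≫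
        ((brSq f g).hom ▷ ((g' ⊠₁ f') ≫ br y'' x'') ≫
          (br x y ≫ (g ⊠₁ f)) ◁ (brSq g' f').hom) ⊗≫
        br x y ◁ (brSq g f).hom ▷ (f' ⊠₁ g') ⊗≫
        (br x y ≫ br y x) ◁ (tenComp f f' g g').inv := by simp; bicategory
    _ = _ := by rw [← h]; simp; bicategory

theorem doubleSq_natural {x x' y y' : B} {f f' : x ⟶ x'} {g g' : y ⟶ y'} (η : f ⟶ f')
    (θ : g ⟶ g') :
    ten₂ η θ ▷ (br x' y' ≫ br y' x') ≫ (doubleSq f' g').hom =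
      (doubleSq f g).hom ≫ (br x y ≫ br y x) ◁ ten₂ η θ := by
  simp only [doubleSq_hom, comp_whiskerLeft, whiskerRight_comp, Category.assoc]
  simp only [Iso.hom_inv_id_assoc, Iso.inv_hom_id_assoc]
  have h1 := brSq_natural η θ
  have h2 := brSq_natural θ η
  rw [← comp_whiskerRight_assoc, h1, comp_whiskerRight_assoc, associator_naturality_middle_assoc,
    ← whiskerLeft_comp_assoc, h2]
  simp
theorem pairCompat_iff {x x' y y' : B} {f : x ⟶ x'} {g : y ⟶ y'}
    {m : br x y ≫ br y x ≅ 𝟙 (x ⊠ y)} {m' : br x' y' ≫ br y' x' ≅ 𝟙 (x' ⊠ y')} :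
    PairCompat f g m m' ↔ (doubleSq f g).hom ≫ m.hom ▷ (f ⊠₁ g) =
      (f ⊠₁ g) ◁ m'.hom ≫ (ρ_ _).hom ≫ (λ_ _).inv := by
  constructor
  · intro h
    have h := congrArg Iso.hom h
    simpa only [Sq.refl, Iso.trans_hom, whiskerLeftIso_hom, whiskerRightIso_hom,
      Iso.symm_hom] using h.symm
  · intro h
    apply Iso.ext
    simpa only [Sq.refl, Iso.trans_hom, whiskerLeftIso_hom, whiskerRightIso_hom,
      Iso.symm_hom] using h.symm

theorem pairCompat_id {x y : B} (m : br x y ≫ br y x ≅ 𝟙 (x ⊠ y)) :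
    PairCompat (𝟙 x) (𝟙 y) m m := by
  rw [pairCompat_iff, doubleSq_id]
  simp only [Category.assoc]
  rw [whisker_exchange, ← cancel_epi ((tenId x y).inv ▷ (br x y ≫ br y x)),
    ← whisker_exchange_assoc]
  simp

theorem pairCompat_congr {x x' y y' : B} {f f' : x ⟶ x'} {g g' : y ⟶ y'}
    {m : br x y ≫ br y x ≅ 𝟙 (x ⊠ y)} {m' : br x' y' ≫ br y' x' ≅ 𝟙 (x' ⊠ y')}
    (η : f ≅ f') (θ : g ≅ g') (h : PairCompat f g m m') : PairCompat f' g' m m' := by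
  rw [pairCompat_iff] at h ⊢
  have e := doubleSq_natural η.hom θ.hom
  have : Epi (ten₂ η.hom θ.hom ▷ (br x' y' ≫ br y' x')) :=
    inferInstanceAs (Epi (whiskerRightIso (tenIso η θ) (br x' y' ≫ br y' x')).hom)
  rw [← cancel_epi (ten₂ η.hom θ.hom ▷ (br x' y' ≫ br y' x')), reassoc_of% e,
    whisker_exchange, reassoc_of% h, ← whisker_exchange_assoc]
  simp

theorem pairCompat_comp {x x' x'' y y' y'' : B} {f : x ⟶ x'} {f' : x' ⟶ x''} {g : y ⟶ y'}
    {g' : y' ⟶ y''} {m : br x y ≫ br y x ≅ 𝟙 (x ⊠ y)} {m' : br x' y' ≫ br y' x' ≅ 𝟙 (x' ⊠ y')}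
    {m'' : br x'' y'' ≫ br y'' x'' ≅ 𝟙 (x'' ⊠ y'')} (h : PairCompat f g m m')
    (h' : PairCompat f' g' m' m'') : PairCompat (f ≫ f') (g ≫ g') m m'' := by
  rw [pairCompat_iff] at h h' ⊢
  calc (doubleSq (f ≫ f') (g ≫ g')).hom ≫ m.hom ▷ ((f ≫ f') ⊠₁ (g ≫ g'))
      = (tenComp f f' g g').hom ▷ (br x'' y'' ≫ br y'' x'') ⊗≫
        (f ⊠₁ g) ◁ (doubleSq f' g').hom ⊗≫ (doubleSq f g).hom ▷ (f' ⊠₁ g') ⊗≫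
        ((br x y ≫ br y x) ◁ (tenComp f f' g g').inv ≫
          m.hom ▷ ((f ≫ f') ⊠₁ (g ≫ g'))) := by
        rw [doubleSq_comp]; bicategory
    _ = (tenComp f f' g g').hom ▷ (br x'' y'' ≫ br y'' x'') ⊗≫
        (f ⊠₁ g) ◁ (doubleSq f' g').hom ⊗≫
        ((doubleSq f g).hom ≫ m.hom ▷ (f ⊠₁ g)) ▷ (f' ⊠₁ g') ⊗≫
        𝟙 (x ⊠ y) ◁ (tenComp f f' g g').inv := by
        rw [whisker_exchange]; bicategory
    _ = (tenComp f f' g g').hom ▷ (br x'' y'' ≫ br y'' x'') ⊗≫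
        (f ⊠₁ g) ◁ ((doubleSq f' g').hom ≫ m'.hom ▷ (f' ⊠₁ g')) ⊗≫
        𝟙 (x ⊠ y) ◁ (tenComp f f' g g').inv := by
        rw [h]; bicategory
    _ = ((tenComp f f' g g').hom ▷ (br x'' y'' ≫ br y'' x'') ≫
        (f ⊠₁ g ≫ f' ⊠₁ g') ◁ m''.hom) ⊗≫ (tenComp f f' g g').inv ⊗≫
          𝟙 (𝟙 (x ⊠ y) ≫ ((f ≫ f') ⊠₁ (g ≫ g'))) := by
        rw [h']; bicategory
    _ = ((f ≫ f') ⊠₁ (g ≫ g')) ◁ m''.hom ⊗≫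
        ((tenComp f f' g g').hom ≫ (tenComp f f' g g').inv) ⊗≫
          𝟙 (𝟙 (x ⊠ y) ≫ ((f ≫ f') ⊠₁ (g ≫ g'))) := by
        rw [← whisker_exchange]; bicategory
    _ = _ := by rw [Iso.hom_inv_id]; bicategory
end Double

section Centre

variable {B : Type u} [Bicategory.{w, v} B] [BraidedBicategory B]

/-- A family of 2-isomorphisms `v_{x||y}` from the double braiding of `x` and `y` to the identity;
equivalently, from `b_{x|y}` to the inverse of `b_{y|x}`. -/
abbrev SylFamily (x : B) : Type (max u w) := ∀ y : B, br x y ≫ br y x ≅ 𝟙 (x ⊠ y)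

/-- The 2-isomorphism from the double braiding of `x` and `y ⊗ z` to the identity obtained from
`v_{x||y}`, `v_{x||z}` and the hexagonators. -/
def sylMul {x : B} (s : SylFamily x) (y z : B) :
    br x (y ⊠ z) ≫ br (y ⊠ z) x ≅ 𝟙 (x ⊠ y ⊠ z) :=
  whiskerRightIso (decompR x y z) (br (y ⊠ z) x) ≪⊗≫
  whiskerLeftIso (isc x y z ≫ br x y ▹ z ≫ asc y x z ≫ y ◃ br x z ≫ isc y z x)
    (decompS y z x) ≪⊗≫
  cancelMid (isc x y z ≫ br x y ▹ z ≫ asc y x z ≫ y ◃ br x z) (iscAsc y z x)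
    (y ◃ br z x ≫ isc y x z ≫ br y x ▹ z ≫ asc x y z) ≪⊗≫
  cancelMid (isc x y z ≫ br x y ▹ z ≫ asc y x z) (wlCancel y (s z))
    (isc y x z ≫ br y x ▹ z ≫ asc x y z) ≪⊗≫
  cancelMid (isc x y z ≫ br x y ▹ z) (ascIsc y x z) (br y x ▹ z ≫ asc x y z) ≪⊗≫
  cancelMid (isc x y z) (wrCancel (s y) z) (asc x y z) ≪⊗≫
  iscAsc x y z

/-- A half syllepsis on `x`: the family `v_{x||-}` is a modification and is compatible with tensor
products in the second variable. -/
structure IsHalfSyllepsis {x : B} (s : SylFamily x) : Prop where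
  natural {y y' : B} (g : y ⟶ y') :
    Sq.Compat (doubleSq (𝟙 x) g) (Sq.refl (x ◃ g)) (s y) (s y')
  mul (y z : B) : s (y ⊠ z) = sylMul s y z

/-- The condition that `f : x ⟶ x'` is compatible with `v_{x||-}` and `v_{x'||-}`. -/
def IsSylMap {x x' : B} (s : SylFamily x) (s' : SylFamily x') (f : x ⟶ x') : Prop :=
  ∀ y : B, Sq.Compat (doubleSq f (𝟙 y)) (Sq.refl (f ▹ y)) (s y) (s' y)

/-- The family `v_{x ⊗ y||-}` obtained from `v_{x||-}`, `v_{y||-}` and the hexagonators. -/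
def tensorFamily {x y : B} (s : SylFamily x) (t : SylFamily y) : SylFamily (x ⊠ y) := fun z =>
  whiskerRightIso (decompS x y z) (br z (x ⊠ y)) ≪⊗≫
  whiskerLeftIso (asc x y z ≫ x ◃ br y z ≫ isc x z y ≫ br x z ▹ y ≫ asc z x y)
    (decompR z x y) ≪⊗≫
  cancelMid (asc x y z ≫ x ◃ br y z ≫ isc x z y ≫ br x z ▹ y) (ascIsc z x y)
    (br z x ▹ y ≫ asc x z y ≫ x ◃ br z y ≫ isc x y z) ≪⊗≫
  cancelMid (asc x y z ≫ x ◃ br y z ≫ isc x z y) (wrCancel (s z) y)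
    (asc x z y ≫ x ◃ br z y ≫ isc x y z) ≪⊗≫
  cancelMid (asc x y z ≫ x ◃ br y z) (iscAsc x z y) (x ◃ br z y ≫ isc x y z) ≪⊗≫
  cancelMid (asc x y z) (wlCancel x (t z)) (isc x y z) ≪⊗≫
  ascIsc x y z

theorem isSylMap_id {x : B} (s : SylFamily x) : IsSylMap s s (𝟙 x) :=
  fun y => pairCompat_id (s y)

theorem isSylMap_comp {x x' x'' : B} {s : SylFamily x} {s' : SylFamily x'} {s'' : SylFamily x''}
    {f : x ⟶ x'} {f' : x' ⟶ x''} (h : IsSylMap s s' f) (h' : IsSylMap s' s'' f') :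
    IsSylMap s s'' (f ≫ f') :=
  fun y => pairCompat_congr (Iso.refl (f ≫ f')) (λ_ (𝟙 y)) (pairCompat_comp (h y) (h' y))

end Centre

/-- An object of the sylleptic centre: an object `x` with a half syllepsis `v_{x||-}`. -/
structure Centre (B : Type u) [Bicategory.{w, v} B] [BraidedBicategory B] where
  /-- the underlying object -/
  obj : B
  /-- the half syllepsis `v_{x||-}` -/
  syl : SylFamily obj
  isHalf : IsHalfSyllepsis syl

namespace Centre

variable {B : Type u} [Bicategory.{w, v} B] [BraidedBicategory B]

/-- A 1-morphism of the sylleptic centre: a 1-morphism compatible with the half syllepses. -/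
structure Hom (X Y : Centre B) : Type v where
  /-- the underlying 1-morphism -/
  hom : X.obj ⟶ Y.obj
  isSylMap : IsSylMap X.syl Y.syl hom

/-- The 2-morphisms of the sylleptic centre are those of the underlying 1-morphisms. -/
instance homCategory (X Y : Centre B) : Category (Hom X Y) where
  Hom f g := f.hom ⟶ g.hom
  id f := 𝟙 f.hom
  comp η θ := η ≫ θ
  id_comp η := Category.id_comp (obj := X.obj ⟶ Y.obj) η
  comp_id η := Category.comp_id (obj := X.obj ⟶ Y.obj) η
  assoc η θ ι := Category.assoc (obj := X.obj ⟶ Y.obj) η θ ι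

/-- Identity 1-morphisms and composition in the sylleptic centre. -/
instance categoryStruct : CategoryStruct (Centre B) where
  Hom X Y := Hom X Y
  id X := ⟨𝟙 X.obj, isSylMap_id X.syl⟩
  comp f g := ⟨f.hom ≫ g.hom, isSylMap_comp f.isSylMap g.isSylMap⟩

/-- A 2-isomorphism between underlying 1-morphisms is a 2-isomorphism in the sylleptic centre. -/
def mkIso {X Y : Centre B} {f g : X ⟶ Y} (θ : f.hom ≅ g.hom) :
    @Iso (Hom X Y) _ f g where
  hom := θ.hom
  inv := θ.inv
  hom_inv_id := θ.hom_inv_id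
  inv_hom_id := θ.inv_hom_id

/-- The sylleptic centre of a braided monoidal bicategory. -/
instance bicategory : Bicategory.{w, v} (Centre B) where
  homCategory X Y := homCategory X Y
  whiskerLeft f _ _ η := Bicategory.whiskerLeft f.hom η
  whiskerRight η h := Bicategory.whiskerRight η h.hom
  associator f g h := mkIso (α_ f.hom g.hom h.hom)
  leftUnitor f := mkIso (λ_ f.hom)
  rightUnitor f := mkIso (ρ_ f.hom)
  whiskerLeft_id f g := Bicategory.whiskerLeft_id f.hom g.hom
  whiskerLeft_comp f _ _ _ η θ := Bicategory.whiskerLeft_comp f.hom η θ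
  id_whiskerLeft {_ _ f g} η := Bicategory.id_whiskerLeft (f := f.hom) (g := g.hom) η
  comp_whiskerLeft {_ _ _ _} f g {h h'} η :=
    Bicategory.comp_whiskerLeft f.hom g.hom (h := h.hom) (h' := h'.hom) η
  id_whiskerRight f g := Bicategory.id_whiskerRight f.hom g.hom
  comp_whiskerRight η θ i := Bicategory.comp_whiskerRight η θ i.hom
  whiskerRight_id {_ _ f g} η := Bicategory.whiskerRight_id (f := f.hom) (g := g.hom) η
  whiskerRight_comp {_ _ _ _ f f'} η g h :=
    Bicategory.whiskerRight_comp (f := f.hom) (f' := f'.hom) η g.hom h.hom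
  whisker_assoc {_ _ _ _} f {g g'} η h :=
    Bicategory.whisker_assoc f.hom (g := g.hom) (g' := g'.hom) η h.hom
  whisker_exchange {_ _ _ f g h i} η θ :=
    Bicategory.whisker_exchange (f := f.hom) (g := g.hom) (h := h.hom) (i := i.hom) η θ
  pentagon f g h i := Bicategory.pentagon f.hom g.hom h.hom i.hom
  triangle f g := Bicategory.triangle f.hom g.hom

end Centre

end SylCentre

namespace SylCentre

local infixr:83 " ⊠ " => ten
local infixr:83 " ⊠₁ " => tenH
local infixr:85 " ◃ " => wl
local infixl:85 " ▹ " => wr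

/-! ### Linear bicategories, direct sums and semisimplicity -/

/-- A `ℂ`-linear bicategory: the 2-morphisms between two parallel 1-morphisms form a complex vector
space, and all compositions are bilinear. -/
class LinearBicategory (B : Type u) [Bicategory.{w, v} B] where
  /-- addition of 2-morphisms -/
  preadditive (a b : B) : Preadditive (a ⟶ b)
  /-- scalar multiplication of 2-morphisms -/
  linear (a b : B) : Linear ℂ (a ⟶ b)
  whiskerLeft_add {a b c : B} (f : a ⟶ b) {g h : b ⟶ c} (η θ : g ⟶ h) :
    f ◁ (η + θ) = f ◁ η + f ◁ θ
  whiskerLeft_smul {a b c : B} (f : a ⟶ b) {g h : b ⟶ c} (r : ℂ) (η : g ⟶ h) :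
    f ◁ (r • η) = r • f ◁ η
  add_whiskerRight {a b c : B} {f g : a ⟶ b} (η θ : f ⟶ g) (h : b ⟶ c) :
    (η + θ) ▷ h = η ▷ h + θ ▷ h
  smul_whiskerRight {a b c : B} {f g : a ⟶ b} (r : ℂ) (η : f ⟶ g) (h : b ⟶ c) :
    (r • η) ▷ h = r • η ▷ h

instance homPreadditive {B : Type u} [Bicategory.{w, v} B] [LinearBicategory B] (a b : B) :
    Preadditive (a ⟶ b) := LinearBicategory.preadditive a b

instance homLinear {B : Type u} [Bicategory.{w, v} B] [LinearBicategory B] (a b : B) :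
    Linear ℂ (a ⟶ b) := LinearBicategory.linear a b

section LocalSums

variable {C : Type v} [Category.{w} C] [Preadditive C]

/-- `Y` is a direct sum of the finite family `X`. -/
def IsSum {n : ℕ} (X : Fin n → C) (Y : C) : Prop :=
  ∃ (i : ∀ k, X k ⟶ Y) (p : ∀ k, Y ⟶ X k), (∀ k, i k ≫ p k = 𝟙 (X k)) ∧
    (∀ k l, k ≠ l → i k ≫ p l = 0) ∧ ∑ k, p k ≫ i k = 𝟙 Y

/-- Every finite family of objects has a direct sum. -/
def HasSums (C : Type v) [Category.{w} C] [Preadditive C] : Prop :=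
  ∀ (n : ℕ) (X : Fin n → C), ∃ Y : C, IsSum X Y

/-- A finite semisimple `ℂ`-linear category: it has finite direct sums, and there is a finite
family of pairwise non-isomorphic simple objects (with endomorphism algebra `ℂ` and no non-zero
morphisms between different members) of which every object is a direct sum. -/
def FiniteSemisimple (C : Type v) [Category.{w} C] [Preadditive C] [Linear ℂ C] : Prop :=
  HasSums C ∧ ∃ (n : ℕ) (S : Fin n → C), (∀ i, Module.finrank ℂ (S i ⟶ S i) = 1) ∧
    (∀ i j, i ≠ j → ∀ f : S i ⟶ S j, f = 0) ∧
    ∀ X : C, ∃ (k : ℕ) (c : Fin k → Fin n), IsSum (fun l => S (c l)) X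

end LocalSums

section ObjectSums

variable {B : Type u} [Bicategory.{w, v} B] [LinearBicategory B]

/-- The object `Y` is a direct sum of the finite family `X`. -/
def IsObjSum {n : ℕ} (X : Fin n → B) (Y : B) : Prop :=
  ∃ (i : ∀ k, X k ⟶ Y) (p : ∀ k, Y ⟶ X k), (∀ k, Nonempty (i k ≫ p k ≅ 𝟙 (X k))) ∧
    (∀ k l, k ≠ l → Limits.IsZero (i k ≫ p l)) ∧ IsSum (fun k => p k ≫ i k) (𝟙 Y)

/-- Every finite family of objects has a direct sum. -/
def HasObjSums (B : Type u) [Bicategory.{w, v} B] [LinearBicategory B] : Prop :=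
  ∀ (n : ℕ) (X : Fin n → B), ∃ Y : B, IsObjSum X Y

/-- An object is simple if its identity 1-morphism is simple. -/
def IsSimple (x : B) : Prop := Module.finrank ℂ (𝟙 x ⟶ 𝟙 x) = 1

/-- A family `E` of objects exhibits the bicategory as the 2-category of `M`-graded 2-vector spaces:
the objects `E m` are simple with only multiples of the identity as endomorphisms, there are no
non-zero 1-morphisms between different `E m`, finite direct sums of objects and of 1-morphisms
exist, and every object is a finite direct sum of objects `E m`. -/
structure IsTwoVec {M : Type*} (E : M → B) : Prop where
  hasSums (x y : B) : HasSums (x ⟶ y)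
  hasObjSums : HasObjSums B
  simple (m : M) : IsSimple (E m)
  endo (m : M) (f : E m ⟶ E m) : ∃ n : ℕ, IsSum (fun _ : Fin n => 𝟙 (E m)) f
  disjoint (m n : M) (h : m ≠ n) (f : E m ⟶ E n) : Limits.IsZero f
  generate (x : B) : ∃ (n : ℕ) (c : Fin n → M), IsObjSum (fun k => E (c k)) x

end ObjectSums

/-! ### Fusion 2-categories -/

section Monads

variable {B : Type u} [Bicategory.{w, v} B]

/-- A monad in a bicategory. -/
structure MonadIn (b : B) where
  /-- the underlying 1-morphism -/
  t : b ⟶ b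
  /-- the multiplication -/
  mul : t ≫ t ⟶ t
  /-- the unit -/
  one : 𝟙 b ⟶ t
  mul_assoc : mul ▷ t ≫ mul = (α_ t t t).hom ≫ t ◁ mul ≫ mul
  one_mul : one ▷ t ≫ mul = (λ_ t).hom
  mul_one : t ◁ one ≫ mul = (ρ_ t).hom

/-- A monad is separable if its multiplication has a section that is a map of bimodules. -/
def MonadIn.Separable {b : B} (T : MonadIn b) : Prop :=
  ∃ s : T.t ⟶ T.t ≫ T.t, s ≫ T.mul = 𝟙 T.t ∧
    T.mul ≫ s = s ▷ T.t ≫ (α_ T.t T.t T.t).hom ≫ T.t ◁ T.mul ∧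
    T.mul ≫ s = T.t ◁ s ≫ (α_ T.t T.t T.t).inv ≫ T.mul ▷ T.t

/-- A monad splits separably if it is the monad of an adjunction whose counit has a section. -/
def MonadIn.Splits {b : B} (T : MonadIn b) : Prop :=
  ∃ (c : B) (l : b ⟶ c) (r : c ⟶ b) (adj : Adjunction l r) (θ : l ≫ r ≅ T.t),
    (∃ s : 𝟙 c ⟶ r ≫ l, s ≫ adj.counit = 𝟙 (𝟙 c)) ∧
    adj.unit ≫ θ.hom = T.one ∧
    (α_ l r (l ≫ r)).hom ≫ l ◁ ((α_ r l r).inv ≫ adj.counit ▷ r ≫ (λ_ r).hom) ≫ θ.hom =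
      θ.hom ▷ (l ≫ r) ≫ T.t ◁ θ.hom ≫ T.mul

end Monads

/-- A finite semisimple 2-category. -/
structure IsFiniteSemisimple (B : Type u) [Bicategory.{w, v} B] [LinearBicategory B] : Prop where
  finiteSemisimple (x y : B) : FiniteSemisimple (x ⟶ y)
  rightAdjoint {x y : B} (f : x ⟶ y) : ∃ g : y ⟶ x, Nonempty (Adjunction f g)
  leftAdjoint {x y : B} (f : x ⟶ y) : ∃ g : y ⟶ x, Nonempty (Adjunction g f)
  hasObjSums : HasObjSums B
  splits {b : B} (T : MonadIn b) (h : T.Separable) : T.Splits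
  finite : ∃ (n : ℕ) (S : Fin n → B), ∀ x : B, IsSimple x → ∃ i, Equivalent x (S i)

section Fusion

/-- The object `y` is dual to `x`, with evaluation `y ⊗ x ⟶ 1` and coevaluation `1 ⟶ x ⊗ y`
satisfying the zigzag equations up to isomorphism. -/
def IsDual {B : Type u} [Bicategory.{w, v} B] [TensorBicategory B] (x y : B) : Prop :=
  ∃ (ev : y ⊠ x ⟶ tunit B) (coev : tunit B ⟶ x ⊠ y),
    Nonempty (lunInv x ≫ coev ▹ x ≫ asc x y x ≫ x ◃ ev ≫ run x ≅ 𝟙 x) ∧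
    Nonempty (runInv y ≫ y ◃ coev ≫ isc y x y ≫ ev ▹ y ≫ lun y ≅ 𝟙 y)

/-- A fusion 2-category: a finite semisimple 2-category with a bilinear monoidal structure such that
every object has a left and a right dual and the unit object is simple. -/
structure IsFusion (B : Type u) [Bicategory.{w, v} B] [LinearBicategory B] [MonoidalBicategory B] :
    Prop extends IsFiniteSemisimple B where
  ten_add {x x' y y' : B} {f f' : x ⟶ x'} {g g' : y ⟶ y'} (η : f ⟶ f') (θ θ' : g ⟶ g') :
    ten₂ η (θ + θ') = ten₂ η θ + ten₂ η θ'
  add_ten {x x' y y' : B} {f f' : x ⟶ x'} {g g' : y ⟶ y'} (η η' : f ⟶ f') (θ : g ⟶ g') :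
    ten₂ (η + η') θ = ten₂ η θ + ten₂ η' θ
  ten_smul {x x' y y' : B} {f f' : x ⟶ x'} {g g' : y ⟶ y'} (r : ℂ) (η : f ⟶ f') (θ : g ⟶ g') :
    ten₂ η (r • θ) = r • ten₂ η θ
  smul_ten {x x' y y' : B} {f f' : x ⟶ x'} {g g' : y ⟶ y'} (r : ℂ) (η : f ⟶ f') (θ : g ⟶ g') :
    ten₂ (r • η) θ = r • ten₂ η θ
  rightDual (x : B) : ∃ y, IsDual x y
  leftDual (x : B) : ∃ y, IsDual y x
  unit_simple : IsSimple (tunit B)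

/-- A strongly fusion 2-category: a fusion 2-category such that the category of endomorphisms of the
unit object is the category of vector spaces. -/
structure IsStronglyFusion (B : Type u) [Bicategory.{w, v} B] [LinearBicategory B]
    [MonoidalBicategory B] : Prop extends IsFusion B where
  endo (f : tunit B ⟶ tunit B) : ∃ n : ℕ, IsSum (fun _ : Fin n => 𝟙 (tunit B)) f

end Fusion

/-! ### Trivial braidings -/

/-- Representatives `e g` of the equivalence classes of simple objects, indexed by the group `L` that
they form under the tensor product, with fusion 1-equivalences `χ : e g ⊗ e h ⟶ e (g h)` and
2-isomorphisms `ω` and `u` comparing these with the associator and the braiding. -/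
structure FusionData (B : Type u) [Bicategory.{w, v} B] [LinearBicategory B] [BraidedBicategory B]
    (L : Type*) [CommGroup L] where
  /-- the simple object representing a group element -/
  e : L → B
  simple (g : L) : IsSimple (e g)
  complete (x : B) (hx : IsSimple x) : ∃ g, Equivalent x (e g)
  injective (g h : L) (hgh : Equivalent (e g) (e h)) : g = h
  /-- the fusion of two simple objects -/
  χ (g h p : L) (hp : g * h = p) : e g ⊠ e h ⟶ e p
  χ_equiv (g h p : L) (hp : g * h = p) : IsEquiv (χ g h p hp)
  /-- the trivialisation of the associator -/
  ω (g h k p q s : L) (hp : g * h = p) (hq : h * k = q) (hs : p * k = s) (ht : g * q = s) :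
    χ g h p hp ▹ e k ≫ χ p k s hs ≅ asc (e g) (e h) (e k) ≫ e g ◃ χ h k q hq ≫ χ g q s ht
  /-- the trivialisation of the braiding -/
  u (g h p : L) (hp : g * h = p) (hp' : h * g = p) :
    br (e g) (e h) ≫ χ h g p hp' ≅ χ g h p hp

namespace FusionData

variable {B : Type u} [Bicategory.{w, v} B] [LinearBicategory B] [BraidedBicategory B]
  {L : Type*} [CommGroup L] (D : FusionData B L)

/-- The trivialisation of the inverse associator. -/
def ωi (g h k p q s : L) (hp : g * h = p) (hq : h * k = q) (hs : p * k = s) (ht : g * q = s) :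
    isc (D.e g) (D.e h) (D.e k) ≫ D.χ g h p hp ▹ D.e k ≫ D.χ p k s hs ≅
      D.e g ◃ D.χ h k q hq ≫ D.χ g q s ht :=
  whiskerLeftIso (isc (D.e g) (D.e h) (D.e k)) (D.ω g h k p q s hp hq hs ht) ≪≫
    cancelFst (iscAsc (D.e g) (D.e h) (D.e k)) (D.e g ◃ D.χ h k q hq ≫ D.χ g q s ht)

/-- The 2-isomorphism `ω` tensored on the left. -/
def ωL (l g h k p q s : L) (hp : g * h = p) (hq : h * k = q) (hs : p * k = s) (ht : g * q = s) :
    D.e l ◃ (D.χ g h p hp ▹ D.e k) ≫ D.e l ◃ D.χ p k s hs ≅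
      D.e l ◃ asc (D.e g) (D.e h) (D.e k) ≫ D.e l ◃ D.e g ◃ D.χ h k q hq ≫
        D.e l ◃ D.χ g q s ht :=
  (wlComp _ _ _).symm ≪≫ wlIso (D.e l) (D.ω g h k p q s hp hq hs ht) ≪≫ wlComp₃ _ _ _ _

/-- The 2-isomorphism `ω` tensored on the right. -/
def ωR (g h k l p q s : L) (hp : g * h = p) (hq : h * k = q) (hs : p * k = s) (ht : g * q = s) :
    D.χ g h p hp ▹ D.e k ▹ D.e l ≫ D.χ p k s hs ▹ D.e l ≅
      asc (D.e g) (D.e h) (D.e k) ▹ D.e l ≫ (D.e g ◃ D.χ h k q hq) ▹ D.e l ≫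
        D.χ g q s ht ▹ D.e l :=
  (wrComp _ _ _).symm ≪≫ wrIso (D.ω g h k p q s hp hq hs ht) (D.e l) ≪≫ wrComp₃ _ _ _ _

/-- The 2-isomorphism `u` tensored on the left. -/
def uL (k g h p : L) (hp : g * h = p) (hp' : h * g = p) :
    D.e k ◃ br (D.e g) (D.e h) ≫ D.e k ◃ D.χ h g p hp' ≅ D.e k ◃ D.χ g h p hp :=
  (wlComp _ _ _).symm ≪≫ wlIso (D.e k) (D.u g h p hp hp')

/-- The 2-isomorphism `u` tensored on the right. -/
def uR (g h k p : L) (hp : g * h = p) (hp' : h * g = p) :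
    br (D.e g) (D.e h) ▹ D.e k ≫ D.χ h g p hp' ▹ D.e k ≅ D.χ g h p hp ▹ D.e k :=
  (wrComp _ _ _).symm ≪≫ wrIso (D.u g h p hp hp') (D.e k)

section Pentagon

variable (g h k l : L)

/-- First 2-isomorphism comparing the two ways of fusing four simple objects. -/
def fusePent₁ (p q s a b c : L) (hp : g * h = p) (hq : p * k = q) (hs : q * l = s)
    (ha : h * k = a) (hb : k * l = b) (hc : a * l = c) (hq' : g * a = q) (hc' : h * b = c)
    (hs' : g * c = s) :
    D.χ g h p hp ▹ D.e k ▹ D.e l ≫ D.χ p k q hq ▹ D.e l ≫ D.χ q l s hs ≅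
      asc (D.e g ⊠ D.e h) (D.e k) (D.e l) ≫ asc (D.e g) (D.e h) (D.e k ⊠ D.e l) ≫
        D.e g ◃ D.e h ◃ D.χ k l b hb ≫ D.e g ◃ D.χ h b c hc' ≫ D.χ g c s hs' :=
  Iso.refl _ ≪⊗≫
  whiskerRightIso (D.ωR g h k l p a q hp ha hq hq') (D.χ q l s hs) ≪⊗≫
  whiskerLeftIso (asc (D.e g) (D.e h) (D.e k) ▹ D.e l ≫ (D.e g ◃ D.χ h k a ha) ▹ D.e l)
    (D.ω g a l q c s hq' hc hs hs') ≪⊗≫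
  mid (asc (D.e g) (D.e h) (D.e k) ▹ D.e l) (asc₂ (D.e g) (D.χ h k a ha) (D.e l))
    (D.e g ◃ D.χ a l c hc ≫ D.χ g c s hs') ≪⊗≫
  mid (asc (D.e g) (D.e h) (D.e k) ▹ D.e l ≫ asc (D.e g) (D.e h ⊠ D.e k) (D.e l))
    (D.ωL g h k l a b c ha hb hc hc') (D.χ g c s hs') ≪⊗≫
  whiskerRightIso (penta (D.e g) (D.e h) (D.e k) (D.e l))
    (D.e g ◃ D.e h ◃ D.χ k l b hb ≫ D.e g ◃ D.χ h b c hc' ≫ D.χ g c s hs') ≪⊗≫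
  Iso.refl _

/-- Second 2-isomorphism comparing the two ways of fusing four simple objects. -/
def fusePent₂ (p q s b c : L) (hp : g * h = p) (hq : p * k = q) (hs : q * l = s)
    (hb : k * l = b) (hc' : h * b = c) (hs' : g * c = s) (hr : p * b = s) :
    D.χ g h p hp ▹ D.e k ▹ D.e l ≫ D.χ p k q hq ▹ D.e l ≫ D.χ q l s hs ≅
      asc (D.e g ⊠ D.e h) (D.e k) (D.e l) ≫ asc (D.e g) (D.e h) (D.e k ⊠ D.e l) ≫
        D.e g ◃ D.e h ◃ D.χ k l b hb ≫ D.e g ◃ D.χ h b c hc' ≫ D.χ g c s hs' :=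
  Iso.refl _ ≪⊗≫
  whiskerLeftIso (D.χ g h p hp ▹ D.e k ▹ D.e l) (D.ω p k l q b s hq hb hs hr) ≪⊗≫
  whiskerRightIso (asc₁ (D.χ g h p hp) (D.e k) (D.e l))
    (D.e p ◃ D.χ k l b hb ≫ D.χ p b s hr) ≪⊗≫
  mid (asc (D.e g ⊠ D.e h) (D.e k) (D.e l)) (interchange (D.χ g h p hp) (D.χ k l b hb)).symm
    (D.χ p b s hr) ≪⊗≫
  whiskerLeftIso (asc (D.e g ⊠ D.e h) (D.e k) (D.e l) ≫ (D.e g ⊠ D.e h) ◃ D.χ k l b hb)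
    (D.ω g h b p c s hp hc' hr hs') ≪⊗≫
  mid (asc (D.e g ⊠ D.e h) (D.e k) (D.e l)) (asc₃ (D.e g) (D.e h) (D.χ k l b hb))
    (D.e g ◃ D.χ h b c hc' ≫ D.χ g c s hs') ≪⊗≫
  Iso.refl _

end Pentagon

section Hexagon

variable (g h k : L)

/-- First 2-isomorphism comparing the hexagonator `R` with the fusion of simple objects. -/
def fuseR₁ (a b c s : L) (ha : g * h = a) (ha' : h * g = a) (hb : h * k = b) (hc : g * k = c)
    (hc' : k * g = c) (has : a * k = s) (hbs : g * b = s) (hcs : h * c = s) :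
    br (D.e g) (D.e h) ▹ D.e k ≫ asc (D.e h) (D.e g) (D.e k) ≫ D.e h ◃ br (D.e g) (D.e k) ≫
        D.e h ◃ D.χ k g c hc' ≫ D.χ h c s hcs ≅
      asc (D.e g) (D.e h) (D.e k) ≫ D.e g ◃ D.χ h k b hb ≫ D.χ g b s hbs :=
  Iso.refl _ ≪⊗≫
  mid (br (D.e g) (D.e h) ▹ D.e k ≫ asc (D.e h) (D.e g) (D.e k)) (D.uL h g k c hc hc')
    (D.χ h c s hcs) ≪⊗≫
  whiskerLeftIso (br (D.e g) (D.e h) ▹ D.e k) (D.ω h g k a c s ha' hc has hcs).symm ≪⊗≫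
  whiskerRightIso (D.uR g h k a ha ha') (D.χ a k s has) ≪⊗≫
  D.ω g h k a b s ha hb has hbs

/-- Second 2-isomorphism comparing the hexagonator `R` with the fusion of simple objects. -/
def fuseR₂ (b c s : L) (hb : h * k = b) (hc' : k * g = c) (hbs : g * b = s) (hbs' : b * g = s)
    (hcs : h * c = s) :
    br (D.e g) (D.e h) ▹ D.e k ≫ asc (D.e h) (D.e g) (D.e k) ≫ D.e h ◃ br (D.e g) (D.e k) ≫
        D.e h ◃ D.χ k g c hc' ≫ D.χ h c s hcs ≅
      asc (D.e g) (D.e h) (D.e k) ≫ D.e g ◃ D.χ h k b hb ≫ D.χ g b s hbs :=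
  Iso.refl _ ≪⊗≫
  whiskerRightIso (hexR (D.e g) (D.e h) (D.e k)) (D.e h ◃ D.χ k g c hc' ≫ D.χ h c s hcs) ≪⊗≫
  whiskerLeftIso (asc (D.e g) (D.e h) (D.e k) ≫ br (D.e g) (D.e h ⊠ D.e k))
    (D.ω h k g b c s hb hc' hbs' hcs).symm ≪⊗≫
  mid (asc (D.e g) (D.e h) (D.e k)) (br₂ (D.e g) (D.χ h k b hb)).symm (D.χ b g s hbs') ≪⊗≫
  whiskerLeftIso (asc (D.e g) (D.e h) (D.e k) ≫ D.e g ◃ D.χ h k b hb) (D.u g b s hbs hbs') ≪⊗≫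
  Iso.refl _

/-- First 2-isomorphism comparing the hexagonator `S` with the fusion of simple objects. -/
def fuseS₁ (a c d s : L) (ha : g * h = a) (hc : g * k = c) (hc' : k * g = c) (hd : h * k = d)
    (hd' : k * h = d) (has : a * k = s) (hcs : c * h = s) (hds : g * d = s) :
    D.e g ◃ br (D.e h) (D.e k) ≫ isc (D.e g) (D.e k) (D.e h) ≫ br (D.e g) (D.e k) ▹ D.e h ≫
        D.χ k g c hc' ▹ D.e h ≫ D.χ c h s hcs ≅
      isc (D.e g) (D.e h) (D.e k) ≫ D.χ g h a ha ▹ D.e k ≫ D.χ a k s has :=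
  Iso.refl _ ≪⊗≫
  mid (D.e g ◃ br (D.e h) (D.e k) ≫ isc (D.e g) (D.e k) (D.e h)) (D.uR g k h c hc hc')
    (D.χ c h s hcs) ≪⊗≫
  whiskerLeftIso (D.e g ◃ br (D.e h) (D.e k)) (D.ωi g k h c d s hc hd' hcs hds) ≪⊗≫
  whiskerRightIso (D.uL g h k d hd hd') (D.χ g d s hds) ≪⊗≫
  (D.ωi g h k a d s ha hd has hds).symm

/-- Second 2-isomorphism comparing the hexagonator `S` with the fusion of simple objects. -/
def fuseS₂ (a c s : L) (ha : g * h = a) (hc' : k * g = c) (has : a * k = s) (has' : k * a = s)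
    (hcs : c * h = s) :
    D.e g ◃ br (D.e h) (D.e k) ≫ isc (D.e g) (D.e k) (D.e h) ≫ br (D.e g) (D.e k) ▹ D.e h ≫
        D.χ k g c hc' ▹ D.e h ≫ D.χ c h s hcs ≅
      isc (D.e g) (D.e h) (D.e k) ≫ D.χ g h a ha ▹ D.e k ≫ D.χ a k s has :=
  Iso.refl _ ≪⊗≫
  whiskerRightIso (hexS (D.e g) (D.e h) (D.e k)) (D.χ k g c hc' ▹ D.e h ≫ D.χ c h s hcs) ≪⊗≫
  whiskerLeftIso (isc (D.e g) (D.e h) (D.e k) ≫ br (D.e g ⊠ D.e h) (D.e k))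
    (D.ωi k g h c a s hc' ha hcs has') ≪⊗≫
  mid (isc (D.e g) (D.e h) (D.e k)) (br₁ (D.χ g h a ha) (D.e k)).symm (D.χ k a s has') ≪⊗≫
  whiskerLeftIso (isc (D.e g) (D.e h) (D.e k) ≫ D.χ g h a ha ▹ D.e k)
    (D.u a k s has has') ≪⊗≫
  Iso.refl _

end Hexagon

/-- The braided cocycle `(π, R, S)` is trivialised by `ω` and `u`: under the identifications of
tensor products of simple objects with simple objects given by `ω` and `u`, the pentagonators and
the hexagonators become identities. -/
structure Trivialises : Prop where
  pent (g h k l p q s a b c : L) (hp : g * h = p) (hq : p * k = q) (hs : q * l = s)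
    (ha : h * k = a) (hb : k * l = b) (hc : a * l = c) (hq' : g * a = q) (hc' : h * b = c)
    (hs' : g * c = s) (hr : p * b = s) :
    D.fusePent₁ g h k l p q s a b c hp hq hs ha hb hc hq' hc' hs' =
      D.fusePent₂ g h k l p q s b c hp hq hs hb hc' hs' hr
  hexR (g h k a b c s : L) (ha : g * h = a) (ha' : h * g = a) (hb : h * k = b) (hc : g * k = c)
    (hc' : k * g = c) (has : a * k = s) (hbs : g * b = s) (hbs' : b * g = s) (hcs : h * c = s) :
    D.fuseR₁ g h k a b c s ha ha' hb hc hc' has hbs hcs =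
      D.fuseR₂ g h k b c s hb hc' hbs hbs' hcs
  hexS (g h k a c d s : L) (ha : g * h = a) (hc : g * k = c) (hc' : k * g = c) (hd : h * k = d)
    (hd' : k * h = d) (has : a * k = s) (has' : k * a = s) (hcs : c * h = s) (hds : g * d = s) :
    D.fuseS₁ g h k a c d s ha hc hc' hd hd' has hcs hds =
      D.fuseS₂ g h k a c s ha hc' has has' hcs

end FusionData

/-! ### The linear structure of the sylleptic centre -/

namespace Centre

variable {B : Type u} [Bicategory.{w, v} B] [BraidedBicategory B] [LinearBicategory B]

/-- Addition of 2-morphisms in the sylleptic centre. -/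
abbrev preadditiveHom (X Y : Centre B) : Preadditive (X ⟶ Y) where
  homGroup f g := inferInstanceAs (AddCommGroup (f.hom ⟶ g.hom))
  add_comp f g h := Preadditive.add_comp f.hom g.hom h.hom
  comp_add f g h := Preadditive.comp_add f.hom g.hom h.hom

/-- Scalar multiplication of 2-morphisms in the sylleptic centre. -/
abbrev linearHom (X Y : Centre B) : @Linear ℂ _ (X ⟶ Y) _ (preadditiveHom X Y) :=
  @Linear.mk ℂ _ (X ⟶ Y) _ (preadditiveHom X Y)
    (fun f g => inferInstanceAs (Module ℂ (f.hom ⟶ g.hom)))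
    (fun (f g h : X ⟶ Y) => Linear.smul_comp f.hom g.hom h.hom)
    (fun (f g h : X ⟶ Y) => Linear.comp_smul f.hom g.hom h.hom)

/-- The sylleptic centre is a linear bicategory, with the vector spaces of 2-morphisms of the
original bicategory. -/
instance linearBicategory : LinearBicategory (Centre B) where
  preadditive := preadditiveHom
  linear := linearHom
  whiskerLeft_add {_ _ _} f {g h} η θ :=
    LinearBicategory.whiskerLeft_add f.hom (g := g.hom) (h := h.hom) η θ
  whiskerLeft_smul {_ _ _} f {g h} r η :=
    LinearBicategory.whiskerLeft_smul f.hom (g := g.hom) (h := h.hom) r η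
  add_whiskerRight {_ _ _ f g} η θ h :=
    LinearBicategory.add_whiskerRight (f := f.hom) (g := g.hom) η θ h.hom
  smul_whiskerRight {_ _ _ f g} r η h :=
    LinearBicategory.smul_whiskerRight (f := f.hom) (g := g.hom) r η h.hom

end Centre

/-! ### Tensor products and the sylleptic form of the centre -/

section Form

variable {B : Type u} [Bicategory.{w, v} B] [BraidedBicategory B]

/-- The sylleptic centre inherits the braided monoidal structure: it is closed under tensor products
of objects and 1-morphisms, the associators and braidings are 1-morphisms of the centre, and the
unit object carries a half syllepsis for which the unitors are 1-morphisms of the centre. The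
2-morphisms `v_{x||y}` are then its syllepsis. -/
structure CentreIsBraided (B : Type u) [Bicategory.{w, v} B] [BraidedBicategory B] : Prop where
  isHalf_ten (X Y : Centre B) : IsHalfSyllepsis (tensorFamily X.syl Y.syl)
  isSylMap_ten {X X' Y Y' : Centre B} (f : X ⟶ X') (g : Y ⟶ Y') :
    IsSylMap (tensorFamily X.syl Y.syl) (tensorFamily X'.syl Y'.syl) (f.hom ⊠₁ g.hom)
  isSylMap_asc (X Y Z : Centre B) :
    IsSylMap (tensorFamily (tensorFamily X.syl Y.syl) Z.syl)
      (tensorFamily X.syl (tensorFamily Y.syl Z.syl)) (asc X.obj Y.obj Z.obj)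
  isSylMap_br (X Y : Centre B) :
    IsSylMap (tensorFamily X.syl Y.syl) (tensorFamily Y.syl X.syl) (br X.obj Y.obj)
  exists_unit : ∃ s : SylFamily (tunit B), IsHalfSyllepsis s ∧ ∀ X : Centre B,
    IsSylMap (tensorFamily s X.syl) X.syl (lun X.obj) ∧
    IsSylMap (tensorFamily X.syl s) X.syl (run X.obj)

/-- The antisymmetric pairing of two objects of the sylleptic centre is the scalar `c`:
`v_{x||y} = c • v_{y||x}`, as 2-morphisms from `b_{x|y} b_{y|x} b_{x|y}` to `b_{x|y}`. -/
def SylForm [LinearBicategory B] (X Y : Centre B) (c : ℂ) : Prop :=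
  (X.syl Y.obj).hom ▷ br X.obj Y.obj ≫ (λ_ _).hom =
    c • ((α_ _ _ _).hom ≫ br X.obj Y.obj ◁ (Y.syl X.obj).hom ≫ (ρ_ _).hom)

/-- The tensor product in the sylleptic centre. -/
def CentreIsBraided.tensor (h : CentreIsBraided B) (X Y : Centre B) : Centre B :=
  ⟨X.obj ⊠ Y.obj, tensorFamily X.syl Y.syl, h.isHalf_ten X Y⟩

/-- The canonical pairing on `L̂ × L`, where `L̂` is the group of characters of `L`. -/
def canonicalPairing {L : Type*} [CommGroup L] (m n : (L →* ℂˣ) × L) : ℂˣ :=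
  m.1 n.2 * (n.1 m.2)⁻¹

end Form

end SylCentre

open SylCentre

/-! The whole computation reduces to scalars on simple objects. Strong fusion gives `End(e_g) = Vec`
for every `g`, since tensoring with an inverse of `e_g` carries endomorphisms of `e_g` to
endomorphisms of the unit (`isMultiple`). A Schur argument with adjoints then shows that 1-morphisms
between different `e_g` vanish (`isZero_of_ne`). Every object is a direct sum of objects `e_g`: the
identity of `b` splits in the semisimple category `End(b)` into orthogonal idempotent 1-morphisms,
each of which is a separable monad and so splits through a simple object (`exists_decomposition`).

Consequently a natural family `v_{x||-}` is the same as an arbitrary choice of its values on the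
`e_h` (`exists_natural`, `natural_ext`). For `x = e_g` each value is a non-zero scalar `r h`,
measured against the composite of `u_{h,g}` and `u_{g,h}`. The remaining axiom, compatibility with
tensor products in the second variable, need only be tested on `e_h ⊗ e_k`. There it says `r (h * k)
= r h * r k`, because the trivialisation turns associators, braidings, `R` and `S` into data over
the fused object `e_{ghk}` with scalar 1. So half syllepses on `e_g` are exactly the characters of
`L` (`exists_half`, `exists_character`). The same scalar count shows that `χ_{g,h}` multiplies
characters (`isSylMap_χ`).

Two auxiliary bicategories replace long pasting calculations. In the arrow bicategory `Arr B` every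
ingredient of the formulas `sylMul` and `tensorFamily` is a 2-isomorphism by its naturality axiom,
so the composites are 2-isomorphisms there too, which is the naturality of the formulas. In `Slice
e` a 2-morphism over `e` carries a scalar by which it fails to commute with the structure
2-morphisms. Scalars multiply under composition, so the scalar of a composite formula is read off
from its factors.

Statements about general objects come from simple ones by transport: compatible pairs can be
cancelled on the right along fully faithful 1-morphisms and on the left along covering families,
such as the inclusions of a direct sum. Closure of the centre under tensor products, associators,
braidings and unitors is thereby reduced to simple objects, where `ω` and `u` express the required
1-morphism through fusion equivalences already known to lie in the centre. Finally, both sides of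
the antisymmetric pairing are 2-morphisms over one fused object with scalars `f(g')` and `f'(g)`,
and their ratio is the claimed value. -/

namespace SylCentre

local infixr:83 " ⊠ " => ten
local infixr:83 " ⊠₁ " => tenH
local infixr:85 " ◃ " => wl
local infixl:85 " ▹ " => wr

/-! ### The arrow bicategory -/

section Arrows

variable {B : Type u} [Bicategory.{w, v} B]

/-- The objects of the arrow bicategory: 1-morphisms of `B`. -/
structure Arr (B : Type u) [Bicategory.{w, v} B] where
  /-- the source -/
  src : B
  /-- the target -/
  tgt : B
  /-- the 1-morphism -/
  arr : src ⟶ tgt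

namespace Arr

/-- The 1-morphisms of the arrow bicategory: squares. -/
structure Hom (X Y : Arr B) where
  /-- the 1-morphism between the sources -/
  top : X.src ⟶ Y.src
  /-- the 1-morphism between the targets -/
  bot : X.tgt ⟶ Y.tgt
  /-- the square -/
  sq : Sq X.arr top bot Y.arr

/-- The 2-morphisms of the arrow bicategory: compatible pairs of 2-morphisms. -/
@[ext]
structure Hom₂ {X Y : Arr B} (F G : Hom X Y) where
  /-- the 2-morphism between the sources -/
  top : F.top ⟶ G.top
  /-- the 2-morphism between the targets -/
  bot : F.bot ⟶ G.bot
  w : X.arr ◁ bot ≫ G.sq.hom = F.sq.hom ≫ top ▷ Y.arr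

instance homCategory (X Y : Arr B) : Category (Hom X Y) where
  Hom F G := Hom₂ F G
  id F := ⟨𝟙 _, 𝟙 _, by simp⟩
  comp η θ := ⟨η.top ≫ θ.top, η.bot ≫ θ.bot, by
    rw [whiskerLeft_comp, Category.assoc, θ.w, reassoc_of% η.w, comp_whiskerRight]⟩
  id_comp η := Hom₂.ext (Category.id_comp _) (Category.id_comp _)
  comp_id η := Hom₂.ext (Category.comp_id _) (Category.comp_id _)
  assoc η θ ι := Hom₂.ext (Category.assoc _ _ _) (Category.assoc _ _ _)

instance categoryStruct : CategoryStruct (Arr B) where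
  Hom X Y := Hom X Y
  id X := ⟨𝟙 _, 𝟙 _, Sq.refl X.arr⟩
  comp F G := ⟨F.top ≫ G.top, F.bot ≫ G.bot, F.sq.comp G.sq⟩

/-- A compatible pair of 2-isomorphisms is a 2-isomorphism of the arrow bicategory. -/
def mkIso {X Y : Arr B} {F G : X ⟶ Y} (m : F.top ≅ G.top) (n : F.bot ≅ G.bot)
    (h : Sq.Compat F.sq G.sq m n) : @Iso (Hom X Y) _ F G where
  hom := ⟨m.hom, n.hom, by simpa using congrArg Iso.hom h⟩
  inv := ⟨m.inv, n.inv, by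
    have h := congrArg Iso.hom h
    simp only [Iso.trans_hom, whiskerLeftIso_hom, whiskerRightIso_hom] at h
    rw [← cancel_epi (X.arr ◁ n.hom), reassoc_of% h]
    simp⟩
  hom_inv_id := Hom₂.ext m.hom_inv_id n.hom_inv_id
  inv_hom_id := Hom₂.ext m.inv_hom_id n.inv_hom_id

/-- The 2-isomorphism between the sources. -/
def topIso {X Y : Arr B} {F G : Hom X Y} (e : F ≅ G) : F.top ≅ G.top where
  hom := e.hom.top
  inv := e.inv.top
  hom_inv_id := congrArg Hom₂.top e.hom_inv_id
  inv_hom_id := congrArg Hom₂.top e.inv_hom_id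

/-- The 2-isomorphism between the targets. -/
def botIso {X Y : Arr B} {F G : Hom X Y} (e : F ≅ G) : F.bot ≅ G.bot where
  hom := e.hom.bot
  inv := e.inv.bot
  hom_inv_id := congrArg Hom₂.bot e.hom_inv_id
  inv_hom_id := congrArg Hom₂.bot e.inv_hom_id

/-- This is the way back from `Arr B`: a formula assembled from 2-isomorphisms of `Arr B` is itself
one, and its defining equation is the naturality of the formula. -/
theorem compat_of_iso {X Y : Arr B} {F G : Hom X Y} (e : F ≅ G) :
    Sq.Compat F.sq G.sq (topIso e) (botIso e) :=
  Iso.ext e.hom.w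

/-- A 2-morphism is a pair of 2-morphisms of `B` with a property, so the coherence laws hold
separately on sources and on targets. Only the compatibility of whiskerings and structural
isomorphisms with pasted squares needs proof. -/
instance bicategory : Bicategory (Arr B) where
  homCategory X Y := homCategory X Y
  whiskerLeft F G H η := ⟨F.top ◁ η.top, F.bot ◁ η.bot, by
    have h := η.w
    change _ ◁ _ ≫ (Sq.comp _ _).hom = (Sq.comp _ _).hom ≫ _
    simp only [Sq.comp, Iso.trans_hom, Iso.symm_hom, whiskerRightIso_hom, whiskerLeftIso_hom,
      Category.assoc]
    rw [associator_inv_naturality_right_assoc, whisker_exchange_assoc,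
      associator_naturality_right_assoc, ← whiskerLeft_comp_assoc, h]
    simp⟩
  whiskerRight {X Y Z F G} η H := ⟨η.top ▷ H.top, η.bot ▷ H.bot, by
    have h := η.w
    change _ ◁ _ ≫ (Sq.comp _ _).hom = (Sq.comp _ _).hom ≫ _
    simp only [Sq.comp, Iso.trans_hom, Iso.symm_hom, whiskerRightIso_hom, whiskerLeftIso_hom,
      Category.assoc]
    rw [associator_inv_naturality_middle_assoc, ← comp_whiskerRight_assoc, h]
    rw [comp_whiskerRight, Category.assoc, associator_naturality_left_assoc,
      ← whisker_exchange_assoc, ← associator_inv_naturality_left]⟩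
  associator F G H := mkIso (α_ _ _ _) (α_ _ _ _) (by
    apply Iso.ext
    change _ ◁ _ ≫ (Sq.comp _ (Sq.comp _ _)).hom = (Sq.comp (Sq.comp _ _) _).hom ≫ _
    simp [Sq.comp])
  leftUnitor F := mkIso (λ_ _) (λ_ _) (by
    apply Iso.ext
    change _ ◁ _ ≫ Iso.hom _ = (Sq.comp (Sq.refl _) _).hom ≫ _
    simp [Sq.comp, Sq.refl])
  rightUnitor F := mkIso (ρ_ _) (ρ_ _) (by
    apply Iso.ext
    change _ ◁ _ ≫ Iso.hom _ = (Sq.comp _ (Sq.refl _)).hom ≫ _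
    simp [Sq.comp, Sq.refl])
  whiskerLeft_id F G := Hom₂.ext (whiskerLeft_id _ _) (whiskerLeft_id _ _)
  whiskerLeft_comp F _ _ _ η θ := Hom₂.ext (whiskerLeft_comp _ _ _) (whiskerLeft_comp _ _ _)
  id_whiskerLeft η := Hom₂.ext (id_whiskerLeft _) (id_whiskerLeft _)
  comp_whiskerLeft F G _ _ η := Hom₂.ext (comp_whiskerLeft _ _ _) (comp_whiskerLeft _ _ _)
  id_whiskerRight F G := Hom₂.ext (id_whiskerRight _ _) (id_whiskerRight _ _)
  comp_whiskerRight η θ F := Hom₂.ext (comp_whiskerRight _ _ _) (comp_whiskerRight _ _ _)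
  whiskerRight_id η := Hom₂.ext (whiskerRight_id _) (whiskerRight_id _)
  whiskerRight_comp η F G := Hom₂.ext (whiskerRight_comp _ _ _) (whiskerRight_comp _ _ _)
  whisker_assoc F _ _ η G := Hom₂.ext (whisker_assoc _ _ _) (whisker_assoc _ _ _)
  whisker_exchange η θ := Hom₂.ext (whisker_exchange _ _) (whisker_exchange _ _)
  pentagon F G H I := Hom₂.ext (pentagon _ _ _ _) (pentagon _ _ _ _)
  triangle F G := Hom₂.ext (triangle _ _) (triangle _ _)

end Arr

end Arrows

/-! ### Chains of cancellations -/

section Chains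

variable {B : Type u} [Bicategory.{w, v} B]

/-- Removing a cancelling pair in the middle of a composite. -/
def midCancel {a b c d : B} (p : a ⟶ b) {f : b ⟶ c} {g : c ⟶ b} (θ : f ≫ g ≅ 𝟙 b) (q : b ⟶ d) :
    p ≫ f ≫ g ≫ q ≅ p ≫ q :=
  whiskerLeftIso p ((α_ f g q).symm ≪≫ whiskerRightIso θ q ≪≫ λ_ q)

/-- Solving a hexagon for its middle 1-morphism. -/
def hexDecomp {a b c d e f : B} {b₁ : b ⟶ c} {a₁ : c ⟶ d} {b₂ : d ⟶ e} {a₀ : b ⟶ a}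
    {t : a ⟶ f} {a₂ : f ⟶ e} {i₀ : a ⟶ b} {i₂ : e ⟶ f} (H : b₁ ≫ a₁ ≫ b₂ ≅ a₀ ≫ t ≫ a₂)
    (κ : i₀ ≫ a₀ ≅ 𝟙 a) (κ' : a₂ ≫ i₂ ≅ 𝟙 f) : t ≅ i₀ ≫ b₁ ≫ a₁ ≫ b₂ ≫ i₂ :=
  ((α_ i₀ a₀ t).symm ≪≫ whiskerRightIso κ t ≪≫ λ_ t).symm ≪⊗≫
  (whiskerLeftIso (i₀ ≫ a₀ ≫ t) κ' ≪≫ ρ_ (i₀ ≫ a₀ ≫ t)).symm ≪⊗≫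
  whiskerLeftIso i₀ (whiskerRightIso H.symm i₂) ≪⊗≫
  Iso.refl _

/-- Two decompositions into five factors which cancel against each other. -/
def cancelChain {a₀ a₁ a₂ a₃ a₄ a₅ : B} {t : a₀ ⟶ a₅} {t' : a₅ ⟶ a₀} {f₁ : a₀ ⟶ a₁} {f₂ : a₁ ⟶ a₂}
    {f₃ : a₂ ⟶ a₃} {f₄ : a₃ ⟶ a₄} {f₅ : a₄ ⟶ a₅} {g₁ : a₁ ⟶ a₀} {g₂ : a₂ ⟶ a₁}
    {g₃ : a₃ ⟶ a₂} {g₄ : a₄ ⟶ a₃} {g₅ : a₅ ⟶ a₄} (H : t ≅ f₁ ≫ f₂ ≫ f₃ ≫ f₄ ≫ f₅)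
    (H' : t' ≅ g₅ ≫ g₄ ≫ g₃ ≫ g₂ ≫ g₁) (κ₅ : f₅ ≫ g₅ ≅ 𝟙 _) (κ₄ : f₄ ≫ g₄ ≅ 𝟙 _)
    (κ₃ : f₃ ≫ g₃ ≅ 𝟙 _) (κ₂ : f₂ ≫ g₂ ≅ 𝟙 _) (κ₁ : f₁ ≫ g₁ ≅ 𝟙 _) : t ≫ t' ≅ 𝟙 a₀ :=
  whiskerRightIso H t' ≪⊗≫
  whiskerLeftIso (f₁ ≫ f₂ ≫ f₃ ≫ f₄ ≫ f₅) H' ≪⊗≫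
  midCancel (f₁ ≫ f₂ ≫ f₃ ≫ f₄) κ₅ (g₄ ≫ g₃ ≫ g₂ ≫ g₁) ≪⊗≫
  midCancel (f₁ ≫ f₂ ≫ f₃) κ₄ (g₃ ≫ g₂ ≫ g₁) ≪⊗≫
  midCancel (f₁ ≫ f₂) κ₃ (g₂ ≫ g₁) ≪⊗≫
  midCancel f₁ κ₂ g₁ ≪⊗≫
  κ₁

end Chains

section

variable {B : Type u} [Bicategory.{w, v} B] [BraidedBicategory B]

end

/-! ### Functoriality of the tensor product -/

section TensorLaws

variable {B : Type u} [Bicategory.{w, v} B] [TensorBicategory B]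

theorem ten₂_id {x x' y y' : B} (f : x ⟶ x') (g : y ⟶ y') : ten₂ (𝟙 f) (𝟙 g) = 𝟙 (f ⊠₁ g) :=
  (TensorBicategory.tensor (B := B)).map₂_id (Prod.mkHom f g)

theorem ten₂_comp {x x' y y' : B} {f f' f'' : x ⟶ x'} {g g' g'' : y ⟶ y'} (η : f ⟶ f')
    (η' : f' ⟶ f'') (θ : g ⟶ g') (θ' : g' ⟶ g'') :
    ten₂ (η ≫ η') (θ ≫ θ') = ten₂ η θ ≫ ten₂ η' θ' :=
  (TensorBicategory.tensor (B := B)).map₂_comp (f := Prod.mkHom f g) (g := Prod.mkHom f' g')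
    (h := Prod.mkHom f'' g'') (Prod.mkHom η θ) (Prod.mkHom η' θ')

theorem ten₂_whiskerLeft {x x' x'' y y' y'' : B} (f : x ⟶ x') {h h' : x' ⟶ x''} (η : h ⟶ h')
    (g : y ⟶ y') {k k' : y' ⟶ y''} (θ : k ⟶ k') :
    ten₂ (f ◁ η) (g ◁ θ) =
      (tenComp f h g k).hom ≫ (f ⊠₁ g) ◁ ten₂ η θ ≫ (tenComp f h' g k').inv :=
  (TensorBicategory.tensor (B := B)).map₂_whisker_left (a := (x, y)) (b := (x', y'))
    (c := (x'', y'')) (Prod.mkHom f g) (g := Prod.mkHom h k) (h := Prod.mkHom h' k')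
    (Prod.mkHom η θ)

theorem ten₂_whiskerRight {x x' x'' y y' y'' : B} {f f' : x ⟶ x'} (η : f ⟶ f') (h : x' ⟶ x'')
    {g g' : y ⟶ y'} (θ : g ⟶ g') (k : y' ⟶ y'') :
    ten₂ (η ▷ h) (θ ▷ k) =
      (tenComp f h g k).hom ≫ ten₂ η θ ▷ (h ⊠₁ k) ≫ (tenComp f' h g' k).inv :=
  (TensorBicategory.tensor (B := B)).map₂_whisker_right (a := (x, y)) (b := (x', y'))
    (c := (x'', y'')) (f := Prod.mkHom f g) (g := Prod.mkHom f' g') (Prod.mkHom η θ)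
    (Prod.mkHom h k)

theorem ten₂_associator {a b c d a' b' c' d' : B} (f : a ⟶ b) (g : b ⟶ c) (h : c ⟶ d)
    (f' : a' ⟶ b') (g' : b' ⟶ c') (h' : c' ⟶ d') :
    ten₂ (α_ f g h).hom (α_ f' g' h').hom =
      (tenComp (f ≫ g) h (f' ≫ g') h').hom ≫ (tenComp f g f' g').hom ▷ (h ⊠₁ h') ≫
        (α_ _ _ _).hom ≫ (f ⊠₁ f') ◁ (tenComp g h g' h').inv ≫
          (tenComp f (g ≫ h) f' (g' ≫ h')).inv :=
  (TensorBicategory.tensor (B := B)).map₂_associator (a := (a, a')) (b := (b, b'))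
    (c := (c, c')) (d := (d, d')) (Prod.mkHom f f') (Prod.mkHom g g') (Prod.mkHom h h')

theorem tenIso_hom {x x' y y' : B} {f f' : x ⟶ x'} {g g' : y ⟶ y'} (η : f ≅ f') (θ : g ≅ g') :
    (tenIso η θ).hom = ten₂ η.hom θ.hom := rfl

theorem tenIso_inv {x x' y y' : B} {f f' : x ⟶ x'} {g g' : y ⟶ y'} (η : f ≅ f') (θ : g ≅ g') :
    (tenIso η θ).inv = ten₂ η.inv θ.inv := rfl

theorem ten₂_associator_inv {a b c d a' b' c' d' : B} (f : a ⟶ b) (g : b ⟶ c) (h : c ⟶ d)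
    (f' : a' ⟶ b') (g' : b' ⟶ c') (h' : c' ⟶ d') :
    ten₂ (α_ f g h).inv (α_ f' g' h').inv =
      (tenComp f (g ≫ h) f' (g' ≫ h')).hom ≫ (f ⊠₁ f') ◁ (tenComp g h g' h').hom ≫
        (α_ _ _ _).inv ≫ (tenComp f g f' g').inv ▷ (h ⊠₁ h') ≫
          (tenComp (f ≫ g) h (f' ≫ g') h').inv := by
  have e : tenIso (α_ f g h) (α_ f' g' h') = tenComp (f ≫ g) h (f' ≫ g') h' ≪≫
      whiskerRightIso (tenComp f g f' g') (h ⊠₁ h') ≪≫ α_ _ _ _ ≪≫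
      whiskerLeftIso (f ⊠₁ f') (tenComp g h g' h').symm ≪≫ (tenComp f (g ≫ h) f' (g' ≫ h')).symm :=
    Iso.ext (ten₂_associator f g h f' g' h')
  simpa [tenIso_inv] using congrArg Iso.inv e

theorem ten₂_leftUnitor {a b a' b' : B} (f : a ⟶ b) (f' : a' ⟶ b') :
    ten₂ (λ_ f).hom (λ_ f').hom =
      (tenComp (𝟙 a) f (𝟙 a') f').hom ≫ (tenId a a').hom ▷ (f ⊠₁ f') ≫ (λ_ _).hom :=
  (TensorBicategory.tensor (B := B)).map₂_left_unitor (a := (a, a')) (b := (b, b'))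
    (Prod.mkHom f f')

theorem ten₂_leftUnitor_inv {a b a' b' : B} (f : a ⟶ b) (f' : a' ⟶ b') :
    ten₂ (λ_ f).inv (λ_ f').inv =
      (λ_ _).inv ≫ (tenId a a').inv ▷ (f ⊠₁ f') ≫ (tenComp (𝟙 a) f (𝟙 a') f').inv := by
  have e : tenIso (λ_ f) (λ_ f') = tenComp (𝟙 a) f (𝟙 a') f' ≪≫
      whiskerRightIso (tenId a a') (f ⊠₁ f') ≪≫ λ_ _ := Iso.ext (ten₂_leftUnitor f f')
  simpa [tenIso_inv] using congrArg Iso.inv e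

theorem ten₂_rightUnitor {a b a' b' : B} (f : a ⟶ b) (f' : a' ⟶ b') :
    ten₂ (ρ_ f).hom (ρ_ f').hom =
      (tenComp f (𝟙 b) f' (𝟙 b')).hom ≫ (f ⊠₁ f') ◁ (tenId b b').hom ≫ (ρ_ _).hom :=
  (TensorBicategory.tensor (B := B)).map₂_right_unitor (a := (a, a')) (b := (b, b'))
    (Prod.mkHom f f')

theorem tenComp_whiskerRight {x x' x'' y y' y'' : B} {f f' : x ⟶ x'} (η : f ⟶ f') (h : x' ⟶ x'')
    {g g' : y ⟶ y'} (θ : g ⟶ g') (k : y' ⟶ y'') :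
    (tenComp f h g k).hom ≫ ten₂ η θ ▷ (h ⊠₁ k) =
      ten₂ (η ▷ h) (θ ▷ k) ≫ (tenComp f' h g' k).hom := by
  rw [ten₂_whiskerRight]; simp

theorem tenComp_whiskerLeft {x x' x'' y y' y'' : B} (f : x ⟶ x') {h h' : x' ⟶ x''} (η : h ⟶ h')
    (g : y ⟶ y') {k k' : y' ⟶ y''} (θ : k ⟶ k') :
    (tenComp f h g k).hom ≫ (f ⊠₁ g) ◁ ten₂ η θ =
      ten₂ (f ◁ η) (g ◁ θ) ≫ (tenComp f h' g k').hom := by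
  rw [ten₂_whiskerLeft]; simp

theorem tenSq_hom {a a' b b' c c' d d' : B} {f : a ⟶ a'} {p : a ⟶ b} {p' : a' ⟶ b'} {g : b ⟶ b'}
    {h : c ⟶ c'} {q : c ⟶ d} {q' : c' ⟶ d'} {k : d ⟶ d'} (s : Sq f p p' g) (t : Sq h q q' k) :
    (tenSq s t).hom = (tenComp f p' h q').inv ≫ ten₂ s.hom t.hom ≫ (tenComp p g q k).hom := rfl

variable {a a' b b' c c' d d' : B}

/-- Naturality of `tenComp` brings the two equations side by side as the two arguments of one
`ten₂`, where functoriality multiplies them. -/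
theorem Sq.Compat.ten {f : a ⟶ a'} {p p₁ : a ⟶ b} {p' p₁' : a' ⟶ b'} {g : b ⟶ b'}
    {h : c ⟶ c'} {q q₁ : c ⟶ d} {q' q₁' : c' ⟶ d'} {k : d ⟶ d'} {s : Sq f p p' g}
    {s₁ : Sq f p₁ p₁' g} {t : Sq h q q' k} {t₁ : Sq h q₁ q₁' k} {m : p ≅ p₁} {m' : p' ≅ p₁'}
    {n : q ≅ q₁} {n' : q' ≅ q₁'} (hs : Sq.Compat s s₁ m m') (ht : Sq.Compat t t₁ n n') :
    Sq.Compat (tenSq s t) (tenSq s₁ t₁) (tenIso m n) (tenIso m' n') := by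
  have hs := congrArg Iso.hom hs
  have ht := congrArg Iso.hom ht
  simp only [Iso.trans_hom, whiskerLeftIso_hom, whiskerRightIso_hom] at hs ht
  apply Iso.ext
  simp only [Iso.trans_hom, whiskerLeftIso_hom, whiskerRightIso_hom, tenSq_hom, tenIso_hom,
    Category.assoc]
  rw [tenComp_whiskerRight, ← cancel_epi (tenComp f p' h q').hom,
    reassoc_of% tenComp_whiskerLeft f m'.hom h n'.hom]
  simp only [Iso.hom_inv_id_assoc]
  rw [← Category.assoc (ten₂ _ _), ← ten₂_comp, hs, ht, ← Category.assoc (ten₂ _ _), ← ten₂_comp]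

/-- Tensoring the associators inside a pasted square produces the associativity constraint of the
pseudofunctor `tensor`; expanding it makes all inner copies of `tenComp` cancel. -/
theorem tenComp_compat {a₂ c₂ a₂' c₂' : B} {f : a ⟶ a'} {p : a ⟶ b} {p' : a' ⟶ b'} {g : b ⟶ b'}
    {h : c ⟶ c'} {q : c ⟶ d} {q' : c' ⟶ d'} {k : d ⟶ d'} {r : b ⟶ a₂} {r' : b' ⟶ a₂'}
    {l : a₂ ⟶ a₂'} {o : d ⟶ c₂} {o' : d' ⟶ c₂'} {j : c₂ ⟶ c₂'} (s : Sq f p p' g)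
    (s' : Sq g r r' l) (t : Sq h q q' k) (t' : Sq k o o' j) :
    Sq.Compat (tenSq (s.comp s') (t.comp t')) ((tenSq s t).comp (tenSq s' t'))
      (tenComp p r q o) (tenComp p' r' q' o') := by
  apply Iso.ext
  simp only [Sq.comp, Iso.trans_hom, whiskerLeftIso_hom, whiskerRightIso_hom, tenSq_hom,
    Category.assoc, Iso.symm_hom, ten₂_comp]
  rw [ten₂_associator, ten₂_associator_inv, ten₂_associator_inv, ten₂_whiskerLeft,
    ten₂_whiskerRight]
  simp

theorem tenId_compat (f : a ⟶ a') (g : b ⟶ b') :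
    Sq.Compat (tenSq (Sq.refl f) (Sq.refl g)) (Sq.refl (f ⊠₁ g)) (tenId a b) (tenId a' b') := by
  apply Iso.ext
  simp only [Sq.refl, Iso.trans_hom, whiskerLeftIso_hom, whiskerRightIso_hom, tenSq_hom,
    Category.assoc, Iso.symm_hom, ten₂_comp, ten₂_rightUnitor, ten₂_leftUnitor_inv]
  simp

end TensorLaws

/-! ### Squares and adjoint inverses -/

section Inverses

variable {B : Type u} [Bicategory.{w, v} B]

theorem AdjointInverse.unit_whiskerRight {a b : B} {f : a ⟶ b} (e : AdjointInverse f) :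
    e.unit.inv ▷ f = (α_ _ _ _).hom ≫ f ◁ e.counit.hom ≫ (ρ_ _).hom ≫ (λ_ _).inv := by
  have h := congrArg Iso.hom e.left_triangle
  simp only [leftZigzagIso_hom, leftZigzag, Iso.trans_hom, Iso.symm_hom] at h
  rw [← cancel_epi (e.unit.hom ▷ f), ← comp_whiskerRight, Iso.hom_inv_id]
  have h' : e.unit.hom ▷ f ≫ (α_ _ _ _).hom ≫ f ◁ e.counit.hom = (λ_ f).hom ≫ (ρ_ f).inv := by
    rw [← h]; simp [bicategoricalComp]
  rw [reassoc_of% h']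
  simp

theorem AdjointInverse.whiskerLeft_counit {a b : B}
    {f : a ⟶ b} (e : AdjointInverse f) :
    f ◁ e.counit.hom = (α_ _ _ _).inv ≫ e.unit.inv ▷ f ≫ (λ_ _).hom ≫ (ρ_ _).inv := by
  rw [e.unit_whiskerRight]; simp

variable {a a' b b' : B} {f : a ⟶ a'} {g : b ⟶ b'} {p : a ⟶ b} {p' : a' ⟶ b'}

theorem Sq.inv_hom (s : Sq f p p' g) (e : AdjointInverse p) (e' : AdjointInverse p') :
    (s.inv e e').hom = (λ_ _).inv ≫ e.counit.inv ▷ (g ≫ e'.inv) ⊗≫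
      e.inv ◁ Iso.inv s ▷ e'.inv ⊗≫ (e.inv ≫ f) ◁ e'.unit.inv ≫ (ρ_ _).hom := rfl

/-- The triangle identity replaces the unit in the mate by the counit; the interchange law then
brings `s` next to its inverse and the counits next to theirs. Applied to the associator square, it
makes the cancellation of associators a 2-isomorphism of `Arr B`. -/
theorem Sq.inv_comp_compat (s : Sq f p p' g) (e : AdjointInverse p) (e' : AdjointInverse p') :
    Sq.Compat ((s.inv e e').comp s) (Sq.refl g) e.counit e'.counit := by
  apply Iso.ext
  simp only [Sq.comp, Sq.refl, Iso.trans_hom, whiskerLeftIso_hom, whiskerRightIso_hom,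
    Iso.symm_hom, Sq.inv_hom]
  symm
  calc _ = 𝟙 _ ⊗≫ e.counit.inv ▷ (g ≫ e'.inv ≫ p') ⊗≫ e.inv ◁ Iso.inv s ▷ (e'.inv ≫ p') ⊗≫
        (e.inv ≫ f) ◁ (e'.unit.inv ▷ p') ⊗≫ e.inv ◁ s.hom ⊗≫ e.counit.hom ▷ g := by bicategory
    _ = 𝟙 _ ⊗≫ e.counit.inv ▷ (g ≫ e'.inv ≫ p') ⊗≫ e.inv ◁ (Iso.inv s ▷ (e'.inv ≫ p') ⊗≫
        ((f ≫ p') ◁ e'.counit.hom ≫ s.hom ▷ 𝟙 _)) ⊗≫ e.counit.hom ▷ g := by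
      rw [e'.unit_whiskerRight]; bicategory
    _ = 𝟙 _ ⊗≫ e.counit.inv ▷ (g ≫ e'.inv ≫ p') ⊗≫ e.inv ◁ ((Iso.inv s ≫ s.hom) ▷ (e'.inv ≫ p') ⊗≫
        (p ≫ g) ◁ e'.counit.hom) ⊗≫ e.counit.hom ▷ g := by
      rw [whisker_exchange]; bicategory
    _ = 𝟙 _ ⊗≫ e.counit.inv ▷ (g ≫ e'.inv ≫ p') ⊗≫
        (((e.inv ≫ p) ≫ g) ◁ e'.counit.hom ≫ (e.counit.hom ▷ g) ▷ 𝟙 _) ⊗≫ 𝟙 _ := by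
      rw [Iso.inv_hom_id]; bicategory
    _ = 𝟙 _ ⊗≫ (e.counit.inv ≫ e.counit.hom) ▷ (g ≫ e'.inv ≫ p') ⊗≫
        g ◁ e'.counit.hom ⊗≫ 𝟙 _ := by
      rw [whisker_exchange]; bicategory
    _ = _ := by rw [Iso.inv_hom_id]; bicategory

theorem AdjointInverse.whiskerLeft_counit_inv {a b : B} {f : a ⟶ b} (e : AdjointInverse f) :
    f ◁ e.counit.inv = (ρ_ _).hom ≫ (λ_ _).inv ≫ e.unit.hom ▷ f ≫ (α_ _ _ _).hom := by
  rw [← cancel_mono (f ◁ e.counit.hom), ← whiskerLeft_comp, Iso.inv_hom_id,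
    ← cancel_mono ((ρ_ _).hom ≫ (λ_ _).inv)]
  have h := e.unit_whiskerRight
  simp only [Category.assoc, ← h]
  simp

/-- The same cancellation in the other order, with the triangle identity now turning the inverse
counit into the unit. -/
theorem Sq.comp_inv_compat (s : Sq f p p' g) (e : AdjointInverse p) (e' : AdjointInverse p') :
    Sq.Compat (s.comp (s.inv e e')) (Sq.refl f) e.unit.symm e'.unit.symm := by
  apply Iso.ext
  simp only [Sq.comp, Sq.refl, Iso.trans_hom, whiskerLeftIso_hom, whiskerRightIso_hom,
    Iso.symm_hom, Sq.inv_hom]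
  symm
  calc _ = 𝟙 _ ⊗≫ s.hom ▷ e'.inv ⊗≫ (p ◁ e.counit.inv) ▷ (g ≫ e'.inv) ⊗≫
        (p ≫ e.inv) ◁ (Iso.inv s ▷ e'.inv) ⊗≫ (p ≫ e.inv ≫ f) ◁ e'.unit.inv ⊗≫
        e.unit.inv ▷ f := by bicategory
    _ = 𝟙 _ ⊗≫ s.hom ▷ e'.inv ⊗≫ (e.unit.hom ▷ ((p ≫ g) ≫ e'.inv) ≫
        (p ≫ e.inv) ◁ (Iso.inv s ▷ e'.inv)) ⊗≫ (p ≫ e.inv ≫ f) ◁ e'.unit.inv ⊗≫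
        e.unit.inv ▷ f := by rw [e.whiskerLeft_counit_inv]; bicategory
    _ = 𝟙 _ ⊗≫ (s.hom ≫ Iso.inv s) ▷ e'.inv ⊗≫ (e.unit.hom ▷ (f ≫ p' ≫ e'.inv) ≫
        (p ≫ e.inv) ◁ (f ◁ e'.unit.inv)) ⊗≫ e.unit.inv ▷ f := by
      rw [← whisker_exchange]; bicategory
    _ = 𝟙 _ ⊗≫ (𝟙 _ ◁ (f ◁ e'.unit.inv)) ⊗≫ (e.unit.hom ≫ e.unit.inv) ▷ f := by
      rw [← whisker_exchange, Iso.hom_inv_id]; bicategory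
    _ = _ := by rw [Iso.hom_inv_id]; bicategory

end Inverses

/-! ### Tensor products of squares, and naturality of the half syllepsis formulas -/

namespace Arr

section Tensor

variable {B : Type u} [Bicategory.{w, v} B] [TensorBicategory B]

/-- The tensor product of two arrows. -/
def ten (X Y : Arr B) : Arr B := ⟨X.src ⊠ Y.src, X.tgt ⊠ Y.tgt, X.arr ⊠₁ Y.arr⟩

/-- The tensor product of two squares. -/
def tenHom {X X' Y Y' : Arr B} (F : X ⟶ X') (G : Y ⟶ Y') : ten X Y ⟶ ten X' Y' :=
  ⟨F.top ⊠₁ G.top, F.bot ⊠₁ G.bot, tenSq F.sq G.sq⟩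

/-- The tensor product of two compatible pairs of 2-isomorphisms. -/
def tenMap {X X' Y Y' : Arr B} {F F' : X ⟶ X'} {G G' : Y ⟶ Y'} (η : F ≅ F') (θ : G ≅ G') :
    tenHom F G ≅ tenHom F' G' :=
  mkIso (F := tenHom F G) (G := tenHom F' G') (tenIso (topIso η) (topIso θ))
    (tenIso (botIso η) (botIso θ)) ((compat_of_iso η).ten (compat_of_iso θ))

/-- The tensor product of arrows preserves composition. -/
def tenMapComp {X X' X'' Y Y' Y'' : Arr B} (F : X ⟶ X') (F' : X' ⟶ X'') (G : Y ⟶ Y')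
    (G' : Y' ⟶ Y'') : tenHom (F ≫ F') (G ≫ G') ≅ tenHom F G ≫ tenHom F' G' :=
  mkIso (F := tenHom (F ≫ F') (G ≫ G')) (G := tenHom F G ≫ tenHom F' G')
    (tenComp F.top F'.top G.top G'.top) (tenComp F.bot F'.bot G.bot G'.bot)
    (tenComp_compat F.sq F'.sq G.sq G'.sq)

/-- The tensor product of arrows preserves identities. -/
def tenMapId (X Y : Arr B) : tenHom (𝟙 X) (𝟙 Y) ≅ 𝟙 (ten X Y) :=
  mkIso (F := tenHom (𝟙 X) (𝟙 Y)) (G := 𝟙 (ten X Y))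
    (tenId X.src Y.src) (tenId X.tgt Y.tgt) (tenId_compat X.arr Y.arr)

/-- Tensoring a cancelling pair of squares on the left. -/
def cancelLeft (X : Arr B) {Y Y' : Arr B} {F : Y ⟶ Y'} {G : Y' ⟶ Y} (θ : F ≫ G ≅ 𝟙 Y) :
    tenHom (𝟙 X) F ≫ tenHom (𝟙 X) G ≅ 𝟙 (ten X Y) :=
  (tenMap (λ_ (𝟙 X)).symm (Iso.refl (F ≫ G)) ≪≫ tenMapComp (𝟙 X) (𝟙 X) F G).symm ≪≫
    tenMap (Iso.refl (𝟙 X)) θ ≪≫ tenMapId X Y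

/-- Tensoring a cancelling pair of squares on the right. -/
def cancelRight {Y Y' : Arr B} {F : Y ⟶ Y'} {G : Y' ⟶ Y} (θ : F ≫ G ≅ 𝟙 Y) (X : Arr B) :
    tenHom F (𝟙 X) ≫ tenHom G (𝟙 X) ≅ 𝟙 (ten Y X) :=
  (tenMap (Iso.refl (F ≫ G)) (λ_ (𝟙 X)).symm ≪≫ tenMapComp F G (𝟙 X) (𝟙 X)).symm ≪≫
    tenMap θ (Iso.refl (𝟙 X)) ≪≫ tenMapId Y X

/-- The associator square. -/
def ascHom (X Y Z : Arr B) : ten (ten X Y) Z ⟶ ten X (ten Y Z) :=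
  ⟨asc X.src Y.src Z.src, asc X.tgt Y.tgt Z.tgt, ascSq X.arr Y.arr Z.arr⟩

/-- The inverse associator square. -/
def iscHom (X Y Z : Arr B) : ten X (ten Y Z) ⟶ ten (ten X Y) Z :=
  ⟨isc X.src Y.src Z.src, isc X.tgt Y.tgt Z.tgt, iscSq X.arr Y.arr Z.arr⟩

/-- Cancellation of associator squares. -/
def ascIscIso (X Y Z : Arr B) : ascHom X Y Z ≫ iscHom X Y Z ≅ 𝟙 (ten (ten X Y) Z) :=
  mkIso (F := ascHom X Y Z ≫ iscHom X Y Z) (G := 𝟙 (ten (ten X Y) Z))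
    (ascIsc X.src Y.src Z.src) (ascIsc X.tgt Y.tgt Z.tgt)
    (Sq.comp_inv_compat _ _ _)

/-- Cancellation of associator squares. -/
def iscAscIso (X Y Z : Arr B) : iscHom X Y Z ≫ ascHom X Y Z ≅ 𝟙 (ten X (ten Y Z)) :=
  mkIso (F := iscHom X Y Z ≫ ascHom X Y Z) (G := 𝟙 (ten X (ten Y Z)))
    (iscAsc X.src Y.src Z.src) (iscAsc X.tgt Y.tgt Z.tgt)
    (Sq.inv_comp_compat _ _ _)

end Tensor

section Braided

variable {B : Type u} [Bicategory.{w, v} B] [BraidedBicategory B]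

/-- The braiding square. -/
def brHom (X Y : Arr B) : ten X Y ⟶ ten Y X :=
  ⟨br X.src Y.src, br X.tgt Y.tgt, brSq X.arr Y.arr⟩

/-- The hexagonator `R` on arrows. -/
def hexRIso (X Y Z : Arr B) :
    tenHom (brHom X Y) (𝟙 Z) ≫ ascHom Y X Z ≫ tenHom (𝟙 Y) (brHom X Z) ≅
      ascHom X Y Z ≫ brHom X (ten Y Z) ≫ ascHom Y Z X :=
  mkIso (F := tenHom (brHom X Y) (𝟙 Z) ≫ ascHom Y X Z ≫ tenHom (𝟙 Y) (brHom X Z))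
    (G := ascHom X Y Z ≫ brHom X (ten Y Z) ≫ ascHom Y Z X)
    (hexR X.src Y.src Z.src) (hexR X.tgt Y.tgt Z.tgt)
    (BraidedBicategory.R_natural X.arr Y.arr Z.arr)

/-- The hexagonator `S` on arrows. -/
def hexSIso (X Y Z : Arr B) :
    tenHom (𝟙 X) (brHom Y Z) ≫ iscHom X Z Y ≫ tenHom (brHom X Z) (𝟙 Y) ≅
      iscHom X Y Z ≫ brHom (ten X Y) Z ≫ iscHom Z X Y :=
  mkIso (F := tenHom (𝟙 X) (brHom Y Z) ≫ iscHom X Z Y ≫ tenHom (brHom X Z) (𝟙 Y))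
    (G := iscHom X Y Z ≫ brHom (ten X Y) Z ≫ iscHom Z X Y)
    (hexS X.src Y.src Z.src) (hexS X.tgt Y.tgt Z.tgt)
    (BraidedBicategory.S_natural X.arr Y.arr Z.arr)

/-- A compatible pair of 2-isomorphisms from double braidings to identities. -/
def pairIso {X Y : Arr B} {m : br X.src Y.src ≫ br Y.src X.src ≅ 𝟙 (X.src ⊠ Y.src)}
    {m' : br X.tgt Y.tgt ≫ br Y.tgt X.tgt ≅ 𝟙 (X.tgt ⊠ Y.tgt)} (h : PairCompat X.arr Y.arr m m') :
    brHom X Y ≫ brHom Y X ≅ 𝟙 (ten X Y) :=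
  mkIso (F := brHom X Y ≫ brHom Y X) (G := 𝟙 (ten X Y)) m m' h

/-- The decomposition `decompR` on arrows. -/
def decompRIso (X Y Z : Arr B) := hexDecomp (hexRIso X Y Z) (iscAscIso X Y Z) (ascIscIso Y Z X)

/-- The decomposition `decompS` on arrows. -/
def decompSIso (X Y Z : Arr B) := hexDecomp (hexSIso X Y Z) (ascIscIso X Y Z) (iscAscIso Z X Y)

end Braided

end Arr

section Naturality

variable {B : Type u} [Bicategory.{w, v} B] [BraidedBicategory B]

/-- The formula is evaluated on the arrows `f`, `g`, `h` instead of objects. Its ingredients lift to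
`Arr B` by the naturality of `R`, `S` and the associators and by the hypotheses on `s` and `s'`. -/
theorem sylMul_natural {x x' y y' z z' : B} {s : SylFamily x} {s' : SylFamily x'} {f : x ⟶ x'}
    {g : y ⟶ y'} {h : z ⟶ z'} (hg : PairCompat f g (s y) (s' y'))
    (hh : PairCompat f h (s z) (s' z')) :
    PairCompat f (g ⊠₁ h) (sylMul s y z) (sylMul s' y' z') := by
  let X : Arr B := ⟨x, x', f⟩
  let Y : Arr B := ⟨y, y', g⟩
  let Z : Arr B := ⟨z, z', h⟩
  have e := Arr.compat_of_iso (cancelChain (Arr.decompRIso X Y Z) (Arr.decompSIso Y Z X)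
    (Arr.iscAscIso Y Z X) (Arr.cancelLeft Y (Arr.pairIso (X := X) (Y := Z) hh))
    (Arr.ascIscIso Y X Z) (Arr.cancelRight (Arr.pairIso (X := X) (Y := Y) hg) Z)
    (Arr.iscAscIso X Y Z))
  -- The chain in `Arr B` projects, by unfolding, to `sylMul` on the sources and on the targets.
  exact e

theorem tensorFamily_natural {x x' y y' z z' : B} {s : SylFamily x} {s' : SylFamily x'}
    {t : SylFamily y} {t' : SylFamily y'} {f : x ⟶ x'} {g : y ⟶ y'} {h : z ⟶ z'}
    (hf : PairCompat f h (s z) (s' z')) (hg : PairCompat g h (t z) (t' z')) :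
    PairCompat (f ⊠₁ g) h (tensorFamily s t z) (tensorFamily s' t' z') := by
  let X : Arr B := ⟨x, x', f⟩
  let Y : Arr B := ⟨y, y', g⟩
  let Z : Arr B := ⟨z, z', h⟩
  have e := Arr.compat_of_iso (cancelChain (Arr.decompSIso X Y Z) (Arr.decompRIso Z X Y)
    (Arr.ascIscIso Z X Y) (Arr.cancelRight (Arr.pairIso (X := X) (Y := Z) hf) Y)
    (Arr.iscAscIso X Z Y) (Arr.cancelLeft X (Arr.pairIso (X := Y) (Y := Z) hg))
    (Arr.ascIscIso X Y Z))
  exact e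

end Naturality

/-! ### The slice bicategory, with scalars -/

section Slices

variable {B : Type u} [Bicategory.{w, v} B] [LinearBicategory B]

/-- The objects over `e`. -/
structure Slice (e : B) where
  /-- the underlying object -/
  obj : B
  /-- the structure 1-morphism -/
  str : obj ⟶ e

namespace Slice

variable {e : B}

/-- The 1-morphisms over `e`, which commute with the structure 1-morphisms up to a
2-isomorphism. -/
structure Hom (X Y : Slice e) where
  /-- the underlying 1-morphism -/
  map : X.obj ⟶ Y.obj
  /-- the compatibility with the structure 1-morphisms -/
  tri : map ≫ Y.str ≅ X.str

/-- The 2-morphisms over `e`, which are compatible with the structure 2-morphisms up to a scalar. -/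
@[ext]
structure Hom₂ {X Y : Slice e} (F G : Hom X Y) where
  /-- the underlying 2-morphism -/
  cell : F.map ⟶ G.map
  /-- the scalar -/
  scalar : ℂ
  w : cell ▷ Y.str ≫ G.tri.hom = scalar • F.tri.hom

/-- The scalar is part of the data, not merely asserted to exist, so that the scalar of a composite
is computed by simplification. -/
instance homCategory (X Y : Slice e) : Category (Hom X Y) where
  Hom F G := Hom₂ F G
  id F := ⟨𝟙 _, 1, by simp⟩
  comp η θ := ⟨η.cell ≫ θ.cell, η.scalar * θ.scalar, by
    rw [comp_whiskerRight, Category.assoc, θ.w, Linear.comp_smul, η.w, smul_smul, mul_comm]⟩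
  id_comp η := Hom₂.ext (Category.id_comp _) (one_mul _)
  comp_id η := Hom₂.ext (Category.comp_id _) (mul_one _)
  assoc η θ ι := Hom₂.ext (Category.assoc _ _ _) (mul_assoc _ _ _)

instance categoryStruct : CategoryStruct (Slice e) where
  Hom X Y := Hom X Y
  id X := ⟨𝟙 _, λ_ _⟩
  comp F G := ⟨F.map ≫ G.map, α_ _ _ _ ≪≫ whiskerLeftIso F.map G.tri ≪≫ F.tri⟩

/-- A 2-isomorphism compatible with the structure 2-morphisms up to an invertible scalar. -/
noncomputable def mkIso {X Y : Slice e} {F G : X ⟶ Y} (m : F.map ≅ G.map) (r : ℂ) (hr : r ≠ 0)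
    (h : m.hom ▷ Y.str ≫ G.tri.hom = r • F.tri.hom) : @Iso (Hom X Y) _ F G where
  hom := ⟨m.hom, r, h⟩
  inv := ⟨m.inv, r⁻¹, by
    rw [← cancel_epi (m.hom ▷ Y.str), ← comp_whiskerRight_assoc, Iso.hom_inv_id, Linear.comp_smul,
      h, smul_smul, inv_mul_cancel₀ hr]
    simp⟩
  hom_inv_id := Hom₂.ext m.hom_inv_id (mul_inv_cancel₀ hr)
  inv_hom_id := Hom₂.ext m.inv_hom_id (inv_mul_cancel₀ hr)

/-- The underlying 2-isomorphism. -/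
def cellIso {X Y : Slice e} {F G : Hom X Y} (i : F ≅ G) : F.map ≅ G.map where
  hom := i.hom.cell
  inv := i.inv.cell
  hom_inv_id := congrArg Hom₂.cell i.hom_inv_id
  inv_hom_id := congrArg Hom₂.cell i.inv_hom_id

theorem scalar_mul_inv {X Y : Slice e} {F G : Hom X Y} (i : F ≅ G) :
    i.hom.scalar * i.inv.scalar = 1 := congrArg Hom₂.scalar i.hom_inv_id

theorem scalar_inv {X Y : Slice e} {F G : Hom X Y} (i : F ≅ G) :
    i.inv.scalar = i.hom.scalar⁻¹ := eq_inv_of_mul_eq_one_right (scalar_mul_inv i)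

theorem scalar_ne_zero {X Y : Slice e} {F G : Hom X Y} (i : F ≅ G) : i.hom.scalar ≠ 0 :=
  left_ne_zero_of_mul_eq_one (scalar_mul_inv i)

/-- The laws for cells are those of `B`. The laws for scalars hold in `ℂ`: composition multiplies
scalars, whiskering keeps them, and the structural 2-isomorphisms have scalar 1. -/
noncomputable instance bicategory : Bicategory (Slice e) where
  homCategory X Y := homCategory X Y
  whiskerLeft F G H η := ⟨F.map ◁ η.cell, η.scalar, by
    have h := η.w
    change _ ▷ _ ≫ (α_ _ _ _).hom ≫ _ ◁ _ ≫ _ = _ • ((α_ _ _ _).hom ≫ _ ◁ _ ≫ _)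
    rw [associator_naturality_middle_assoc, ← whiskerLeft_comp_assoc, h,
      LinearBicategory.whiskerLeft_smul, Linear.smul_comp, Linear.comp_smul]⟩
  whiskerRight {X Y Z F G} η H := ⟨η.cell ▷ H.map, η.scalar, by
    have h := η.w
    change _ ▷ _ ≫ (α_ _ _ _).hom ≫ _ ◁ _ ≫ _ = _ • ((α_ _ _ _).hom ≫ _ ◁ _ ≫ _)
    rw [associator_naturality_left_assoc, ← whisker_exchange_assoc, h, Linear.comp_smul,
      Linear.comp_smul]⟩
  associator F G H := mkIso (α_ _ _ _) 1 one_ne_zero (by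
    change _ ▷ _ ≫ (α_ _ _ _).hom ≫ _ ◁ ((α_ _ _ _).hom ≫ _ ◁ _ ≫ _) ≫ _ =
      _ • ((α_ _ _ _).hom ≫ _ ◁ _ ≫ (α_ _ _ _).hom ≫ _ ◁ _ ≫ _)
    simp)
  leftUnitor F := mkIso (λ_ _) 1 one_ne_zero (by
    change _ ▷ _ ≫ _ = _ • ((α_ _ _ _).hom ≫ _ ◁ _ ≫ (λ_ _).hom)
    simp)
  rightUnitor F := mkIso (ρ_ _) 1 one_ne_zero (by
    change _ ▷ _ ≫ _ = _ • ((α_ _ _ _).hom ≫ _ ◁ (λ_ _).hom ≫ _)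
    simp)
  whiskerLeft_id F G := Hom₂.ext (whiskerLeft_id _ _) rfl
  whiskerLeft_comp F _ _ _ η θ := Hom₂.ext (whiskerLeft_comp _ _ _) rfl
  id_whiskerLeft η := Hom₂.ext (id_whiskerLeft _)
    (show _ = (1 : ℂ) * (_ * (1 : ℂ)⁻¹) by simp)
  comp_whiskerLeft F G _ _ η := Hom₂.ext (comp_whiskerLeft _ _ _)
    (show _ = (1 : ℂ) * (_ * (1 : ℂ)⁻¹) by simp)
  id_whiskerRight F G := Hom₂.ext (id_whiskerRight _ _) rfl
  comp_whiskerRight η θ F := Hom₂.ext (comp_whiskerRight _ _ _) rfl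
  whiskerRight_id η := Hom₂.ext (whiskerRight_id _)
    (show _ = (1 : ℂ) * (_ * (1 : ℂ)⁻¹) by simp)
  whiskerRight_comp η F G := Hom₂.ext (whiskerRight_comp _ _ _)
    (show _ = (1 : ℂ)⁻¹ * (_ * (1 : ℂ)) by simp)
  whisker_assoc F _ _ η G := Hom₂.ext (whisker_assoc _ _ _)
    (show _ = (1 : ℂ) * (_ * (1 : ℂ)⁻¹) by simp)
  whisker_exchange η θ := Hom₂.ext (whisker_exchange _ _) (mul_comm _ _)
  pentagon F G H I := Hom₂.ext (pentagon _ _ _ _) (show (1 : ℂ) * (1 * 1) = 1 * 1 by simp)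
  triangle F G := Hom₂.ext (triangle _ _) (show (1 : ℂ) * 1 = 1 by simp)

/-! ### Scalars of composite 2-isomorphisms. -/

section Scalars

variable {X Y Z W : Slice e}

@[simp] theorem scalar_id (F : X ⟶ Y) : Hom₂.scalar (𝟙 F) = 1 := rfl

@[simp] theorem scalar_comp {F G H : X ⟶ Y} (η : F ⟶ G) (θ : G ⟶ H) :
    Hom₂.scalar (η ≫ θ) = η.scalar * θ.scalar := rfl

@[simp] theorem scalar_whiskerLeft (F : X ⟶ Y) {G H : Y ⟶ Z} (η : G ⟶ H) :
    Hom₂.scalar (F ◁ η) = η.scalar := rfl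

@[simp] theorem scalar_whiskerRight {F G : X ⟶ Y} (η : F ⟶ G) (H : Y ⟶ Z) :
    Hom₂.scalar (η ▷ H) = η.scalar := rfl

@[simp] theorem scalar_associator (F : X ⟶ Y) (G : Y ⟶ Z) (H : Z ⟶ W) :
    Hom₂.scalar (α_ F G H).hom = 1 := rfl

@[simp] theorem scalar_associator_inv (F : X ⟶ Y) (G : Y ⟶ Z) (H : Z ⟶ W) :
    Hom₂.scalar (α_ F G H).inv = 1 := by rw [scalar_inv]; simp

@[simp] theorem scalar_leftUnitor (F : X ⟶ Y) : Hom₂.scalar (λ_ F).hom = 1 := rfl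

@[simp] theorem scalar_rightUnitor (F : X ⟶ Y) : Hom₂.scalar (ρ_ F).hom = 1 := rfl

theorem scalar_hexDecomp {a b c d e' f : Slice e} {b₁ : b ⟶ c} {a₁ : c ⟶ d} {b₂ : d ⟶ e'}
    {a₀ : b ⟶ a} {t : a ⟶ f} {a₂ : f ⟶ e'} {i₀ : a ⟶ b} {i₂ : e' ⟶ f}
    (H : b₁ ≫ a₁ ≫ b₂ ≅ a₀ ≫ t ≫ a₂) (κ : i₀ ≫ a₀ ≅ 𝟙 a) (κ' : a₂ ≫ i₂ ≅ 𝟙 f)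
    (hH : H.hom.scalar = 1) (hκ : κ.hom.scalar = 1) (hκ' : κ'.hom.scalar = 1) :
    (hexDecomp H κ κ').hom.scalar = 1 := by
  simp [hexDecomp, bicategoricalIsoComp, scalar_inv, hH, hκ, hκ']

/-- In the half syllepsis formulas the second and fourth cancellations are the two places where a
value of a family `v` enters; everything else is an associator or a hexagonator. -/
theorem scalar_cancelChain {a₀ a₁ a₂ a₃ a₄ a₅ : Slice e} {t : a₀ ⟶ a₅} {t' : a₅ ⟶ a₀}
    {f₁ : a₀ ⟶ a₁} {f₂ : a₁ ⟶ a₂}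
    {f₃ : a₂ ⟶ a₃} {f₄ : a₃ ⟶ a₄} {f₅ : a₄ ⟶ a₅} {g₁ : a₁ ⟶ a₀} {g₂ : a₂ ⟶ a₁}
    {g₃ : a₃ ⟶ a₂} {g₄ : a₄ ⟶ a₃} {g₅ : a₅ ⟶ a₄} (H : t ≅ f₁ ≫ f₂ ≫ f₃ ≫ f₄ ≫ f₅)
    (H' : t' ≅ g₅ ≫ g₄ ≫ g₃ ≫ g₂ ≫ g₁) (κ₅ : f₅ ≫ g₅ ≅ 𝟙 _) (κ₄ : f₄ ≫ g₄ ≅ 𝟙 _)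
    (κ₃ : f₃ ≫ g₃ ≅ 𝟙 _) (κ₂ : f₂ ≫ g₂ ≅ 𝟙 _) (κ₁ : f₁ ≫ g₁ ≅ 𝟙 _)
    (hH : H.hom.scalar = 1) (hH' : H'.hom.scalar = 1) (h₅ : κ₅.hom.scalar = 1)
    (h₃ : κ₃.hom.scalar = 1) (h₁ : κ₁.hom.scalar = 1) :
    (cancelChain H H' κ₅ κ₄ κ₃ κ₂ κ₁).hom.scalar = κ₄.hom.scalar * κ₂.hom.scalar := by
  simp [cancelChain, midCancel, bicategoricalIsoComp, hH, hH', h₅, h₃, h₁]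

end Scalars

end Slice

end Slices

/-! ### Tensoring with a fixed object -/

section Whiskering

variable {B : Type u} [Bicategory.{w, v} B] [TensorBicategory B]

theorem ten₂_whiskerRight_inv {x x' x'' y y' y'' : B} {f f' : x ⟶ x'} (η : f ⟶ f') (h : x' ⟶ x'')
    {g g' : y ⟶ y'} (θ : g ⟶ g') (k : y' ⟶ y'') :
    ten₂ η θ ▷ (h ⊠₁ k) ≫ (tenComp f' h g' k).inv =
      (tenComp f h g k).inv ≫ ten₂ (η ▷ h) (θ ▷ k) := by
  rw [ten₂_whiskerRight]; simp

theorem ten₂_whiskerLeft_inv {x x' x'' y y' y'' : B} (f : x ⟶ x') {h h' : x' ⟶ x''} (η : h ⟶ h')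
    (g : y ⟶ y') {k k' : y' ⟶ y''} (θ : k ⟶ k') :
    (f ⊠₁ g) ◁ ten₂ η θ ≫ (tenComp f h' g k').inv =
      (tenComp f h g k).inv ≫ ten₂ (f ◁ η) (g ◁ θ) := by
  rw [ten₂_whiskerLeft]; simp

/-- `x ⊗ -` on 2-morphisms. -/
def wl₂ (x : B) {y y' : B} {f g : y ⟶ y'} (η : f ⟶ g) : x ◃ f ⟶ x ◃ g := ten₂ (𝟙 (𝟙 x)) η

/-- `- ⊗ y` on 2-morphisms. -/
def wr₂ {x x' : B} {f g : x ⟶ x'} (η : f ⟶ g) (y : B) : f ▹ y ⟶ g ▹ y := ten₂ η (𝟙 (𝟙 y))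

theorem wl₂_comp (x : B) {y y' : B} {f g h : y ⟶ y'} (η : f ⟶ g) (θ : g ⟶ h) :
    wl₂ x (η ≫ θ) = wl₂ x η ≫ wl₂ x θ := by
  delta wl₂ wl; rw [← ten₂_comp, Category.comp_id]

theorem wr₂_comp {x x' : B} {f g h : x ⟶ x'} (η : f ⟶ g) (θ : g ⟶ h) (y : B) :
    wr₂ (η ≫ θ) y = wr₂ η y ≫ wr₂ θ y := by
  delta wr₂ wr; rw [← ten₂_comp, Category.comp_id]

theorem wlIso_hom (x : B) {y y' : B} {f g : y ⟶ y'} (η : f ≅ g) : (wlIso x η).hom = wl₂ x η.hom :=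
  rfl

theorem wrIso_hom {x x' : B} {f g : x ⟶ x'} (η : f ≅ g) (y : B) : (wrIso η y).hom = wr₂ η.hom y :=
  rfl

theorem wl₂_whiskerRight (x : B) {y y' y'' : B} {f f' : y ⟶ y'} (η : f ⟶ f') (c : y' ⟶ y'') :
    wl₂ x η ▷ (x ◃ c) ≫ (wlComp x f' c).inv = (wlComp x f c).inv ≫ wl₂ x (η ▷ c) := by
  delta wl₂ wlComp wl
  simp only [Iso.trans_inv, tenIso_inv, Category.assoc, Iso.symm_inv, Iso.refl_inv]
  rw [reassoc_of% ten₂_whiskerRight_inv, ← ten₂_comp, ← ten₂_comp]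
  simp

theorem wr₂_whiskerRight {x x' x'' : B} {f f' : x ⟶ x'} (η : f ⟶ f') (c : x' ⟶ x'') (y : B) :
    wr₂ η y ▷ (c ▹ y) ≫ (wrComp f' c y).inv = (wrComp f c y).inv ≫ wr₂ (η ▷ c) y := by
  delta wr₂ wrComp wr
  simp only [Iso.trans_inv, tenIso_inv, Category.assoc, Iso.symm_inv, Iso.refl_inv]
  rw [reassoc_of% ten₂_whiskerRight_inv, ← ten₂_comp, ← ten₂_comp]
  simp

theorem wl₂_whiskerLeft (x : B) {y y' y'' : B} (f : y ⟶ y') {c c' : y' ⟶ y''} (η : c ⟶ c') :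
    (x ◃ f) ◁ wl₂ x η ≫ (wlComp x f c').inv = (wlComp x f c).inv ≫ wl₂ x (f ◁ η) := by
  delta wl₂ wlComp wl
  simp only [Iso.trans_inv, tenIso_inv, Category.assoc, Iso.symm_inv, Iso.refl_inv]
  rw [reassoc_of% ten₂_whiskerLeft_inv, ← ten₂_comp, ← ten₂_comp]
  simp

theorem wr₂_whiskerLeft {x x' x'' : B} (f : x ⟶ x') {c c' : x' ⟶ x''} (η : c ⟶ c') (y : B) :
    (f ▹ y) ◁ wr₂ η y ≫ (wrComp f c' y).inv = (wrComp f c y).inv ≫ wr₂ (f ◁ η) y := by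
  delta wr₂ wrComp wr
  simp only [Iso.trans_inv, tenIso_inv, Category.assoc, Iso.symm_inv, Iso.refl_inv]
  rw [reassoc_of% ten₂_whiskerLeft_inv, ← ten₂_comp, ← ten₂_comp]
  simp

theorem wl₂_leftUnitor (x : B) {y y' : B} (c : y ⟶ y') :
    (wlId x y).hom ▷ (x ◃ c) ≫ (λ_ _).hom = (wlComp x (𝟙 y) c).inv ≫ wl₂ x (λ_ c).hom := by
  delta wl₂ wlComp wlId wl
  simp only [Iso.trans_inv, tenIso_inv, Category.assoc, Iso.symm_inv, Iso.refl_inv]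
  rw [← ten₂_comp, Category.id_comp, Category.comp_id, ten₂_leftUnitor]
  simp

theorem wr₂_leftUnitor {x x' : B} (c : x ⟶ x') (y : B) :
    (wrId x y).hom ▷ (c ▹ y) ≫ (λ_ _).hom = (wrComp (𝟙 x) c y).inv ≫ wr₂ (λ_ c).hom y := by
  delta wr₂ wrComp wrId wr
  simp only [Iso.trans_inv, tenIso_inv, Category.assoc, Iso.symm_inv, Iso.refl_inv]
  rw [← ten₂_comp, Category.id_comp, Category.comp_id, ten₂_leftUnitor]
  simp

/-- The associativity constraint of `x ⊗ -` is that of `tensor`, corrected in the first factor,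
where `wlComp` identifies `𝟙 x ≫ 𝟙 x` with `𝟙 x`. -/
theorem wl₂_associator (x : B) {y₀ y₁ y₂ y₃ : B} (f : y₀ ⟶ y₁) (g : y₁ ⟶ y₂) (h : y₂ ⟶ y₃) :
    (wlComp x f g).inv ▷ (x ◃ h) ≫ (wlComp x (f ≫ g) h).inv ≫ wl₂ x (α_ f g h).hom =
      (α_ _ _ _).hom ≫ (x ◃ f) ◁ (wlComp x g h).inv ≫ (wlComp x f (g ≫ h)).inv := by
  -- The two ways of collapsing three copies of `𝟙 x` differ by an associator; inserting it lets
  -- `ten₂_associator` apply.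
  have e₃ : ten₂ ((λ_ (𝟙 x)).hom ▷ 𝟙 x ≫ (λ_ (𝟙 x)).hom) (α_ f g h).hom =
      ten₂ (α_ (𝟙 x) (𝟙 x) (𝟙 x)).hom (α_ f g h).hom ≫
        ten₂ (𝟙 x ◁ (λ_ (𝟙 x)).hom ≫ (λ_ (𝟙 x)).hom) (𝟙 (f ≫ g ≫ h)) := by
    rw [← ten₂_comp]
    congr 1 <;> simp
  delta wl₂ wlComp wl
  simp only [Iso.trans_inv, tenIso_inv, Category.assoc, Iso.symm_inv, Iso.refl_inv,
    comp_whiskerRight, whiskerLeft_comp]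
  rw [reassoc_of% ten₂_whiskerRight_inv, reassoc_of% ten₂_whiskerLeft_inv, ← ten₂_comp,
    ← ten₂_comp, ← ten₂_comp]
  simp only [Category.comp_id, id_whiskerRight, Category.id_comp, whiskerLeft_id]
  rw [e₃, ten₂_associator]
  simp

theorem wr₂_associator {x₀ x₁ x₂ x₃ : B} (f : x₀ ⟶ x₁) (g : x₁ ⟶ x₂) (h : x₂ ⟶ x₃) (y : B) :
    (wrComp f g y).inv ▷ (h ▹ y) ≫ (wrComp (f ≫ g) h y).inv ≫ wr₂ (α_ f g h).hom y =
      (α_ _ _ _).hom ≫ (f ▹ y) ◁ (wrComp g h y).inv ≫ (wrComp f (g ≫ h) y).inv := by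
  have e₃ : ten₂ (α_ f g h).hom ((λ_ (𝟙 y)).hom ▷ 𝟙 y ≫ (λ_ (𝟙 y)).hom) =
      ten₂ (α_ f g h).hom (α_ (𝟙 y) (𝟙 y) (𝟙 y)).hom ≫
        ten₂ (𝟙 (f ≫ g ≫ h)) (𝟙 y ◁ (λ_ (𝟙 y)).hom ≫ (λ_ (𝟙 y)).hom) := by
    rw [← ten₂_comp]
    congr 1 <;> simp
  delta wr₂ wrComp wr
  simp only [Iso.trans_inv, tenIso_inv, Category.assoc, Iso.symm_inv, Iso.refl_inv,
    comp_whiskerRight, whiskerLeft_comp]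
  rw [reassoc_of% ten₂_whiskerRight_inv, reassoc_of% ten₂_whiskerLeft_inv, ← ten₂_comp,
    ← ten₂_comp, ← ten₂_comp]
  simp only [Category.comp_id, id_whiskerRight, Category.id_comp, whiskerLeft_id]
  rw [e₃, ten₂_associator]
  simp

variable {y y' z t : B} {c : y ⟶ z} {c' : y' ⟶ z} {f : y ⟶ y'} {g : y' ⟶ y}

/-- This and `wlCancel_tri'` bring the two sides of the slice condition for a tensored cancellation
to the same shape: a fixed 2-morphism followed by `wl₂ x` of the corresponding side of the condition
before tensoring. Linearity of `wl₂ x` can then carry a scalar across. -/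
theorem wlCancel_tri (x : B) (θ : f ≫ g ≅ 𝟙 y) (d : x ⊠ z ⟶ t) :
    (wlCancel x θ).hom ▷ (x ◃ c ≫ d) ≫ (λ_ _).hom =
      (α_ _ _ _).inv ≫ ((wlComp x f g).inv ▷ (x ◃ c) ≫ (wlComp x (f ≫ g) c).inv ≫
        wl₂ x (θ.hom ▷ c ≫ (λ_ c).hom)) ▷ d := by
  have e := wl₂_leftUnitor x c
  have e₁ := wl₂_whiskerRight x θ.hom c
  rw [wl₂_comp, ← reassoc_of% e₁, ← e]
  simp only [wlCancel, Iso.trans_hom, Iso.symm_hom, comp_whiskerRight, Category.assoc, wlIso_hom]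
  simp

theorem wlCancel_tri' (x : B) (φ : f ≫ c' ≅ c) (ψ : g ≫ c ≅ c') (d : x ⊠ z ⟶ t) :
    (α_ _ _ _).hom ≫ (x ◃ f) ◁ ((α_ _ _ _).inv ≫ ((wlComp x g c).inv ≫ wl₂ x ψ.hom) ▷ d) ≫
      (α_ _ _ _).inv ≫ ((wlComp x f c').inv ≫ wl₂ x φ.hom) ▷ d =
    (α_ _ _ _).inv ≫ ((wlComp x f g).inv ▷ (x ◃ c) ≫ (wlComp x (f ≫ g) c).inv ≫
        wl₂ x ((α_ _ _ _).hom ≫ f ◁ ψ.hom ≫ φ.hom)) ▷ d := by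
  have e := wl₂_associator x f g c
  have e₁ := wl₂_whiskerLeft x f ψ.hom
  rw [wl₂_comp, wl₂_comp, reassoc_of% e, ← reassoc_of% e₁]
  simp

theorem wrCancel_tri (x : B) (θ : f ≫ g ≅ 𝟙 y) (d : z ⊠ x ⟶ t) :
    (wrCancel θ x).hom ▷ (c ▹ x ≫ d) ≫ (λ_ _).hom =
      (α_ _ _ _).inv ≫ ((wrComp f g x).inv ▷ (c ▹ x) ≫ (wrComp (f ≫ g) c x).inv ≫
        wr₂ (θ.hom ▷ c ≫ (λ_ c).hom) x) ▷ d := by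
  have e := wr₂_leftUnitor c x
  have e₁ := wr₂_whiskerRight θ.hom c x
  rw [wr₂_comp, ← reassoc_of% e₁, ← e]
  simp only [wrCancel, Iso.trans_hom, Iso.symm_hom, comp_whiskerRight, Category.assoc, wrIso_hom]
  simp

theorem wrCancel_tri' (x : B) (φ : f ≫ c' ≅ c) (ψ : g ≫ c ≅ c') (d : z ⊠ x ⟶ t) :
    (α_ _ _ _).hom ≫ (f ▹ x) ◁ ((α_ _ _ _).inv ≫ ((wrComp g c x).inv ≫ wr₂ ψ.hom x) ▷ d) ≫
      (α_ _ _ _).inv ≫ ((wrComp f c' x).inv ≫ wr₂ φ.hom x) ▷ d =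
    (α_ _ _ _).inv ≫ ((wrComp f g x).inv ▷ (c ▹ x) ≫ (wrComp (f ≫ g) c x).inv ≫
        wr₂ ((α_ _ _ _).hom ≫ f ◁ ψ.hom ≫ φ.hom) x) ▷ d := by
  have e := wr₂_associator f g c x
  have e₁ := wr₂_whiskerLeft f ψ.hom x
  rw [wr₂_comp, wr₂_comp, reassoc_of% e, ← reassoc_of% e₁]
  simp

end Whiskering

/-! ### Fusion of simple objects -/

theorem bicategoricalIsoComp_hom {B : Type u} [Bicategory.{w, v} B] {a b : B} {f g h i : a ⟶ b}
    [BicategoricalCoherence g h] (η : f ≅ g) (θ : h ≅ i) : (η ≪⊗≫ θ).hom = η.hom ⊗≫ θ.hom := rfl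

/-- The tensor product of 2-morphisms is compatible with scalars. -/
structure TensorLinear (B : Type u) [Bicategory.{w, v} B] [LinearBicategory B]
    [TensorBicategory B] : Prop where
  ten_smul {x x' y y' : B} {f f' : x ⟶ x'} {g g' : y ⟶ y'} (r : ℂ) (η : f ⟶ f') (θ : g ⟶ g') :
    ten₂ η (r • θ) = r • ten₂ η θ
  smul_ten {x x' y y' : B} {f f' : x ⟶ x'} {g g' : y ⟶ y'} (r : ℂ) (η : f ⟶ f') (θ : g ⟶ g') :
    ten₂ (r • η) θ = r • ten₂ η θ

section Cancel

variable {B : Type u} [Bicategory.{w, v} B] [LinearBicategory B] [TensorBicategory B]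
  (hB : TensorLinear B) {y y' z t : B} {c : y ⟶ z} {c' : y' ⟶ z} {f : y ⟶ y'} {g : y' ⟶ y}

include hB

theorem wlCancel_smul (x : B) {φ : f ≫ c' ≅ c} {ψ : g ≫ c ≅ c'} {θ : f ≫ g ≅ 𝟙 y} {r : ℂ}
    (h : θ.hom ▷ c ≫ (λ_ c).hom = r • ((α_ _ _ _).hom ≫ f ◁ ψ.hom ≫ φ.hom)) (d : x ⊠ z ⟶ t) :
    (wlCancel x θ).hom ▷ (x ◃ c ≫ d) ≫ (λ_ _).hom =
      r • ((α_ _ _ _).hom ≫ (x ◃ f) ◁ ((α_ _ _ _).inv ≫ ((wlComp x g c).inv ≫ wl₂ x ψ.hom) ▷ d) ≫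
      (α_ _ _ _).inv ≫ ((wlComp x f c').inv ≫ wl₂ x φ.hom) ▷ d) := by
  rw [wlCancel_tri, wlCancel_tri', h]
  have e (η : (f ≫ g) ≫ c ⟶ c) : wl₂ x (r • η) = r • wl₂ x η := hB.ten_smul _ _ _
  rw [e, Linear.comp_smul, Linear.comp_smul, LinearBicategory.smul_whiskerRight, Linear.comp_smul]

theorem wrCancel_smul (x : B) {φ : f ≫ c' ≅ c} {ψ : g ≫ c ≅ c'} {θ : f ≫ g ≅ 𝟙 y} {r : ℂ}
    (h : θ.hom ▷ c ≫ (λ_ c).hom = r • ((α_ _ _ _).hom ≫ f ◁ ψ.hom ≫ φ.hom)) (d : z ⊠ x ⟶ t) :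
    (wrCancel θ x).hom ▷ (c ▹ x ≫ d) ≫ (λ_ _).hom =
      r • ((α_ _ _ _).hom ≫ (f ▹ x) ◁ ((α_ _ _ _).inv ≫ ((wrComp g c x).inv ≫ wr₂ ψ.hom x) ▷ d) ≫
      (α_ _ _ _).inv ≫ ((wrComp f c' x).inv ≫ wr₂ φ.hom x) ▷ d) := by
  rw [wrCancel_tri, wrCancel_tri', h]
  have e (η : (f ≫ g) ≫ c ⟶ c) : wr₂ (r • η) x = r • wr₂ η x := hB.smul_ten _ _ _
  rw [e, Linear.comp_smul, Linear.comp_smul, LinearBicategory.smul_whiskerRight, Linear.comp_smul]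

end Cancel

namespace FusionData

variable {B : Type u} [Bicategory.{w, v} B] [LinearBicategory B] [BraidedBicategory B]
  {L : Type*} [CommGroup L] (D : FusionData B L)

/-- The tensor product of two simple objects over their fusion. -/
def pairS (g h s : L) (hs : g * h = s) : Slice (D.e s) := ⟨D.e g ⊠ D.e h, D.χ g h s hs⟩

/-- Tensoring an object over `e p` with `e g` on the left. -/
def wlObj (g p s : L) (hs : g * p = s) (X : Slice (D.e p)) : Slice (D.e s) :=
  ⟨D.e g ⊠ X.obj, D.e g ◃ X.str ≫ D.χ g p s hs⟩

/-- Tensoring an object over `e p` with `e g` on the right. -/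
def wrObj (p g s : L) (hs : p * g = s) (X : Slice (D.e p)) : Slice (D.e s) :=
  ⟨X.obj ⊠ D.e g, X.str ▹ D.e g ≫ D.χ p g s hs⟩

/-- Tensoring a 1-morphism over `e p` with `e g` on the left. -/
def wlHom (g p s : L) (hs : g * p = s) {X Y : Slice (D.e p)} (F : X ⟶ Y) :
    D.wlObj g p s hs X ⟶ D.wlObj g p s hs Y :=
  ⟨D.e g ◃ F.map, (α_ _ _ _).symm ≪≫
    whiskerRightIso ((wlComp _ _ _).symm ≪≫ wlIso (D.e g) F.tri) (D.χ g p s hs)⟩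

/-- Tensoring a 1-morphism over `e p` with `e g` on the right. -/
def wrHom (p g s : L) (hs : p * g = s) {X Y : Slice (D.e p)} (F : X ⟶ Y) :
    D.wrObj p g s hs X ⟶ D.wrObj p g s hs Y :=
  ⟨F.map ▹ D.e g, (α_ _ _ _).symm ≪≫
    whiskerRightIso ((wrComp _ _ _).symm ≪≫ wrIso F.tri (D.e g)) (D.χ p g s hs)⟩

/-- The associator over the fusion of three simple objects. -/
def ascHom (g h k p q s : L) (hp : g * h = p) (hq : h * k = q) (hs : p * k = s) (ht : g * q = s) :
    D.wrObj p k s hs (D.pairS g h p hp) ⟶ D.wlObj g q s ht (D.pairS h k q hq) :=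
  ⟨asc (D.e g) (D.e h) (D.e k), (D.ω g h k p q s hp hq hs ht).symm⟩

/-- The inverse associator over the fusion of three simple objects. -/
def iscHom (g h k p q s : L) (hp : g * h = p) (hq : h * k = q) (hs : p * k = s) (ht : g * q = s) :
    D.wlObj g q s ht (D.pairS h k q hq) ⟶ D.wrObj p k s hs (D.pairS g h p hp) :=
  ⟨isc (D.e g) (D.e h) (D.e k), D.ωi g h k p q s hp hq hs ht⟩

/-- The braiding of two simple objects over their fusion. -/
def brHom (g h s : L) (hs : g * h = s) (hs' : h * g = s) : D.pairS g h s hs ⟶ D.pairS h g s hs' :=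
  ⟨br (D.e g) (D.e h), D.u g h s hs hs'⟩

/-- The braiding of a simple object with an object over a simple object. -/
def brLeft (g p s : L) (hs : g * p = s) (hs' : p * g = s) (X : Slice (D.e p)) :
    D.wlObj g p s hs X ⟶ D.wrObj p g s hs' X :=
  ⟨br (D.e g) X.obj, (α_ _ _ _).symm ≪≫ whiskerRightIso (br₂ (D.e g) X.str).symm _ ≪≫
    α_ _ _ _ ≪≫ whiskerLeftIso _ (D.u g p s hs hs')⟩

/-- The braiding of an object over a simple object with a simple object. -/
def brRight (p g s : L) (hs : p * g = s) (hs' : g * p = s) (X : Slice (D.e p)) :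
    D.wrObj p g s hs X ⟶ D.wlObj g p s hs' X :=
  ⟨br X.obj (D.e g), (α_ _ _ _).symm ≪≫ whiskerRightIso (br₁ X.str (D.e g)).symm _ ≪≫
    α_ _ _ _ ≪≫ whiskerLeftIso _ (D.u p g s hs hs')⟩

/-- Cancellation tensored on the left. -/
noncomputable def cancelLeft (hB : TensorLinear B) (g p s : L) (hs : g * p = s)
    {X Y : Slice (D.e p)} {F : X ⟶ Y} {G : Y ⟶ X} (θ : F ≫ G ≅ 𝟙 X) :
    D.wlHom g p s hs F ≫ D.wlHom g p s hs G ≅ 𝟙 (D.wlObj g p s hs X) :=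
  Slice.mkIso (F := D.wlHom g p s hs F ≫ D.wlHom g p s hs G) (G := 𝟙 (D.wlObj g p s hs X))
    (wlCancel (D.e g) (Slice.cellIso θ)) θ.hom.scalar (Slice.scalar_ne_zero θ)
    (wlCancel_smul hB (D.e g) (θ := Slice.cellIso θ) θ.hom.w (D.χ g p s hs))

/-- Cancellation tensored on the right. -/
noncomputable def cancelRight (hB : TensorLinear B) (p g s : L) (hs : p * g = s)
    {X Y : Slice (D.e p)} {F : X ⟶ Y} {G : Y ⟶ X} (θ : F ≫ G ≅ 𝟙 X) :
    D.wrHom p g s hs F ≫ D.wrHom p g s hs G ≅ 𝟙 (D.wrObj p g s hs X) :=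
  Slice.mkIso (F := D.wrHom p g s hs F ≫ D.wrHom p g s hs G) (G := 𝟙 (D.wrObj p g s hs X))
    (wrCancel (Slice.cellIso θ) (D.e g)) θ.hom.scalar (Slice.scalar_ne_zero θ)
    (wrCancel_smul hB (D.e g) (θ := Slice.cellIso θ) θ.hom.w (D.χ p g s hs))

/-! ### Cancelling associators over the fused object. -/

section Cancellation

variable (g h k p q s : L) (hp : g * h = p) (hq : h * k = q) (hs : p * k = s) (ht : g * q = s)

theorem iscAsc_tri : (iscAsc (D.e g) (D.e h) (D.e k)).hom ▷ (D.e g ◃ D.χ h k q hq ≫ D.χ g q s ht) ≫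
    (λ_ _).hom = (α_ _ _ _).hom ≫ isc (D.e g) (D.e h) (D.e k) ◁ (D.ω g h k p q s hp hq hs ht).inv ≫
      (D.ωi g h k p q s hp hq hs ht).hom := by
  simp [ωi, cancelFst]

/-- Since `ωi` is built from the counit of the associator equivalence, cancelling in this order
needs the triangle identity, which trades the counit for the unit. -/
theorem ascIsc_tri : (ascIsc (D.e g) (D.e h) (D.e k)).hom ▷ (D.χ g h p hp ▹ D.e k ≫ D.χ p k s hs) ≫
    (λ_ _).hom = (α_ _ _ _).hom ≫ asc (D.e g) (D.e h) (D.e k) ◁ (D.ωi g h k p q s hp hq hs ht).hom ≫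
      (D.ω g h k p q s hp hq hs ht).inv := by
  have e : asc (D.e g) (D.e h) (D.e k) ◁ (iscAsc (D.e g) (D.e h) (D.e k)).hom =
    (α_ _ _ _).inv ≫ (ascIsc (D.e g) (D.e h) (D.e k)).hom ▷ _ ≫ (λ_ _).hom ≫ (ρ_ _).inv :=
    AdjointInverse.whiskerLeft_counit _
  have e2 := whisker_exchange (ascIsc (D.e g) (D.e h) (D.e k)).hom
    (D.ω g h k p q s hp hq hs ht).hom
  rw [← cancel_mono (D.ω g h k p q s hp hq hs ht).hom]
  simp only [ωi, cancelFst, Iso.trans_hom, whiskerLeftIso_hom, whiskerRightIso_hom,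
    Iso.symm_hom, Category.assoc, Iso.inv_hom_id, Category.comp_id]
  have e3 : asc (D.e g) (D.e h) (D.e k) ◁ (iscAsc (D.e g) (D.e h) (D.e k)).hom ▷
      (D.e g ◃ D.χ h k q hq ≫ D.χ g q s ht) = (α_ _ _ _).inv ≫
      (asc (D.e g) (D.e h) (D.e k) ◁ (iscAsc (D.e g) (D.e h) (D.e k)).hom) ▷ _ ≫
      (α_ _ _ _).hom := by simp
  simp only [whiskerLeft_comp, e3, e]
  rw [← leftUnitor_naturality, ← reassoc_of% e2]
  bicategory

/-- Cancellation of associators over the fusion of three simple objects. -/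
noncomputable def iscAscIso :
    D.iscHom g h k p q s hp hq hs ht ≫ D.ascHom g h k p q s hp hq hs ht ≅
      𝟙 (D.wlObj g q s ht (D.pairS h k q hq)) :=
  Slice.mkIso (F := D.iscHom g h k p q s hp hq hs ht ≫ D.ascHom g h k p q s hp hq hs ht)
    (G := 𝟙 (D.wlObj g q s ht (D.pairS h k q hq))) (iscAsc (D.e g) (D.e h) (D.e k)) 1 one_ne_zero
    ((D.iscAsc_tri g h k p q s hp hq hs ht).trans (one_smul _ _).symm)

/-- Cancellation of associators over the fusion of three simple objects. -/
noncomputable def ascIscIso :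
    D.ascHom g h k p q s hp hq hs ht ≫ D.iscHom g h k p q s hp hq hs ht ≅
      𝟙 (D.wrObj p k s hs (D.pairS g h p hp)) :=
  Slice.mkIso (F := D.ascHom g h k p q s hp hq hs ht ≫ D.iscHom g h k p q s hp hq hs ht)
    (G := 𝟙 (D.wrObj p k s hs (D.pairS g h p hp))) (ascIsc (D.e g) (D.e h) (D.e k)) 1 one_ne_zero
    ((D.ascIsc_tri g h k p q s hp hq hs ht).trans (one_smul _ _).symm)

end Cancellation

section Hexagons

variable {D} (hD : D.Trivialises) (g h k : L)

include hD

/-- The trivialisation axiom `hexR` with `ω` moved to the other side: in this form it says that the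
hexagonator is a 2-morphism of `Slice` with scalar 1. -/
theorem Trivialises.hexR_tri (a b c s : L) (ha : g * h = a) (ha' : h * g = a) (hb : h * k = b)
    (hc : g * k = c) (hc' : k * g = c) (has : a * k = s) (hbs : g * b = s) (hbs' : b * g = s)
    (hcs : h * c = s) :
    (SylCentre.hexR (D.e g) (D.e h) (D.e k)).hom ▷ (D.e h ◃ D.χ k g c hc' ≫ D.χ h c s hcs) ≫
      (α_ _ _ _).hom ≫ asc (D.e g) (D.e h) (D.e k) ◁ ((α_ _ _ _).hom ≫
        br (D.e g) (D.e h ⊠ D.e k) ◁ (D.ω h k g b c s hb hc' hbs' hcs).inv ≫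
        (α_ _ _ _).inv ≫ (br₂ (D.e g) (D.χ h k b hb)).inv ▷ D.χ b g s hbs' ≫
        (α_ _ _ _).hom ≫ (D.e g ◃ D.χ h k b hb) ◁ (D.u g b s hbs hbs').hom) ≫
      (D.ω g h k a b s ha hb has hbs).inv =
    (α_ _ _ _).hom ≫ (br (D.e g) (D.e h) ▹ D.e k) ◁ ((α_ _ _ _).hom ≫
        asc (D.e h) (D.e g) (D.e k) ◁ ((α_ _ _ _).inv ≫
          (D.uL h g k c hc hc').hom ▷ D.χ h c s hcs) ≫
        (D.ω h g k a c s ha' hc has hcs).inv) ≫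
      (α_ _ _ _).inv ≫ (D.uR g h k a ha ha').hom ▷ D.χ a k s has := by
  have e := congrArg Iso.hom (hD.hexR g h k a b c s ha ha' hb hc hc' has hbs hbs' hcs)
  simp only [fuseR₁, fuseR₂, mid, Iso.symm_hom, bicategoricalIsoComp_hom,
    whiskerLeftIso_hom, whiskerRightIso_hom, Iso.refl_hom] at e
  -- Composing with `ω` and adjusting the bracketing turns the two sides into `fuseR₂` and `fuseR₁`.
  rw [← cancel_mono (D.ω g h k a b s ha hb has hbs).hom,
    ← cancel_epi ((br (D.e g) (D.e h) ▹ D.e k) ◁ (α_ _ _ _).inv ≫ (α_ _ _ _).inv)]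
  refine Eq.trans ?_ (e.symm.trans ?_)
  · simp only [Category.assoc, Iso.inv_hom_id]
    bicategory
  · simp only [Category.assoc]
    bicategory

theorem Trivialises.hexS_tri (a c d s : L) (ha : g * h = a) (hc : g * k = c) (hc' : k * g = c)
    (hd : h * k = d) (hd' : k * h = d) (has : a * k = s) (has' : k * a = s) (hcs : c * h = s)
    (hds : g * d = s) :
    (SylCentre.hexS (D.e g) (D.e h) (D.e k)).hom ▷ (D.χ k g c hc' ▹ D.e h ≫ D.χ c h s hcs) ≫
      (α_ _ _ _).hom ≫ isc (D.e g) (D.e h) (D.e k) ◁ ((α_ _ _ _).hom ≫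
        br (D.e g ⊠ D.e h) (D.e k) ◁ (D.ωi k g h c a s hc' ha hcs has').hom ≫
        (α_ _ _ _).inv ≫ (br₁ (D.χ g h a ha) (D.e k)).inv ▷ D.χ k a s has' ≫
        (α_ _ _ _).hom ≫ (D.χ g h a ha ▹ D.e k) ◁ (D.u a k s has has').hom) ≫
      (D.ωi g h k a d s ha hd has hds).hom =
    (α_ _ _ _).hom ≫ (D.e g ◃ br (D.e h) (D.e k)) ◁ ((α_ _ _ _).hom ≫
        isc (D.e g) (D.e k) (D.e h) ◁ ((α_ _ _ _).inv ≫
          (D.uR g k h c hc hc').hom ▷ D.χ c h s hcs) ≫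
        (D.ωi g k h c d s hc hd' hcs hds).hom) ≫
      (α_ _ _ _).inv ≫ (D.uL g h k d hd hd').hom ▷ D.χ g d s hds := by
  have e := congrArg Iso.hom (hD.hexS g h k a c d s ha hc hc' hd hd' has has' hcs hds)
  simp only [fuseS₁, fuseS₂, mid, Iso.symm_hom, bicategoricalIsoComp_hom,
    whiskerLeftIso_hom, whiskerRightIso_hom, Iso.refl_hom] at e
  rw [← cancel_mono (D.ωi g h k a d s ha hd has hds).inv,
    ← cancel_epi ((D.e g ◃ br (D.e h) (D.e k)) ◁ (α_ _ _ _).inv ≫ (α_ _ _ _).inv)]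
  refine Eq.trans ?_ (e.symm.trans ?_)
  · simp only [Category.assoc, Iso.hom_inv_id]
    bicategory
  · simp only [Category.assoc]
    bicategory

/-- The hexagonator `R` over the fusion of three simple objects. -/
noncomputable def hexRIso (a b c s : L) (ha : g * h = a) (ha' : h * g = a) (hb : h * k = b)
    (hc : g * k = c) (hc' : k * g = c) (has : a * k = s) (hbs : g * b = s) (hbs' : b * g = s)
    (hcs : h * c = s) :
    D.wrHom a k s has (D.brHom g h a ha ha') ≫ D.ascHom h g k a c s ha' hc has hcs ≫
      D.wlHom h c s hcs (D.brHom g k c hc hc') ≅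
    D.ascHom g h k a b s ha hb has hbs ≫ D.brLeft g b s hbs hbs' (D.pairS h k b hb) ≫
        D.ascHom h k g b c s hb hc' hbs' hcs :=
  Slice.mkIso (F := D.wrHom a k s has (D.brHom g h a ha ha') ≫
      D.ascHom h g k a c s ha' hc has hcs ≫ D.wlHom h c s hcs (D.brHom g k c hc hc'))
    (G := D.ascHom g h k a b s ha hb has hbs ≫ D.brLeft g b s hbs hbs' (D.pairS h k b hb) ≫
        D.ascHom h k g b c s hb hc' hbs' hcs) (SylCentre.hexR (D.e g) (D.e h) (D.e k)) 1 one_ne_zero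
    ((hD.hexR_tri g h k a b c s ha ha' hb hc hc' has hbs hbs' hcs).trans (one_smul _ _).symm)

/-- The hexagonator `S` over the fusion of three simple objects. -/
noncomputable def hexSIso (a c d s : L) (ha : g * h = a) (hc : g * k = c) (hc' : k * g = c)
    (hd : h * k = d) (hd' : k * h = d) (has : a * k = s) (has' : k * a = s) (hcs : c * h = s)
    (hds : g * d = s) :
    D.wlHom g d s hds (D.brHom h k d hd hd') ≫ D.iscHom g k h c d s hc hd' hcs hds ≫
      D.wrHom c h s hcs (D.brHom g k c hc hc') ≅
    D.iscHom g h k a d s ha hd has hds ≫ D.brRight a k s has has' (D.pairS g h a ha) ≫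
      D.iscHom k g h c a s hc' ha hcs has' :=
  Slice.mkIso (F := D.wlHom g d s hds (D.brHom h k d hd hd') ≫
      D.iscHom g k h c d s hc hd' hcs hds ≫ D.wrHom c h s hcs (D.brHom g k c hc hc'))
    (G := D.iscHom g h k a d s ha hd has hds ≫ D.brRight a k s has has' (D.pairS g h a ha) ≫
      D.iscHom k g h c a s hc' ha hcs has') (SylCentre.hexS (D.e g) (D.e h) (D.e k)) 1 one_ne_zero
    ((hD.hexS_tri g h k a c d s ha hc hc' hd hd' has has' hcs hds).trans (one_smul _ _).symm)

end Hexagons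

end FusionData

/-! ### The half syllepsis formulas on simple objects -/

/-- In the application `p`, `p'` are braidings with a tensor product, `b`, `b'` braidings with the
fused simple object, and `σ`, `σ'` the naturality squares along the fusion `i`. The braidings `p`,
`p'` are placed over `e` by the inverses of these squares, so pasting `σ` and `σ'` cancels them and
leaves the same scalar `r` on both sides. -/
theorem pasted_squares_whiskerRight {B : Type u} [Bicategory.{w, v} B] [LinearBicategory B]
    {a a' t t' e : B} {i : a ⟶ a'} {j : t ⟶ t'} {b : a' ⟶ t'} {b' : t' ⟶ a'} {p : a ⟶ t} {p' : t ⟶ a}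
    {c : a' ⟶ e} {c' : t' ⟶ e} (σ : Sq i p b j) (σ' : Sq j p' b' i) (φ : b ≫ c' ≅ c)
    (φ' : b' ≫ c ≅ c') {m : p ≫ p' ≅ 𝟙 a} {m' : b ≫ b' ≅ 𝟙 a'} {r : ℂ}
    (hm : m.hom ▷ (i ≫ c) ≫ (λ_ _).hom =
      r • ((α_ _ _ _).hom ≫ p ◁ ((α_ _ _ _).inv ≫ Iso.inv σ' ▷ c ≫ (α_ _ _ _).hom ≫ j ◁ φ'.hom) ≫
        (α_ _ _ _).inv ≫ Iso.inv σ ▷ c' ≫ (α_ _ _ _).hom ≫ i ◁ φ.hom))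
    (hm' : m'.hom ▷ c ≫ (λ_ _).hom = r • ((α_ _ _ _).hom ≫ b ◁ φ'.hom ≫ φ.hom)) :
    ((Sq.comp σ σ').hom ≫ m.hom ▷ i) ▷ c = (i ◁ m'.hom ≫ (ρ_ _).hom ≫ (λ_ _).inv) ▷ c := by
  have h₁ : m.hom ▷ (i ≫ c) = r • ((α_ _ _ _).hom ≫ p ◁ ((α_ _ _ _).inv ≫ Iso.inv σ' ▷ c ≫
      (α_ _ _ _).hom ≫ j ◁ φ'.hom) ≫ (α_ _ _ _).inv ≫ Iso.inv σ ▷ c' ≫ (α_ _ _ _).hom ≫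
      i ◁ φ.hom ≫ (λ_ _).inv) := by
    rw [← cancel_mono (λ_ (i ≫ c)).hom, hm]
    simp only [Linear.smul_comp, Category.assoc, Iso.inv_hom_id, Category.comp_id]
  have h₂ : m'.hom ▷ c = r • ((α_ _ _ _).hom ≫ b ◁ φ'.hom ≫ φ.hom ≫ (λ_ _).inv) := by
    rw [← cancel_mono (λ_ c).hom, hm']
    simp only [Linear.smul_comp, Category.assoc, Iso.inv_hom_id, Category.comp_id]
  calc _ = 𝟙 _ ⊗≫ (Iso.hom σ ▷ b' ⊗≫ p ◁ Iso.hom σ') ▷ c ⊗≫ m.hom ▷ (i ≫ c) ⊗≫ 𝟙 _ := by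
        simp only [Sq.comp, Iso.trans_hom, whiskerRightIso_hom, whiskerLeftIso_hom, Iso.symm_hom]
        bicategory
    _ = r • (𝟙 _ ⊗≫ Iso.hom σ ▷ b' ▷ c ⊗≫ p ◁ (Iso.hom σ' ≫ Iso.inv σ') ▷ c ⊗≫ p ◁ j ◁ φ'.hom ⊗≫
          Iso.inv σ ▷ c' ⊗≫ i ◁ φ.hom ⊗≫ 𝟙 _) := by
        rw [h₁]
        simp only [bicategoricalComp, Linear.smul_comp, Linear.comp_smul]
        congr 1
        bicategory
    _ = r • (𝟙 _ ⊗≫ (Iso.hom σ ▷ (b' ≫ c) ≫ (p ≫ j) ◁ φ'.hom) ⊗≫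
          Iso.inv σ ▷ c' ⊗≫ i ◁ φ.hom ⊗≫ 𝟙 _) := by
        rw [Iso.hom_inv_id]
        congr 1
        bicategory
    _ = r • (𝟙 _ ⊗≫ (i ≫ b) ◁ φ'.hom ⊗≫ (Iso.hom σ ≫ Iso.inv σ) ▷ c' ⊗≫ i ◁ φ.hom ⊗≫ 𝟙 _) := by
        rw [← whisker_exchange]
        congr 1
        bicategory
    _ = r • (𝟙 _ ⊗≫ i ◁ (b ◁ φ'.hom ≫ φ.hom) ⊗≫ 𝟙 _) := by
        rw [Iso.hom_inv_id]
        congr 1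
        bicategory
    _ = 𝟙 _ ⊗≫ i ◁ m'.hom ▷ c ⊗≫ 𝟙 _ := by
        rw [h₂, LinearBicategory.whiskerLeft_smul]
        simp only [bicategoricalComp, Linear.smul_comp, Linear.comp_smul]
        congr 1
        bicategory
    _ = _ := by bicategory

namespace FusionData

variable {B : Type u} [Bicategory.{w, v} B] [LinearBicategory B] [BraidedBicategory B]
  {L : Type*} [CommGroup L] (D : FusionData B L)

/-- A 2-isomorphism from the double braiding of two simple objects to the identity is the scalar `r`
under the identifications given by `χ` and `u`. -/
def IsTwist (g h s : L) (hs : g * h = s) (hs' : h * g = s)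
    (v : br (D.e g) (D.e h) ≫ br (D.e h) (D.e g) ≅ 𝟙 (D.e g ⊠ D.e h)) (r : ℂ) : Prop :=
  v.hom ▷ D.χ g h s hs ≫ (λ_ _).hom =
    r • ((α_ _ _ _).hom ≫ br (D.e g) (D.e h) ◁ (D.u h g s hs' hs).hom ≫ (D.u g h s hs hs').hom)

variable {D}

/-- The 2-isomorphism over the fusion of two simple objects given by a scalar. -/
noncomputable def IsTwist.iso {g h s : L} {hs : g * h = s} {hs' : h * g = s}
    {v : br (D.e g) (D.e h) ≫ br (D.e h) (D.e g) ≅ 𝟙 (D.e g ⊠ D.e h)} {r : ℂ}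
    (H : D.IsTwist g h s hs hs' v r) (hr : r ≠ 0) :
    D.brHom g h s hs hs' ≫ D.brHom h g s hs' hs ≅ 𝟙 (D.pairS g h s hs) :=
  Slice.mkIso (F := D.brHom g h s hs hs' ≫ D.brHom h g s hs' hs) (G := 𝟙 (D.pairS g h s hs)) v r hr H

section Hexagons

variable (hB : TensorLinear B) (hD : D.Trivialises) (g h k : L)

include hB hD

/-- By unfolding, `sylMul` is the cell of a `cancelChain` in `Slice (D.e t)`. Only the cancellations
`κ₂` and `κ₄`, which contain `v` on `e_h` and on `e_k`, have scalars other than 1. -/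
theorem sylMul_tri (a b c t : L) (ha : g * h = a) (ha' : h * g = a) (hb : h * k = b)
    (hc : g * k = c) (hc' : k * g = c) (hat : a * k = t) (hbt : g * b = t) (hbt' : b * g = t)
    (hct : h * c = t) {v : SylFamily (D.e g)} {r r' : ℂ} (hr : r ≠ 0) (hr' : r' ≠ 0)
    (H : D.IsTwist g h a ha ha' (v (D.e h)) r) (H' : D.IsTwist g k c hc hc' (v (D.e k)) r') :
    (sylMul v (D.e h) (D.e k)).hom ▷ (D.e g ◃ D.χ h k b hb ≫ D.χ g b t hbt) ≫ (λ_ _).hom =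
      (r * r') • (D.brLeft g b t hbt hbt' (D.pairS h k b hb) ≫
        D.brRight b g t hbt' hbt (D.pairS h k b hb)).tri.hom := by
  let κ₁ := D.iscAscIso g h k a b t ha hb hat hbt
  let κ₂ := D.cancelRight hB a k t hat (H.iso hr)
  let κ₃ := D.ascIscIso h g k a c t ha' hc hat hct
  let κ₄ := D.cancelLeft hB h c t hct (H'.iso hr')
  let κ₅ := D.iscAscIso h k g b c t hb hc' hbt' hct
  let κ₆ := D.ascIscIso h k g b c t hb hc' hbt' hct
  let R := hexRIso hD g h k a b c t ha ha' hb hc hc' hat hbt hbt' hct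
  let S := hexSIso hD h k g b a c t hb ha' ha hc' hc hbt' hbt hat hct
  let e := cancelChain (hexDecomp R κ₁ κ₆) (hexDecomp S κ₆ κ₁) κ₅ κ₄ κ₃ κ₂ κ₁
  have h₁ : e.hom.scalar = r' * r :=
    Slice.scalar_cancelChain (hexDecomp R κ₁ κ₆) (hexDecomp S κ₆ κ₁) κ₅ κ₄ κ₃ κ₂ κ₁
      (Slice.scalar_hexDecomp R κ₁ κ₆ rfl rfl rfl) (Slice.scalar_hexDecomp S κ₆ κ₁ rfl rfl rfl)
      rfl rfl rfl
  have h₂ := e.hom.w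
  -- The chain meets `e_k` before `e_h`, so the product appears in the opposite order.
  rw [h₁, mul_comm] at h₂
  exact h₂

theorem tensorFamily_tri (a c d t : L) (ha : g * h = a) (hc : g * k = c) (hc' : k * g = c)
    (hd : h * k = d) (hd' : k * h = d) (hat : a * k = t) (hat' : k * a = t) (hct : c * h = t)
    (hdt : g * d = t) {v : SylFamily (D.e g)} {v' : SylFamily (D.e h)} {r r' : ℂ} (hr : r ≠ 0)
    (hr' : r' ≠ 0) (H : D.IsTwist g k c hc hc' (v (D.e k)) r)
    (H' : D.IsTwist h k d hd hd' (v' (D.e k)) r') :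
    (tensorFamily v v' (D.e k)).hom ▷ (D.χ g h a ha ▹ D.e k ≫ D.χ a k t hat) ≫ (λ_ _).hom =
      (r * r') • (D.brRight a k t hat hat' (D.pairS g h a ha) ≫
        D.brLeft k a t hat' hat (D.pairS g h a ha)).tri.hom := by
  let κ₁ := D.ascIscIso g h k a d t ha hd hat hdt
  let κ₂ := D.cancelLeft hB g d t hdt (H'.iso hr')
  let κ₃ := D.iscAscIso g k h c d t hc hd' hct hdt
  let κ₄ := D.cancelRight hB c h t hct (H.iso hr)
  let κ₅ := D.ascIscIso k g h c a t hc' ha hct hat'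
  let κ₆ := D.iscAscIso k g h c a t hc' ha hct hat'
  let S := hexSIso hD g h k a c d t ha hc hc' hd hd' hat hat' hct hdt
  let R := hexRIso hD k g h c a d t hc' hc ha hd' hd hct hat' hat hdt
  let e := cancelChain (hexDecomp S κ₁ κ₆) (hexDecomp R κ₆ κ₁) κ₅ κ₄ κ₃ κ₂ κ₁
  have h₁ : e.hom.scalar = r * r' :=
    Slice.scalar_cancelChain (hexDecomp S κ₁ κ₆) (hexDecomp R κ₆ κ₁) κ₅ κ₄ κ₃ κ₂ κ₁
      (Slice.scalar_hexDecomp S κ₁ κ₆ rfl rfl rfl) (Slice.scalar_hexDecomp R κ₆ κ₁ rfl rfl rfl)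
      rfl rfl rfl
  have h₂ := e.hom.w
  rw [h₁] at h₂
  exact h₂

/-- This is the link between tensor compatibility and multiplicativity: a value on `e_b` with scalar
`r * r'` is the one corresponding to `sylMul` along fusion. The assumption `hf` removes the final
whiskering by `χ`. -/
theorem sylMul_pairCompat (a b c t : L) (ha : g * h = a) (ha' : h * g = a) (hb : h * k = b)
    (hc : g * k = c) (hc' : k * g = c) (hat : a * k = t) (hbt : g * b = t) (hbt' : b * g = t)
    (hct : h * c = t) {v : SylFamily (D.e g)} {r r' : ℂ} (hr : r ≠ 0) (hr' : r' ≠ 0)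
    (H : D.IsTwist g h a ha ha' (v (D.e h)) r) (H' : D.IsTwist g k c hc hc' (v (D.e k)) r')
    {w : br (D.e g) (D.e b) ≫ br (D.e b) (D.e g) ≅ 𝟙 (D.e g ⊠ D.e b)}
    (H'' : D.IsTwist g b t hbt hbt' w (r * r'))
    (hf : ∀ {f f' : D.e g ⊠ D.e h ⊠ D.e k ⟶ D.e g ⊠ D.e b} (η θ : f ⟶ f'),
      η ▷ D.χ g b t hbt = θ ▷ D.χ g b t hbt → η = θ) :
    PairCompat (𝟙 (D.e g)) (D.χ h k b hb) (sylMul v (D.e h) (D.e k)) w := by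
  rw [pairCompat_iff]
  exact hf _ _ (pasted_squares_whiskerRight (brSq (𝟙 (D.e g)) (D.χ h k b hb))
    (brSq (D.χ h k b hb) (𝟙 (D.e g))) (D.u g b t hbt hbt') (D.u b g t hbt' hbt)
    (sylMul_tri hB hD g h k a b c t ha ha' hb hc hc' hat hbt hbt' hct hr hr' H H') H'')

theorem tensorFamily_pairCompat (a c d t : L) (ha : g * h = a) (hc : g * k = c) (hc' : k * g = c)
    (hd : h * k = d) (hd' : k * h = d) (hat : a * k = t) (hat' : k * a = t) (hct : c * h = t)
    (hdt : g * d = t) {v : SylFamily (D.e g)} {v' : SylFamily (D.e h)} {w : br (D.e a) (D.e k) ≫ br (D.e k) (D.e a) ≅ 𝟙 (D.e a ⊠ D.e k)}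
    {r r' : ℂ} (hr : r ≠ 0)
    (hr' : r' ≠ 0) (H : D.IsTwist g k c hc hc' (v (D.e k)) r)
    (H' : D.IsTwist h k d hd hd' (v' (D.e k)) r')
    (H'' : D.IsTwist a k t hat hat' w (r * r'))
    (hf : ∀ {f f' : (D.e g ⊠ D.e h) ⊠ D.e k ⟶ D.e a ⊠ D.e k} (η θ : f ⟶ f'),
      η ▷ D.χ a k t hat = θ ▷ D.χ a k t hat → η = θ) :
    PairCompat (D.χ g h a ha) (𝟙 (D.e k)) (tensorFamily v v' (D.e k)) w := by
  rw [pairCompat_iff]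
  exact hf _ _ (pasted_squares_whiskerRight (brSq (D.χ g h a ha) (𝟙 (D.e k)))
    (brSq (𝟙 (D.e k)) (D.χ g h a ha)) (D.u a k t hat hat') (D.u k a t hat' hat)
    (tensorFamily_tri hB hD g h k a c d t ha hc hc' hd hd' hat hat' hct hdt hr hr' H H') H'')

end Hexagons

end FusionData

/-! ### Direct sums in linear categories -/

section Sums

variable {C : Type v} [Category.{w} C] [Preadditive C] {D : Type v'} [Category.{w'} D]
  [Preadditive D]

theorem IsSum.map {n : ℕ} {X : Fin n → C} {Y : C} (h : IsSum X Y) (F : C ⥤ D) [F.Additive] :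
    IsSum (fun k => F.obj (X k)) (F.obj Y) := by
  obtain ⟨i, p, h₁, h₂, h₃⟩ := h
  refine ⟨fun k => F.map (i k), fun k => F.map (p k), fun k => ?_, fun k l hkl => ?_, ?_⟩
  · rw [← F.map_comp, h₁, F.map_id]
  · rw [← F.map_comp, h₂ k l hkl, F.map_zero]
  · simp_rw [← F.map_comp]
    rw [← F.map_sum, h₃, F.map_id]

theorem IsSum.congr {n : ℕ} {X X' : Fin n → C} {Y Y' : C} (h : IsSum X Y)
    (e : ∀ k, Nonempty (X k ≅ X' k)) (e' : Nonempty (Y ≅ Y')) : IsSum X' Y' := by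
  obtain ⟨i, p, h₁, h₂, h₃⟩ := h
  let a := fun k => (e k).some
  let b := e'.some
  refine ⟨fun k => (a k).inv ≫ i k ≫ b.hom, fun k => b.inv ≫ p k ≫ (a k).hom, fun k => ?_,
    fun k l hkl => ?_, ?_⟩
  · simp [reassoc_of% h₁]
  · simp [reassoc_of% h₂ k l hkl]
  · have := congrArg (fun f => b.inv ≫ f ≫ b.hom) h₃
    simpa [Preadditive.sum_comp, Preadditive.comp_sum] using this

theorem IsSum.unique {n : ℕ} {X : Fin n → C} {Y Y' : C} (h : IsSum X Y) (h' : IsSum X Y') :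
    Nonempty (Y ≅ Y') := by
  obtain ⟨i, p, h₁, h₂, h₃⟩ := h
  obtain ⟨i', p', h₁', h₂', h₃'⟩ := h'
  have key {Y Y' : C} {i : ∀ k, X k ⟶ Y} {p : ∀ k, Y ⟶ X k} {i' : ∀ k, X k ⟶ Y'}
      {p' : ∀ k, Y' ⟶ X k} (h₃ : ∑ k, p k ≫ i k = 𝟙 Y) (h₁' : ∀ k, i' k ≫ p' k = 𝟙 (X k))
      (h₂' : ∀ k l, k ≠ l → i' k ≫ p' l = 0) :
      (∑ k, p k ≫ i' k) ≫ (∑ k, p' k ≫ i k) = 𝟙 Y := by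
    rw [← h₃, Preadditive.sum_comp]
    refine Finset.sum_congr rfl fun k _ => ?_
    rw [Preadditive.comp_sum, Finset.sum_eq_single k]
    · rw [Category.assoc, reassoc_of% h₁']
    · intro l _ hl
      rw [Category.assoc, reassoc_of% h₂' k l hl.symm, Limits.zero_comp, Limits.comp_zero]
    · simp
  exact ⟨⟨∑ k, p k ≫ i' k, ∑ k, p' k ≫ i k, key h₃ h₁' h₂', key h₃' h₁ h₂⟩⟩

theorem isSum_one {X Y : C} (e : X ≅ Y) : IsSum (fun _ : Fin 1 => X) Y :=
  ⟨fun _ => e.hom, fun _ => e.inv, fun _ => e.hom_inv_id,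
    fun k l h => (h (Subsingleton.elim k l)).elim, by simp⟩

theorem isSum_zero {X : Fin 0 → C} {Y : C} (h : Limits.IsZero Y) : IsSum X Y :=
  ⟨fun k => k.elim0, fun k => k.elim0, fun k => k.elim0, fun k => k.elim0, h.eq_of_src _ _⟩

theorem IsSum.isZero {X : Fin 0 → C} {Y : C} (h : IsSum X Y) : Limits.IsZero Y := by
  obtain ⟨i, p, -, -, h₃⟩ := h
  rw [Limits.IsZero.iff_id_eq_zero, ← h₃]
  simp

theorem IsSum.iso {X Y : C} (h : IsSum (fun _ : Fin 1 => X) Y) : Nonempty (X ≅ Y) :=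
  (isSum_one (Iso.refl X)).unique h

variable [Linear ℂ C]

theorem id_ne_zero_of_finrank {X : C} (hX : Module.finrank ℂ (X ⟶ X) = 1) : 𝟙 X ≠ 0 := by
  intro h
  have : Subsingleton (X ⟶ X) :=
    ⟨fun f g => by rw [← Category.id_comp f, ← Category.id_comp g, h]; simp⟩
  rw [Module.finrank_zero_of_subsingleton] at hX
  exact zero_ne_one hX

theorem exists_smul_of_finrank {V : Type*} [AddCommGroup V] [Module ℂ V]
    (hV : Module.finrank ℂ V = 1) {x : V} (hx : x ≠ 0) (y : V) : ∃ c : ℂ, c • x = y :=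
  (finrank_eq_one_iff_of_nonzero' x hx).1 hV y

theorem exists_smul_id {X : C} (hX : Module.finrank ℂ (X ⟶ X) = 1) (f : X ⟶ X) :
    ∃ c : ℂ, c • 𝟙 X = f :=
  exists_smul_of_finrank hX (id_ne_zero_of_finrank hX) f

theorem finrank_end_congr {X Y : C} (e : X ≅ Y) :
    Module.finrank ℂ (X ⟶ X) = Module.finrank ℂ (Y ⟶ Y) :=
  LinearEquiv.finrank_eq (Linear.homCongr ℂ e e)

/-- Schur's lemma for summands: the idempotent `p k ≫ i k` is a scalar. If it is zero the summand
vanishes; otherwise `i k` is invertible, with inverse a multiple of `p k`. -/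
theorem IsSum.isZero_or_iso {n : ℕ} {X : Fin n → C} {Y : C} (h : IsSum X Y)
    (hY : Module.finrank ℂ (Y ⟶ Y) = 1) (k : Fin n) :
    Limits.IsZero (X k) ∨ Nonempty (X k ≅ Y) := by
  obtain ⟨i, p, h₁, -, -⟩ := h
  obtain ⟨c, hc⟩ := exists_smul_id hY (p k ≫ i k)
  by_cases h0 : c = 0
  · left
    have e : 𝟙 (X k) = i k ≫ (p k ≫ i k) ≫ p k := by simp [h₁]
    rw [Limits.IsZero.iff_id_eq_zero, e, ← hc, h0, zero_smul, Limits.zero_comp, Limits.comp_zero]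
  · right
    refine ⟨⟨i k, c⁻¹ • p k, ?_, by rw [Linear.smul_comp, ← hc, smul_smul, inv_mul_cancel₀ h0,
      one_smul]⟩⟩
    have : c • i k = i k := by
      have := congrArg (i k ≫ ·) hc
      simpa [reassoc_of% h₁] using this
    have h2 : c • 𝟙 (X k) = 𝟙 (X k) := by rw [← h₁ k, ← Linear.smul_comp, this]
    rw [Linear.comp_smul, h₁]
    nth_rw 1 [← h2]
    rw [smul_smul, inv_mul_cancel₀ h0, one_smul]

/-- Two copies would give two inclusions in a space that embeds in a line, so one would be a
multiple of the other, contradicting the orthogonality of inclusions and projections. -/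
theorem IsSum.le_one {n : ℕ} {X Y : C} (h : IsSum (fun _ : Fin n => X) Y) (hX : 𝟙 X ≠ 0)
    {V : Type*} [AddCommGroup V] [Module ℂ V] (hV : Module.finrank ℂ V = 1)
    (φ : (X ⟶ Y) →ₗ[ℂ] V) (hφ : Function.Injective φ) : n ≤ 1 := by
  obtain ⟨i, p, h₁, h₂, -⟩ := h
  by_contra! hn
  let a : Fin n := ⟨0, by omega⟩
  let b : Fin n := ⟨1, hn⟩
  have hab : a ≠ b := by simp [a, b, Fin.ext_iff]
  have hb : φ (i b) ≠ 0 := fun h0 => hX (by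
    rw [← h₁ b, hφ (h0.trans φ.map_zero.symm), Limits.zero_comp])
  obtain ⟨c, hc⟩ := exists_smul_of_finrank hV hb (φ (i a))
  rw [← φ.map_smul] at hc
  apply hX
  rw [← h₁ a, ← hφ hc, Linear.smul_comp, h₂ b a hab.symm, smul_zero]

theorem IsSum.eq_one {n : ℕ} {X : C} (h : IsSum (fun _ : Fin n => X) X)
    (hX : Module.finrank ℂ (X ⟶ X) = 1) : n = 1 := by
  have h₁ := h.le_one (id_ne_zero_of_finrank hX) hX LinearMap.id Function.injective_id
  rcases Nat.le_one_iff_eq_zero_or_eq_one.1 h₁ with rfl | rfl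
  · exact absurd ((Limits.IsZero.iff_id_eq_zero _).1 h.isZero) (id_ne_zero_of_finrank hX)
  · rfl

end Sums

/-! ### Direct sums of 1-morphisms -/

section Whiskering

variable {B : Type u} [Bicategory.{w, v} B] [LinearBicategory B] {a b c : B}

instance precomp_additive (f : a ⟶ b) : (precomp c f).Additive :=
  ⟨LinearBicategory.whiskerLeft_add f _ _⟩

instance postcomp_additive (f : b ⟶ c) : (postcomp a f).Additive :=
  ⟨LinearBicategory.add_whiskerRight _ _ f⟩

theorem whiskerLeft_zero (f : a ⟶ b) (g h : b ⟶ c) : f ◁ (0 : g ⟶ h) = 0 :=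
  (precomp c f).map_zero g h

theorem whiskerLeft_sum {ι : Type*} (s : Finset ι) (f : a ⟶ b) {g h : b ⟶ c} (η : ι → (g ⟶ h)) :
    f ◁ (∑ k ∈ s, η k) = ∑ k ∈ s, f ◁ η k :=
  (precomp c f).map_sum η s

theorem sum_whiskerRight {ι : Type*} (s : Finset ι) {g h : a ⟶ b} (η : ι → (g ⟶ h)) (f : b ⟶ c) :
    (∑ k ∈ s, η k) ▷ f = ∑ k ∈ s, η k ▷ f :=
  (postcomp a f).map_sum η s

theorem IsSum.whiskerLeft {n : ℕ} {X : Fin n → (b ⟶ c)} {Y : b ⟶ c} (h : IsSum X Y) (f : a ⟶ b) :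
    IsSum (fun k => f ≫ X k) (f ≫ Y) := h.map (precomp c f)

theorem IsSum.whiskerRight {n : ℕ} {X : Fin n → (a ⟶ b)} {Y : a ⟶ b} (h : IsSum X Y) (f : b ⟶ c) :
    IsSum (fun k => X k ≫ f) (Y ≫ f) := h.map (postcomp a f)

theorem isZero_whiskerLeft (f : a ⟶ b) {g : b ⟶ c} (h : Limits.IsZero g) : Limits.IsZero (f ≫ g) :=
  Functor.map_isZero (precomp c f) h

theorem isZero_whiskerRight {g : a ⟶ b} (h : Limits.IsZero g) (f : b ⟶ c) : Limits.IsZero (g ≫ f) :=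
  Functor.map_isZero (postcomp a f) h

end Whiskering

/-! ### Covering families and fully faithful 1-morphisms -/

section Coverings

variable {B : Type u} [Bicategory.{w, v} B]

/-- A 1-morphism is fully faithful if 2-morphisms can be cancelled and lifted along it. -/
def FullyFaithful {a b : B} (i : a ⟶ b) : Prop :=
  ∀ ⦃z : B⦄ (f g : z ⟶ a), Function.Bijective fun η : f ⟶ g => η ▷ i

/-- The comparison of `f` with `f ≫ g ≫ f`. -/
def zigzagOut {a b : B} {i : a ⟶ b} {p : b ⟶ a} (θ : i ≫ p ≅ 𝟙 a) (s : 𝟙 b ⟶ p ≫ i) : i ⟶ i :=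
  (ρ_ i).inv ≫ i ◁ s ≫ (α_ i p i).inv ≫ θ.hom ▷ i ≫ (λ_ i).hom

/-- The comparison of `f ≫ g ≫ f` with `f`. -/
def zigzagIn {a b : B} {i : a ⟶ b} {p : b ⟶ a} (θ : i ≫ p ≅ 𝟙 a) (t : p ≫ i ⟶ 𝟙 b) : i ⟶ i :=
  (λ_ i).inv ≫ θ.inv ▷ i ≫ (α_ i p i).hom ≫ i ◁ t ≫ (ρ_ i).hom

/-! ### Retracts whose triangle identities may fail. -/

section Zigzag

variable {a b : B} {i : a ⟶ b} {p : b ⟶ a} (θ : i ≫ p ≅ 𝟙 a) {s : 𝟙 b ⟶ p ≫ i} {t : p ≫ i ⟶ 𝟙 b}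

/-- The 2-isomorphism `θ` and the pair `s`, `t` need not satisfy triangle identities, but the
discrepancies are mutually inverse and can be undone. This avoids replacing the data of a direct sum
or an equivalence by adjoint data. -/
theorem zigzagOut_in (h : i ◁ (s ≫ t) = 𝟙 _) : zigzagOut θ s ≫ zigzagIn θ t = 𝟙 i := by
  rw [whiskerLeft_comp] at h
  simp [zigzagOut, zigzagIn, reassoc_of% h]

theorem zigzagIn_out (h : i ◁ (t ≫ s) = 𝟙 _) : zigzagIn θ t ≫ zigzagOut θ s = 𝟙 i := by
  rw [whiskerLeft_comp] at h
  simp [zigzagOut, zigzagIn, reassoc_of% h]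

/-- Transporting `ξ` through `b` and restricting along `i` returns `ξ` up to the two zigzags,
because inserting `θ` and its inverse allows the interchange law to move `ξ` past them. -/
theorem whiskerLeft_zigzag (s : 𝟙 b ⟶ p ≫ i) (t : p ≫ i ⟶ 𝟙 b) {z : B} {f g : b ⟶ z}
    (ξ : i ≫ f ⟶ i ≫ g) :
    i ◁ ((λ_ f).inv ≫ s ▷ f ≫ (α_ _ _ _).hom ≫ p ◁ ξ ≫ (α_ _ _ _).inv ≫ t ▷ g ≫ (λ_ g).hom) =
      zigzagOut θ s ▷ f ≫ ξ ≫ zigzagIn θ t ▷ g := by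
  have h := whisker_exchange θ.hom ξ
  calc _ = 𝟙 _ ⊗≫ i ◁ s ▷ f ⊗≫ ((i ≫ p) ◁ ξ ≫ (θ.hom ≫ θ.inv) ▷ (i ≫ g)) ⊗≫ i ◁ t ▷ g ⊗≫ 𝟙 _ := by
        rw [θ.hom_inv_id]; bicategory
    _ = 𝟙 _ ⊗≫ i ◁ s ▷ f ⊗≫ ((i ≫ p) ◁ ξ ≫ θ.hom ▷ (i ≫ g)) ⊗≫ θ.inv ▷ (i ≫ g) ⊗≫
          i ◁ t ▷ g ⊗≫ 𝟙 _ := by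
        bicategory
    _ = 𝟙 _ ⊗≫ i ◁ s ▷ f ⊗≫ (θ.hom ▷ (i ≫ f) ≫ 𝟙 a ◁ ξ) ⊗≫ θ.inv ▷ (i ≫ g) ⊗≫
          i ◁ t ▷ g ⊗≫ 𝟙 _ := by
        rw [h]
    _ = _ := by unfold zigzagOut zigzagIn; bicategory

theorem whiskerRight_zigzag (hst : i ◁ (t ≫ s) = 𝟙 _) {z : B} {f g : z ⟶ a}
    (ξ : f ≫ i ⟶ g ≫ i) :
    ((ρ_ f).inv ≫ f ◁ θ.inv ≫ (α_ _ _ _).inv ≫ ξ ▷ p ≫ (α_ _ _ _).hom ≫ g ◁ θ.hom ≫ (ρ_ g).hom) ▷ i =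
      f ◁ zigzagIn θ t ≫ ξ ≫ g ◁ zigzagOut θ s := by
  have h := whisker_exchange ξ t
  calc _ = 𝟙 _ ⊗≫ f ◁ θ.inv ▷ i ⊗≫ ξ ▷ (p ≫ i) ⊗≫ g ◁ i ◁ (t ≫ s) ⊗≫ g ◁ θ.hom ▷ i ⊗≫ 𝟙 _ := by
        rw [hst]; bicategory
    _ = 𝟙 _ ⊗≫ f ◁ θ.inv ▷ i ⊗≫ (ξ ▷ (p ≫ i) ≫ (g ≫ i) ◁ t) ⊗≫ g ◁ i ◁ s ⊗≫ g ◁ θ.hom ▷ i ⊗≫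
          𝟙 _ := by
        bicategory
    _ = 𝟙 _ ⊗≫ f ◁ θ.inv ▷ i ⊗≫ ((f ≫ i) ◁ t ≫ ξ ▷ 𝟙 b) ⊗≫ g ◁ i ◁ s ⊗≫ g ◁ θ.hom ▷ i ⊗≫
          𝟙 _ := by
        rw [h]
    _ = _ := by unfold zigzagOut zigzagIn; bicategory

-- Whiskering with the retraction `p` and using `θ` recovers a 2-morphism from its image, which
-- gives injectivity. For surjectivity the condition `hts` makes the zigzags invertible, so the
-- distortion of a lift can be corrected in advance.
include θ in
theorem fullyFaithful_of_retract (hts : i ◁ (t ≫ s) = 𝟙 _) :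
    FullyFaithful i := by
  refine fun z f g => ⟨fun η η' h => ?_, fun ξ => ?_⟩
  · have h : η ▷ i = η' ▷ i := h
    have e (η : f ⟶ g) : η = (ρ_ f).inv ≫ f ◁ θ.inv ≫ (α_ _ _ _).inv ≫ (η ▷ i) ▷ p ≫
        (α_ _ _ _).hom ≫ g ◁ θ.hom ≫ (ρ_ g).hom := by
      calc η = 𝟙 _ ⊗≫ f ◁ (θ.inv ≫ θ.hom) ⊗≫ η ▷ 𝟙 a ⊗≫ 𝟙 _ := by
            rw [θ.inv_hom_id]; bicategory
        _ = 𝟙 _ ⊗≫ f ◁ θ.inv ⊗≫ (η ▷ (i ≫ p) ≫ g ◁ θ.hom) ⊗≫ 𝟙 _ := by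
            rw [← whisker_exchange]; bicategory
        _ = _ := by bicategory
    rw [e η, e η', h]
  -- The lift starts from `ξ` conjugated by the zigzags, which cancels the conjugation produced by
  -- `whiskerRight_zigzag`.
  · refine ⟨(ρ_ f).inv ≫ f ◁ θ.inv ≫ (α_ _ _ _).inv ≫
      (f ◁ zigzagOut θ s ≫ ξ ≫ g ◁ zigzagIn θ t) ▷ p ≫ (α_ _ _ _).hom ≫ g ◁ θ.hom ≫ (ρ_ g).hom, ?_⟩
    refine (whiskerRight_zigzag θ hts _).trans ?_
    have h := zigzagIn_out θ hts
    rw [Category.assoc, Category.assoc, ← whiskerLeft_comp_assoc, h, ← whiskerLeft_comp, h]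
    simp

end Zigzag

theorem IsEquiv.fullyFaithful {a b : B} {f : a ⟶ b} (h : IsEquiv f) : FullyFaithful f := by
  obtain ⟨g, ⟨θ⟩, ⟨φ⟩⟩ := h
  exact fullyFaithful_of_retract θ (s := φ.inv) (t := φ.hom) (by simp)

theorem isEquiv_id (a : B) : IsEquiv (𝟙 a) := ⟨𝟙 a, ⟨λ_ _⟩, ⟨λ_ _⟩⟩

theorem IsEquiv.comp {a b c : B} {f : a ⟶ b} {g : b ⟶ c} (hf : IsEquiv f) (hg : IsEquiv g) :
    IsEquiv (f ≫ g) := by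
  obtain ⟨f', ⟨θ⟩, ⟨φ⟩⟩ := hf
  obtain ⟨g', ⟨θ'⟩, ⟨φ'⟩⟩ := hg
  exact ⟨g' ≫ f', ⟨α_ _ _ _ ≪≫ cancelMid f θ' f' ≪≫ θ⟩, ⟨α_ _ _ _ ≪≫ cancelMid g' φ g ≪≫ φ'⟩⟩

theorem IsEquiv.exists_inv {a b : B} {f : a ⟶ b} (h : IsEquiv f) :
    ∃ g : b ⟶ a, IsEquiv g ∧ Nonempty (f ≫ g ≅ 𝟙 a) ∧ Nonempty (g ≫ f ≅ 𝟙 b) := by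
  obtain ⟨g, h₁, h₂⟩ := h
  exact ⟨g, ⟨f, h₂, h₁⟩, h₁, h₂⟩

variable [LinearBicategory B]

/-- A family of 1-morphisms to `b` covers `b` if the identity of `b` is a sum of 2-morphisms factoring
through 1-morphisms that factor through members of the family. -/
def Covers {ι : Type*} [Fintype ι] {a : ι → B} {b : B} (i : ∀ k, a k ⟶ b) : Prop :=
  ∃ (p : ∀ k, b ⟶ a k) (s : ∀ k, 𝟙 b ⟶ p k ≫ i k) (t : ∀ k, p k ≫ i k ⟶ 𝟙 b),
    ∑ k, s k ≫ t k = 𝟙 (𝟙 b)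

/-- The partition of the identity of `b` writes any `η` as a sum of terms that depend only on the
restrictions `i k ◁ η`. -/
theorem Covers.ext {ι : Type*} [Fintype ι] {a : ι → B} {b : B} {i : ∀ k, a k ⟶ b} (hi : Covers i)
    {z : B} {f g : b ⟶ z} {η θ : f ⟶ g} (h : ∀ k, i k ◁ η = i k ◁ θ) : η = θ := by
  obtain ⟨p, s, t, e⟩ := hi
  have key (η : f ⟶ g) : η = ∑ k, (λ_ f).inv ≫ s k ▷ f ≫ (α_ _ _ _).hom ≫ p k ◁ i k ◁ η ≫
      (α_ _ _ _).inv ≫ t k ▷ g ≫ (λ_ g).hom := by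
    calc η = (λ_ f).inv ≫ (𝟙 (𝟙 b)) ▷ f ≫ 𝟙 b ◁ η ≫ (λ_ g).hom := by simp
      _ = _ := by
        rw [← e, sum_whiskerRight, Preadditive.sum_comp, Preadditive.comp_sum]
        refine Finset.sum_congr rfl fun k _ => ?_
        rw [comp_whiskerRight, Category.assoc, ← whisker_exchange_assoc]
        simp
  rw [key η, key θ]
  simp_rw [h]

theorem IsEquiv.covers {a b : B} {f : a ⟶ b} (h : IsEquiv f) : Covers fun _ : Unit => f := by
  obtain ⟨g, -, ⟨φ⟩⟩ := h
  exact ⟨fun _ => g, fun _ => φ.inv, fun _ => φ.hom, by simp⟩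

theorem IsEquiv.whiskerLeft_injective {a b z : B} {i : a ⟶ b} (hi : IsEquiv i) {f g : b ⟶ z}
    {η θ : f ⟶ g} (h : i ◁ η = i ◁ θ) : η = θ :=
  hi.covers.ext fun _ => h

/-- The 1-morphisms `i` and `p` exhibit `b` as the direct sum of the family `a`. -/
def IsObjSumVia {n : ℕ} {a : Fin n → B} {b : B} (i : ∀ k, a k ⟶ b) (p : ∀ k, b ⟶ a k) : Prop :=
  (∀ k, Nonempty (i k ≫ p k ≅ 𝟙 (a k))) ∧ (∀ k l, k ≠ l → Limits.IsZero (i k ≫ p l)) ∧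
    IsSum (fun k => p k ≫ i k) (𝟙 b)

namespace IsObjSumVia

variable {n : ℕ} {a : Fin n → B} {b : B} {i : ∀ k, a k ⟶ b} {p : ∀ k, b ⟶ a k}

theorem covers (h : IsObjSumVia i p) : Covers i := by
  obtain ⟨-, -, t, s, -, -, e⟩ := h
  exact ⟨p, s, t, e⟩

/-- After restriction along `i k` only the `k`-th term of the partition of the identity survives,
since `i k ≫ p l` is zero for `l ≠ k`. -/
theorem exists_zigzag (h : IsObjSumVia i p) :
    ∃ (s : ∀ k, 𝟙 b ⟶ p k ≫ i k) (t : ∀ k, p k ≫ i k ⟶ 𝟙 b), (∑ k, s k ≫ t k = 𝟙 (𝟙 b)) ∧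
      ∀ k, i k ◁ (s k ≫ t k) = 𝟙 _ ∧ i k ◁ (t k ≫ s k) = 𝟙 _ := by
  obtain ⟨-, h₂, t, s, h₃, -, e⟩ := h
  refine ⟨s, t, e, fun k => ⟨?_, by rw [h₃, whiskerLeft_id]⟩⟩
  have e' := congrArg (i k ◁ ·) e
  simp only [whiskerLeft_sum, whiskerLeft_id] at e'
  rw [Finset.sum_eq_single k] at e'
  · exact e'
  · intro l _ hl
    have z : Limits.IsZero (i k ≫ p l ≫ i l) :=
      (isZero_whiskerRight (h₂ k l hl.symm) (i l)).of_iso (α_ _ _ _).symm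
    rw [whiskerLeft_comp, z.eq_zero_of_tgt (i k ◁ s l), Limits.zero_comp]
  · simp

theorem fullyFaithful (h : IsObjSumVia i p) (k : Fin n) : FullyFaithful (i k) := by
  obtain ⟨s, t, -, e⟩ := h.exists_zigzag
  exact fullyFaithful_of_retract (h.1 k).some (e k).2

/-- Gluing along a direct sum: orthogonality of the summands means that the restrictions can be
prescribed independently. -/
theorem exists_whiskerLeft_eq (h : IsObjSumVia i p) {z : B} {f g : b ⟶ z}
    (ξ : ∀ k, i k ≫ f ⟶ i k ≫ g) : ∃ m : f ⟶ g, ∀ k, i k ◁ m = ξ k := by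
  obtain ⟨s, t, -, e⟩ := h.exists_zigzag
  let θ k := (h.1 k).some
  -- Each component is corrected in advance so that the zigzags introduced by gluing cancel.
  let ξ' k := zigzagIn (θ k) (t k) ▷ f ≫ ξ k ≫ zigzagOut (θ k) (s k) ▷ g
  refine ⟨∑ k, ((λ_ f).inv ≫ s k ▷ f ≫ (α_ _ _ _).hom ≫ p k ◁ ξ' k ≫ (α_ _ _ _).inv ≫
    t k ▷ g ≫ (λ_ g).hom), fun l => ?_⟩
  rw [whiskerLeft_sum, Finset.sum_eq_single l]
  · rw [whiskerLeft_zigzag (θ l)]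
    have h₁ := zigzagOut_in (θ l) (e l).1
    simp only [ξ', Category.assoc]
    rw [← comp_whiskerRight_assoc, h₁, ← comp_whiskerRight, h₁]
    simp
  · intro k _ hk
    have z : Limits.IsZero (i l ≫ p k ≫ i k ≫ g) :=
      (isZero_whiskerRight (h.2.1 l k hk.symm) (i k ≫ g)).of_iso (α_ _ _ _).symm
    simp only [whiskerLeft_comp]
    rw [z.eq_zero_of_tgt (i l ◁ p k ◁ ξ' k)]
    simp
  · simp

theorem exists_whiskerLeftIso_eq (h : IsObjSumVia i p) {z : B} {f g : b ⟶ z}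
    (ξ : ∀ k, i k ≫ f ≅ i k ≫ g) : ∃ m : f ≅ g, ∀ k, i k ◁ m.hom = (ξ k).hom := by
  obtain ⟨m, hm⟩ := h.exists_whiskerLeft_eq fun k => (ξ k).hom
  obtain ⟨m', hm'⟩ := h.exists_whiskerLeft_eq fun k => (ξ k).inv
  exact ⟨⟨m, m', h.covers.ext fun k => by simp [hm, hm'], h.covers.ext fun k => by simp [hm, hm']⟩,
    hm⟩

end IsObjSumVia

theorem FullyFaithful.exists_whiskerRightIso_eq {B : Type u} [Bicategory.{w, v} B] {a b z : B}
    {i : a ⟶ b} (hi : FullyFaithful i) {f g : z ⟶ a} (ξ : f ≫ i ≅ g ≫ i) :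
    ∃ m : f ≅ g, m.hom ▷ i = ξ.hom := by
  obtain ⟨m, hm⟩ := (hi f g).2 ξ.hom
  obtain ⟨m', hm'⟩ := (hi g f).2 ξ.inv
  dsimp only at hm hm'
  exact ⟨⟨m, m', (hi _ _).1 (by simp [hm, hm']), (hi _ _).1 (by simp [hm, hm'])⟩, hm⟩

end Coverings

/-! ### Tensor products of sums, coverings and equivalences -/

section TensorSums

variable {B : Type u} [Bicategory.{w, v} B] [TensorBicategory B]

theorem IsEquiv.ten {x x' y y' : B} {f : x ⟶ x'} {g : y ⟶ y'} (hf : IsEquiv f) (hg : IsEquiv g) :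
    IsEquiv (f ⊠₁ g) := by
  obtain ⟨f', ⟨θ⟩, ⟨φ⟩⟩ := hf
  obtain ⟨g', ⟨θ'⟩, ⟨φ'⟩⟩ := hg
  exact ⟨f' ⊠₁ g', ⟨(tenComp _ _ _ _).symm ≪≫ tenIso θ θ' ≪≫ tenId _ _⟩,
    ⟨(tenComp _ _ _ _).symm ≪≫ tenIso φ φ' ≪≫ tenId _ _⟩⟩

variable [LinearBicategory B]

/-- The tensor product of 2-morphisms is bilinear. -/
structure TensorBilinear (B : Type u) [Bicategory.{w, v} B] [LinearBicategory B]
    [TensorBicategory B] : Prop extends TensorLinear B where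
  ten_add {x x' y y' : B} {f f' : x ⟶ x'} {g g' : y ⟶ y'} (η : f ⟶ f') (θ θ' : g ⟶ g') :
    ten₂ η (θ + θ') = ten₂ η θ + ten₂ η θ'
  add_ten {x x' y y' : B} {f f' : x ⟶ x'} {g g' : y ⟶ y'} (η η' : f ⟶ f') (θ : g ⟶ g') :
    ten₂ (η + η') θ = ten₂ η θ + ten₂ η' θ

/-- Tensoring with a 1-morphism on the left, as a functor. -/
def tenLeftFunctor {x x' : B} (f : x ⟶ x') (y y' : B) : (y ⟶ y') ⥤ (x ⊠ y ⟶ x' ⊠ y') where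
  obj g := f ⊠₁ g
  map θ := ten₂ (𝟙 f) θ
  map_id g := ten₂_id f g
  map_comp θ θ' := by rw [← ten₂_comp, Category.id_comp]

/-- Tensoring with a 1-morphism on the right, as a functor. -/
def tenRightFunctor (x x' : B) {y y' : B} (g : y ⟶ y') : (x ⟶ x') ⥤ (x ⊠ y ⟶ x' ⊠ y') where
  obj f := f ⊠₁ g
  map θ := ten₂ θ (𝟙 g)
  map_id f := ten₂_id f g
  map_comp θ θ' := by rw [← ten₂_comp, Category.id_comp]

namespace TensorBilinear

variable (hB : TensorBilinear B)

include hB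

theorem tenLeftFunctor_additive {x x' : B} (f : x ⟶ x') (y y' : B) :
    (tenLeftFunctor f y y').Additive := ⟨hB.ten_add _ _ _⟩

theorem tenRightFunctor_additive (x x' : B) {y y' : B} (g : y ⟶ y') :
    (tenRightFunctor x x' g).Additive := ⟨hB.add_ten _ _ _⟩

theorem ten_sum {ι : Type*} (s : Finset ι) {x x' y y' : B} (f : x ⟶ x') {g g' : y ⟶ y'}
    (θ : ι → (g ⟶ g')) : ten₂ (𝟙 f) (∑ k ∈ s, θ k) = ∑ k ∈ s, ten₂ (𝟙 f) (θ k) :=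
  have := hB.tenLeftFunctor_additive f y y'
  (tenLeftFunctor f y y').map_sum θ s

theorem sum_ten {ι : Type*} (s : Finset ι) {x x' y y' : B} {f f' : x ⟶ x'} (θ : ι → (f ⟶ f'))
    (g : y ⟶ y') : ten₂ (∑ k ∈ s, θ k) (𝟙 g) = ∑ k ∈ s, ten₂ (θ k) (𝟙 g) :=
  have := hB.tenRightFunctor_additive x x' g
  (tenRightFunctor x x' g).map_sum θ s

theorem isSum_ten_left {n : ℕ} {x x' y y' : B} {g : Fin n → (y ⟶ y')} {g' : y ⟶ y'}
    (h : IsSum g g') (f : x ⟶ x') : IsSum (fun k => f ⊠₁ g k) (f ⊠₁ g') :=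
  have := hB.tenLeftFunctor_additive f y y'
  h.map (tenLeftFunctor f y y')

theorem isSum_ten_right {n : ℕ} {x x' y y' : B} {f : Fin n → (x ⟶ x')} {f' : x ⟶ x'}
    (h : IsSum f f') (g : y ⟶ y') : IsSum (fun k => f k ⊠₁ g) (f' ⊠₁ g) :=
  have := hB.tenRightFunctor_additive x x' g
  h.map (tenRightFunctor x x' g)

theorem isZero_ten_left {x x' y y' : B} (f : x ⟶ x') {g : y ⟶ y'} (h : Limits.IsZero g) :
    Limits.IsZero (f ⊠₁ g) :=
  have := hB.tenLeftFunctor_additive f y y'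
  Functor.map_isZero (tenLeftFunctor f y y') h

theorem isZero_ten_right {x x' y y' : B} {f : x ⟶ x'} (h : Limits.IsZero f) (g : y ⟶ y') :
    Limits.IsZero (f ⊠₁ g) :=
  have := hB.tenRightFunctor_additive x x' g
  Functor.map_isZero (tenRightFunctor x x' g) h

theorem isObjSumVia_wl {n : ℕ} {a : Fin n → B} {b : B} {i : ∀ k, a k ⟶ b} {p : ∀ k, b ⟶ a k}
    (h : IsObjSumVia i p) (x : B) : IsObjSumVia (fun k => x ◃ i k) (fun k => x ◃ p k) :=
  ⟨fun k => ⟨wlCancel x (h.1 k).some⟩,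
    fun k l hkl => (hB.isZero_ten_left (𝟙 x) (h.2.1 k l hkl)).of_iso (wlComp x _ _).symm,
    (hB.isSum_ten_left h.2.2 (𝟙 x)).congr (fun _ => ⟨wlComp x _ _⟩) ⟨tenId x b⟩⟩

theorem isObjSumVia_wr {n : ℕ} {a : Fin n → B} {b : B} {i : ∀ k, a k ⟶ b} {p : ∀ k, b ⟶ a k}
    (h : IsObjSumVia i p) (x : B) : IsObjSumVia (fun k => i k ▹ x) (fun k => p k ▹ x) :=
  ⟨fun k => ⟨wrCancel (h.1 k).some x⟩,
    fun k l hkl => (hB.isZero_ten_right (h.2.1 k l hkl) (𝟙 x)).of_iso (wrComp _ _ x).symm,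
    (hB.isSum_ten_right h.2.2 (𝟙 x)).congr (fun _ => ⟨wrComp _ _ x⟩) ⟨tenId b x⟩⟩

/-- The tensor products of the terms of two partitions of the identity form a partition of the
identity, by bilinearity. -/
theorem covers_ten {ι κ : Type*} [Fintype ι] [Fintype κ] {a : ι → B} {b : B} {c : κ → B} {d : B}
    {i : ∀ k, a k ⟶ b} {j : ∀ l, c l ⟶ d} (hi : Covers i) (hj : Covers j) :
    Covers fun m : ι × κ => i m.1 ⊠₁ j m.2 := by
  obtain ⟨p, s, t, e⟩ := hi
  obtain ⟨q, s', t', e'⟩ := hj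
  refine ⟨fun m => p m.1 ⊠₁ q m.2,
    fun m => (tenId b d).inv ≫ ten₂ (s m.1) (s' m.2) ≫ (tenComp _ _ _ _).hom,
    fun m => (tenComp _ _ _ _).inv ≫ ten₂ (t m.1) (t' m.2) ≫ (tenId b d).hom, ?_⟩
  have h : ∑ m : ι × κ, ten₂ (s m.1 ≫ t m.1) (s' m.2 ≫ t' m.2) = 𝟙 (𝟙 b ⊠₁ 𝟙 d) := by
    rw [Fintype.sum_prod_type]
    calc _ = ∑ k, ten₂ (s k ≫ t k) (𝟙 (𝟙 d)) := by
          refine Finset.sum_congr rfl fun k _ => ?_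
          have e₁ (θ : 𝟙 d ⟶ 𝟙 d) : ten₂ (s k ≫ t k) θ = ten₂ (s k ≫ t k) (𝟙 (𝟙 d)) ≫
              ten₂ (𝟙 (𝟙 b)) θ := by
            rw [← ten₂_comp, Category.comp_id, Category.id_comp]
          simp only [e₁ (_ ≫ _)]
          rw [← Preadditive.comp_sum, ← hB.ten_sum, e', ten₂_id, Category.comp_id]
      _ = _ := by rw [← hB.sum_ten, e, ten₂_id]
  have h' := congrArg (fun η => (tenId b d).inv ≫ η ≫ (tenId b d).hom) h
  simpa [Preadditive.sum_comp, Preadditive.comp_sum, ten₂_comp] using h'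

end TensorBilinear

end TensorSums

/-! ### Calculus of compatible pairs -/

section Pairs

variable {B : Type u} [Bicategory.{w, v} B] [BraidedBicategory B]

/-! ### Two out of three for compatible pairs. -/

section Cancel

variable {x x' x'' y y' y'' : B} {f : x ⟶ x'} {f' : x' ⟶ x''} {g : y ⟶ y'} {g' : y' ⟶ y''}
  {m : br x y ≫ br y x ≅ 𝟙 (x ⊠ y)} {m' : br x' y' ≫ br y' x' ≅ 𝟙 (x' ⊠ y')}
  {m'' : br x'' y'' ≫ br y'' x'' ≅ 𝟙 (x'' ⊠ y'')}

theorem pairCompat_comp_iff : PairCompat (f ≫ f') (g ≫ g') m m'' ↔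
    (α_ _ _ _).hom ≫ (f ⊠₁ g) ◁ (doubleSq f' g').hom ≫ (α_ _ _ _).inv ≫
      ((doubleSq f g).hom ≫ m.hom ▷ (f ⊠₁ g)) ▷ (f' ⊠₁ g') ≫ (α_ _ _ _).hom =
      (f ⊠₁ g ≫ f' ⊠₁ g') ◁ m''.hom ≫ (ρ_ _).hom ≫ (λ_ _).inv := by
  have e₁ : (doubleSq (f ≫ f') (g ≫ g')).hom ≫ m.hom ▷ ((f ≫ f') ⊠₁ (g ≫ g')) =
      (tenComp f f' g g').hom ▷ _ ≫ ((α_ _ _ _).hom ≫ (f ⊠₁ g) ◁ (doubleSq f' g').hom ≫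
      (α_ _ _ _).inv ≫ ((doubleSq f g).hom ≫ m.hom ▷ (f ⊠₁ g)) ▷ (f' ⊠₁ g') ≫ (α_ _ _ _).hom) ≫
      𝟙 _ ◁ (tenComp f f' g g').inv := by
    calc _ = (tenComp f f' g g').hom ▷ (br x'' y'' ≫ br y'' x'') ⊗≫
          (f ⊠₁ g) ◁ (doubleSq f' g').hom ⊗≫ (doubleSq f g).hom ▷ (f' ⊠₁ g') ⊗≫
          ((br x y ≫ br y x) ◁ (tenComp f f' g g').inv ≫
            m.hom ▷ ((f ≫ f') ⊠₁ (g ≫ g'))) := by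
          rw [doubleSq_comp]; bicategory
      _ = _ := by rw [whisker_exchange]; bicategory
  have e₂ : ((f ≫ f') ⊠₁ (g ≫ g')) ◁ m''.hom ≫ (ρ_ _).hom ≫ (λ_ _).inv =
      (tenComp f f' g g').hom ▷ _ ≫ ((f ⊠₁ g ≫ f' ⊠₁ g') ◁ m''.hom ≫ (ρ_ _).hom ≫ (λ_ _).inv) ≫
      𝟙 _ ◁ (tenComp f f' g g').inv := by
    rw [Category.assoc, ← whisker_exchange_assoc]
    simp
  rw [pairCompat_iff, e₁, e₂]
  constructor
  · intro h
    exact (cancel_mono _).1 ((cancel_epi _).1 h)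
  · intro h
    rw [h]

/-- The compatibility square of a composite is a pasting of two squares. When the first commutes,
the condition on the second follows after restriction along `f ⊠₁ g`, hence outright once such
1-morphisms cover. -/
theorem whiskerLeft_of_pairCompat_comp (h : PairCompat f g m m')
    (h' : PairCompat (f ≫ f') (g ≫ g') m m'') :
    (f ⊠₁ g) ◁ ((doubleSq f' g').hom ≫ m'.hom ▷ (f' ⊠₁ g')) =
      (f ⊠₁ g) ◁ ((f' ⊠₁ g') ◁ m''.hom ≫ (ρ_ _).hom ≫ (λ_ _).inv) := by
  rw [pairCompat_comp_iff, pairCompat_iff.1 h] at h'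
  calc _ = 𝟙 _ ⊗≫ ((α_ _ _ _).hom ≫ (f ⊠₁ g) ◁ (doubleSq f' g').hom ≫ (α_ _ _ _).inv ≫
        ((f ⊠₁ g) ◁ m'.hom ≫ (ρ_ _).hom ≫ (λ_ _).inv) ▷ (f' ⊠₁ g') ≫ (α_ _ _ _).hom) ⊗≫ 𝟙 _ := by
        bicategory
    _ = _ := by rw [h']; bicategory

theorem whiskerRight_of_pairCompat_comp (h : PairCompat f' g' m' m'')
    (h' : PairCompat (f ≫ f') (g ≫ g') m m'') :
    ((doubleSq f g).hom ≫ m.hom ▷ (f ⊠₁ g)) ▷ (f' ⊠₁ g') =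
      ((f ⊠₁ g) ◁ m'.hom ≫ (ρ_ _).hom ≫ (λ_ _).inv) ▷ (f' ⊠₁ g') := by
  rw [pairCompat_comp_iff] at h'
  rw [pairCompat_iff] at h
  rw [← cancel_epi ((f ⊠₁ g) ◁ (doubleSq f' g').hom ≫ (α_ _ _ _).inv), ← cancel_mono (α_ _ _ _).hom,
    ← cancel_epi (α_ _ _ _).hom]
  simp only [Category.assoc]
  refine h'.trans ?_
  calc _ = 𝟙 _ ⊗≫ (f ⊠₁ g) ◁ ((f' ⊠₁ g') ◁ m''.hom ≫ (ρ_ _).hom ≫ (λ_ _).inv) ⊗≫ 𝟙 _ := by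
        bicategory
    _ = _ := by rw [← h]; bicategory

end Cancel

theorem PairCompat.eq_left {x x' y y' : B} {f : x ⟶ x'} {g : y ⟶ y'}
    {m m₁ : br x y ≫ br y x ≅ 𝟙 (x ⊠ y)} {m' : br x' y' ≫ br y' x' ≅ 𝟙 (x' ⊠ y')}
    (hf : FullyFaithful (f ⊠₁ g)) (h : PairCompat f g m m') (h' : PairCompat f g m₁ m') : m = m₁ := by
  rw [pairCompat_iff] at h h'
  exact Iso.ext ((hf _ _).1 ((cancel_epi (doubleSq f g).hom).1 (h.trans h'.symm)))

theorem PairCompat.whiskerLeft_eq {x x' y y' : B} {f : x ⟶ x'} {g : y ⟶ y'}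
    {m : br x y ≫ br y x ≅ 𝟙 (x ⊠ y)} {m' m₁' : br x' y' ≫ br y' x' ≅ 𝟙 (x' ⊠ y')}
    (h : PairCompat f g m m') (h' : PairCompat f g m m₁') :
    (f ⊠₁ g) ◁ m'.hom = (f ⊠₁ g) ◁ m₁'.hom := by
  rw [pairCompat_iff] at h h'
  exact (cancel_mono _).1 (h.symm.trans h')

theorem exists_pairCompat_left {x x' y y' : B} {f : x ⟶ x'} {g : y ⟶ y'}
    (hf : FullyFaithful (f ⊠₁ g)) (m' : br x' y' ≫ br y' x' ≅ 𝟙 (x' ⊠ y')) :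
    ∃ m : br x y ≫ br y x ≅ 𝟙 (x ⊠ y), PairCompat f g m m' := by
  obtain ⟨m, hm⟩ := hf.exists_whiskerRightIso_eq ((doubleSq f g).symm ≪≫
    whiskerLeftIso (f ⊠₁ g) m' ≪≫ ρ_ _ ≪≫ (λ_ _).symm)
  refine ⟨m, ?_⟩
  rw [pairCompat_iff, hm]
  simp

theorem PairCompat.of_comp_right {x x' x'' y y' y'' : B} {f : x ⟶ x'} {f' : x' ⟶ x''} {g : y ⟶ y'}
    {g' : y' ⟶ y''} {m : br x y ≫ br y x ≅ 𝟙 (x ⊠ y)} {m' : br x' y' ≫ br y' x' ≅ 𝟙 (x' ⊠ y')}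
    {m'' : br x'' y'' ≫ br y'' x'' ≅ 𝟙 (x'' ⊠ y'')} (hf : FullyFaithful (f' ⊠₁ g'))
    (h : PairCompat f' g' m' m'') (h' : PairCompat (f ≫ f') (g ≫ g') m m'') :
    PairCompat f g m m' :=
  pairCompat_iff.2 ((hf _ _).1 (whiskerRight_of_pairCompat_comp h h'))

variable [LinearBicategory B]

theorem exists_pairCompat_right {n : ℕ} {x y : Fin n → B} {z t : B} {f : ∀ k, x k ⟶ z}
    {g : ∀ k, y k ⟶ t} {p : ∀ k, z ⊠ t ⟶ x k ⊠ y k} (h : IsObjSumVia (fun k => f k ⊠₁ g k) p)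
    (m : ∀ k, br (x k) (y k) ≫ br (y k) (x k) ≅ 𝟙 (x k ⊠ y k)) :
    ∃ m' : br z t ≫ br t z ≅ 𝟙 (z ⊠ t), ∀ k, PairCompat (f k) (g k) (m k) m' := by
  obtain ⟨m', hm'⟩ := h.exists_whiskerLeftIso_eq fun k => doubleSq (f k) (g k) ≪≫
    whiskerRightIso (m k) (f k ⊠₁ g k) ≪≫ λ_ _ ≪≫ (ρ_ _).symm
  refine ⟨m', fun k => ?_⟩
  rw [pairCompat_iff, hm']
  simp

theorem PairCompat.eq_right {ι : Type*} [Fintype ι] {x y : ι → B} {z t : B} {f : ∀ k, x k ⟶ z}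
    {g : ∀ k, y k ⟶ t} (hf : Covers fun k => f k ⊠₁ g k)
    {m : ∀ k, br (x k) (y k) ≫ br (y k) (x k) ≅ 𝟙 (x k ⊠ y k)} {m' m₁' : br z t ≫ br t z ≅ 𝟙 (z ⊠ t)}
    (h : ∀ k, PairCompat (f k) (g k) (m k) m') (h' : ∀ k, PairCompat (f k) (g k) (m k) m₁') :
    m' = m₁' :=
  Iso.ext (hf.ext fun k => (h k).whiskerLeft_eq (h' k))

theorem PairCompat.of_comp_left {ι : Type*} [Fintype ι] {x y : ι → B} {x' x'' y' y'' : B}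
    {f : ∀ k, x k ⟶ x'} {f' : x' ⟶ x''} {g : ∀ k, y k ⟶ y'} {g' : y' ⟶ y''}
    {m : ∀ k, br (x k) (y k) ≫ br (y k) (x k) ≅ 𝟙 (x k ⊠ y k)}
    {m' : br x' y' ≫ br y' x' ≅ 𝟙 (x' ⊠ y')} {m'' : br x'' y'' ≫ br y'' x'' ≅ 𝟙 (x'' ⊠ y'')}
    (hf : Covers fun k => f k ⊠₁ g k) (h : ∀ k, PairCompat (f k) (g k) (m k) m')
    (h' : ∀ k, PairCompat (f k ≫ f') (g k ≫ g') (m k) m'') : PairCompat f' g' m' m'' :=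
  pairCompat_iff.2 (hf.ext fun k => whiskerLeft_of_pairCompat_comp (h k) (h' k))

/-- The double braiding is natural in 2-morphisms of `f` and `g`, so the condition can be checked on
each term of a decomposition of the identity of `f ⊠₁ g`. Direct sums, zero 1-morphisms and retracts
are all instances. -/
theorem pairCompat_of_sum {ι : Type*} [Fintype ι] {x x' y y' : B} {f : x ⟶ x'} {g : y ⟶ y'}
    {m : br x y ≫ br y x ≅ 𝟙 (x ⊠ y)} {m' : br x' y' ≫ br y' x' ≅ 𝟙 (x' ⊠ y')}
    {f' : ι → (x ⟶ x')} {g' : ι → (y ⟶ y')} (σ : ∀ k, f ⊠₁ g ⟶ f' k ⊠₁ g' k) (η : ∀ k, f' k ⟶ f)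
    (θ : ∀ k, g' k ⟶ g) (e : ∑ k, σ k ≫ ten₂ (η k) (θ k) = 𝟙 _)
    (h : ∀ k, PairCompat (f' k) (g' k) m m') : PairCompat f g m m' := by
  simp_rw [pairCompat_iff] at h ⊢
  have key (k) : ten₂ (η k) (θ k) ▷ (br x' y' ≫ br y' x') ≫ (doubleSq f g).hom ≫
      m.hom ▷ (f ⊠₁ g) =
      ten₂ (η k) (θ k) ▷ (br x' y' ≫ br y' x') ≫ (f ⊠₁ g) ◁ m'.hom ≫ (ρ_ _).hom ≫ (λ_ _).inv := by
    rw [reassoc_of% doubleSq_natural, whisker_exchange, reassoc_of% h k, ← whisker_exchange_assoc]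
    simp
  rw [← Category.id_comp ((doubleSq f g).hom ≫ _), ← Category.id_comp ((f ⊠₁ g) ◁ m'.hom ≫ _),
    ← id_whiskerRight, ← e, sum_whiskerRight, Preadditive.sum_comp, Preadditive.sum_comp]
  refine Finset.sum_congr rfl fun k _ => ?_
  rw [comp_whiskerRight, Category.assoc, Category.assoc, key]

end Pairs

/-! ### 1-morphisms between simple objects -/

section Multiples

variable {B : Type u} [Bicategory.{w, v} B]

theorem AdjointInverse.isEquiv {a b : B} {f : a ⟶ b} (h : AdjointInverse f) : IsEquiv f :=
  ⟨h.inv, ⟨h.unit.symm⟩, ⟨h.counit⟩⟩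

theorem AdjointInverse.isEquiv_inv {a b : B} {f : a ⟶ b} (h : AdjointInverse f) : IsEquiv h.inv :=
  ⟨f, ⟨h.counit⟩, ⟨h.unit.symm⟩⟩

variable [LinearBicategory B]

/-- An endomorphism is a multiple of the identity if it is a direct sum of copies of it. -/
def IsMultiple {x : B} (f : x ⟶ x) : Prop := ∃ n : ℕ, IsSum (fun _ : Fin n => 𝟙 x) f

theorem IsMultiple.of_square {x y : B} {f : x ⟶ x} {g : y ⟶ y} (hg : IsMultiple g) {e : x ⟶ y}
    (he : IsEquiv e) (s : f ≫ e ≅ e ≫ g) : IsMultiple f := by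
  obtain ⟨n, hg⟩ := hg
  obtain ⟨e', ⟨θ⟩, -⟩ := he
  refine ⟨n, ((hg.whiskerRight e').whiskerLeft e).congr (fun _ => ⟨?_⟩) ⟨?_⟩⟩
  · exact whiskerLeftIso e (λ_ e') ≪≫ θ
  · exact (α_ _ _ _).symm ≪≫ whiskerRightIso s.symm e' ≪≫ α_ _ _ _ ≪≫ cancelLst f θ

theorem IsMultiple.of_square' {x y : B} {f : x ⟶ x} {g : y ⟶ y} (hf : IsMultiple f) {e : x ⟶ y}
    (he : IsEquiv e) (s : f ≫ e ≅ e ≫ g) : IsMultiple g := by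
  obtain ⟨e', he', ⟨θ⟩, ⟨φ⟩⟩ := he.exists_inv
  exact hf.of_square he' ((cancelFst φ (g ≫ e')).symm ≪≫ whiskerLeftIso e' ((α_ _ _ _).symm ≪≫
    whiskerRightIso s.symm e' ≪≫ α_ _ _ _ ≪≫ cancelLst f θ))

theorem isMultiple_of_equivalent {x y : B} (h : Equivalent x y) (hy : ∀ g : y ⟶ y, IsMultiple g)
    (f : x ⟶ x) : IsMultiple f := by
  obtain ⟨e, he⟩ := h
  obtain ⟨e', -, ⟨θ⟩, -⟩ := he.exists_inv
  exact (hy (e' ≫ f ≫ e)).of_square he (cancelFst θ _).symm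

theorem IsMultiple.wr [TensorBicategory B] (hB : TensorBilinear B) {x : B} {f : x ⟶ x}
    (h : IsMultiple f) (y : B) : IsMultiple (f ▹ y) := by
  obtain ⟨n, h⟩ := h
  exact ⟨n, (hB.isSum_ten_right h (𝟙 y)).congr (fun _ => ⟨tenId x y⟩) ⟨Iso.refl _⟩⟩

/-- Endomorphisms of `f` correspond by transposition to 2-morphisms into the zero 1-morphism `f ≫
g`, so the identity of `f` is zero. -/
theorem eq_zero_of_adjunction {x y : B} {f : x ⟶ y} {g : y ⟶ x} (adj : Adjunction f g)
    (h : Limits.IsZero (f ≫ g)) : Limits.IsZero f := by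
  rw [Limits.IsZero.iff_id_eq_zero, ← cancel_epi (λ_ f).hom]
  exact (adj.homEquiv₂ (g := 𝟙 x) (h := f)).injective (h.eq_of_tgt _ _)

/-- The transposition of 2-morphisms along an adjunction. -/
def adjunctionTranspose {x y : B} {f : x ⟶ y} {g : y ⟶ x} (adj : Adjunction f g) :
    (𝟙 x ⟶ f ≫ g) →ₗ[ℂ] (f ⟶ f) where
  toFun γ := (λ_ f).inv ≫ γ ▷ f ≫ (α_ _ _ _).hom ≫ f ◁ adj.counit ≫ (ρ_ _).hom
  map_add' γ γ' := by
    rw [LinearBicategory.add_whiskerRight, Preadditive.add_comp, Preadditive.comp_add]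
  map_smul' r γ := by
    rw [LinearBicategory.smul_whiskerRight, Linear.smul_comp, Linear.comp_smul]; rfl

theorem adjunctionTranspose_injective {x y : B} {f : x ⟶ y} {g : y ⟶ x} (adj : Adjunction f g) :
    Function.Injective (adjunctionTranspose adj) := fun _ _ h =>
  (adj.homEquiv₂ (g := 𝟙 x) (h := f)).symm.injective ((cancel_epi (λ_ f).inv).1 h)

/-- Write `f ≫ g` as `n` copies and `g ≫ f` as `m` copies of an identity. Transposition embeds the
2-morphisms `𝟙 x ⟶ f ≫ g` in the line `End(f)`, so `n ≤ 1`, and `n = 0` would make `f` zero. -/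
theorem isEquiv_of_simple {x y : B} {f : x ⟶ y} {g : y ⟶ x} (adj : Adjunction f g)
    (hx : IsSimple x) (hf : Module.finrank ℂ (f ⟶ f) = 1) (h : IsMultiple (f ≫ g))
    (h' : IsMultiple (g ≫ f)) : IsEquiv f := by
  obtain ⟨n, hn⟩ := h
  obtain ⟨m, hm⟩ := h'
  have h₁ := hn.le_one (id_ne_zero_of_finrank hx) hf (adjunctionTranspose adj)
    (adjunctionTranspose_injective adj)
  rcases Nat.le_one_iff_eq_zero_or_eq_one.1 h₁ with rfl | rfl
  · exact absurd ((Limits.IsZero.iff_id_eq_zero _).1 (eq_zero_of_adjunction adj hn.isZero))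
      (id_ne_zero_of_finrank hf)
  obtain ⟨θ⟩ := hn.iso
  -- Rebracketing `f ≫ g ≫ f` shows that `f` is a sum of `m` copies of itself, which forces `m = 1`.
  have h₂ : IsSum (fun _ : Fin m => f) f := (hm.whiskerLeft f).congr (fun _ => ⟨ρ_ f⟩)
    ⟨(α_ f g f).symm ≪≫ whiskerRightIso θ.symm f ≪≫ λ_ f⟩
  obtain rfl := h₂.eq_one hf
  obtain ⟨φ⟩ := hm.iso
  exact ⟨g, ⟨θ.symm⟩, ⟨φ.symm⟩⟩

end Multiples

theorem IsFusion.tensorBilinear {B : Type u} [Bicategory.{w, v} B] [LinearBicategory B]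
    [MonoidalBicategory B] (hB : IsFusion B) : TensorBilinear B :=
  ⟨⟨hB.ten_smul, hB.smul_ten⟩, hB.ten_add, hB.add_ten⟩

theorem isZero_of_no_simple {C : Type v} [Category.{w} C] [Preadditive C] [Linear ℂ C]
    (hC : FiniteSemisimple C) (h : ∀ X : C, Module.finrank ℂ (X ⟶ X) ≠ 1) (X : C) :
    Limits.IsZero X := by
  obtain ⟨-, n, S, hS, -, h₃⟩ := hC
  obtain ⟨k, c, hX⟩ := h₃ X
  cases k with
  | zero => exact hX.isZero
  | succ k => exact absurd (hS (c 0)) (h _)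

namespace FusionData

variable {B : Type u} [Bicategory.{w, v} B] [LinearBicategory B] [BraidedBicategory B]
  {L : Type*} [CommGroup L] (D : FusionData B L) (hB : IsStronglyFusion B)

include hB

/-- Tensoring with a suitable `e_h` moves `f` to an endomorphism of an object equivalent to the
unit, where strong fusion applies. Tensoring back with `e_g`, reassociating and identifying `e_h ⊗
e_g` with the unit recovers `f` up to equivalence. -/
theorem isMultiple (g : L) (f : D.e g ⟶ D.e g) : IsMultiple f := by
  have hT := hB.toIsFusion.tensorBilinear
  -- The class of the unit object is not yet known to be `1`, so `g⁻¹ * g₀` plays the role of the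
  -- inverse of `g`.
  obtain ⟨g₀, q, hq⟩ := D.complete (tunit B) hB.unit_simple
  obtain ⟨q', hq', -⟩ := hq.exists_inv
  have h₁ (h : L) (hh : g * h = g₀) : IsMultiple (f ▹ D.e h) :=
    isMultiple_of_equivalent ⟨_, (D.χ_equiv g h g₀ hh).comp hq'⟩ hB.endo _
  have h₂ := (h₁ (g⁻¹ * g₀) (by group)).wr hT (D.e g)
  have h₃ : IsMultiple (f ▹ (D.e (g⁻¹ * g₀) ⊠ D.e g)) :=
    h₂.of_square (AdjointInverse.isEquiv_inv _) (isc₁ f _ _)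
  obtain ⟨κ, hκ, -⟩ := (D.χ_equiv (g⁻¹ * g₀) g g₀ (by rw [mul_comm]; group)).exists_inv
  have h₄ : IsMultiple (f ▹ tunit B) :=
    h₃.of_square ((isEquiv_id _).ten (hq.comp hκ)) (interchange f (q ≫ κ)).symm
  exact h₄.of_square' (AdjointInverse.isEquiv (TensorBicategory.rightInverse _)) (runSq f)

/-- A simple 1-morphism from `e_g` to `e_h` would be an equivalence, and there is none for `g ≠ h`;
a finite semisimple category without simple objects is zero. -/
theorem isZero_of_ne {g h : L} (hgh : g ≠ h) (f : D.e g ⟶ D.e h) : Limits.IsZero f := by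
  refine isZero_of_no_simple (hB.finiteSemisimple _ _) (fun f hf => hgh ?_) f
  obtain ⟨f', ⟨adj⟩⟩ := hB.rightAdjoint f
  exact D.injective g h ⟨f, isEquiv_of_simple adj (D.simple g) hf (D.isMultiple hB g _)
    (D.isMultiple hB h _)⟩

end FusionData

/-! ### Decomposition of objects -/

section Summands

variable {B : Type u} [Bicategory.{w, v} B]

/-- Both sides agree after composing with `ι`, by the interchange law, and `ι` is a split
monomorphism. -/
theorem whiskerRight_eq_whiskerLeft_of_retract {b : B} {T : b ⟶ b} {ι : T ⟶ 𝟙 b} {π : 𝟙 b ⟶ T}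
    (hι : ι ≫ π = 𝟙 T) : ι ▷ T ≫ (λ_ T).hom = T ◁ ι ≫ (ρ_ T).hom := by
  have h : (ι ▷ T ≫ (λ_ T).hom) ≫ ι = (T ◁ ι ≫ (ρ_ T).hom) ≫ ι := by
    have := whisker_exchange_assoc ι ι (λ_ (𝟙 b)).hom
    simpa [unitors_equal] using this.symm
  have := congrArg (· ≫ π) h
  simpa [hι] using this

/-- The monad of an idempotent direct summand of an identity 1-morphism. -/
def summandMonad {b : B} (T : b ⟶ b) (ι : T ⟶ 𝟙 b) (π : 𝟙 b ⟶ T) (hι : ι ≫ π = 𝟙 T)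
    (h : (π ≫ ι) ▷ T = 𝟙 _) (h' : T ◁ (π ≫ ι) = 𝟙 _) : MonadIn b where
  t := T
  mul := ι ▷ T ≫ (λ_ T).hom
  one := π
  mul_assoc := by
    nth_rw 1 [whiskerRight_eq_whiskerLeft_of_retract hι]
    simp
  one_mul := by rw [← Category.assoc, ← comp_whiskerRight, h, Category.id_comp]
  mul_one := by
    rw [whiskerRight_eq_whiskerLeft_of_retract hι, ← whiskerLeft_comp_assoc, h', Category.id_comp]

/-- If the multiplication is invertible, its inverse is a section, and associativity alone makes it
a map of bimodules. -/
theorem MonadIn.separable_of_inverse {b : B} (M : MonadIn b) (s : M.t ⟶ M.t ≫ M.t)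
    (h : s ≫ M.mul = 𝟙 M.t) (h' : M.mul ≫ s = 𝟙 (M.t ≫ M.t)) : M.Separable := by
  have : IsIso M.mul := ⟨s, h', h⟩
  refine ⟨s, h, ?_, ?_⟩
  · rw [← cancel_mono M.mul, h', Category.id_comp, Category.assoc, Category.assoc, ← M.mul_assoc,
      ← comp_whiskerRight_assoc, h]
    simp
  · rw [← cancel_mono M.mul, h', Category.id_comp, Category.assoc, Category.assoc, M.mul_assoc,
      Iso.inv_hom_id_assoc, ← whiskerLeft_comp_assoc, h]
    simp

theorem summandMonad_separable {b : B} (T : b ⟶ b) (ι : T ⟶ 𝟙 b) (π : 𝟙 b ⟶ T) (hι : ι ≫ π = 𝟙 T)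
    (h : (π ≫ ι) ▷ T = 𝟙 _) (h' : T ◁ (π ≫ ι) = 𝟙 _) : (summandMonad T ι π hι h h').Separable := by
  refine MonadIn.separable_of_inverse _ ((λ_ T).inv ≫ π ▷ T) ?_ ?_
  · change ((λ_ T).inv ≫ π ▷ T) ≫ ι ▷ T ≫ (λ_ T).hom = 𝟙 T
    rw [Category.assoc, ← comp_whiskerRight_assoc, h]
    simp
  · change (ι ▷ T ≫ (λ_ T).hom) ≫ (λ_ T).inv ≫ π ▷ T = 𝟙 (T ≫ T)
    rw [Category.assoc, Iso.hom_inv_id_assoc, ← comp_whiskerRight, hι, id_whiskerRight]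

end Summands

/-! ### Orthogonal summands of an identity 1-morphism. -/

section Splitting

variable {B : Type u} [Bicategory.{w, v} B]

/-- The Eckmann-Hilton argument. -/
theorem id_comp_comm {b : B} (η θ : 𝟙 b ⟶ 𝟙 b) : η ≫ θ = θ ≫ η := by
  have h := whisker_exchange η θ
  simp only [id_whiskerLeft, whiskerRight_id, unitors_equal, unitors_inv_equal,
    ← Category.assoc, cancel_mono] at h
  simpa using h.symm

theorem whiskerRight_injective_of_section {a b c : B} {l : b ⟶ c} {r : c ⟶ b} {ν : r ≫ l ⟶ 𝟙 c}
    {s : 𝟙 c ⟶ r ≫ l} (h : s ≫ ν = 𝟙 _) {f g : a ⟶ c} {η θ : f ⟶ g} (e : η ▷ r = θ ▷ r) : η = θ := by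
  have key (η : f ⟶ g) : η = 𝟙 _ ⊗≫ f ◁ s ⊗≫ (η ▷ r) ▷ l ⊗≫ g ◁ ν ⊗≫ 𝟙 _ := by
    calc η = 𝟙 _ ⊗≫ f ◁ (s ≫ ν) ⊗≫ η ▷ 𝟙 c ⊗≫ 𝟙 _ := by rw [h]; bicategory
      _ = 𝟙 _ ⊗≫ f ◁ s ⊗≫ (f ◁ ν ≫ η ▷ 𝟙 c) ⊗≫ 𝟙 _ := by bicategory
      _ = _ := by rw [whisker_exchange]; bicategory
  rw [key η, key θ, e]

variable [LinearBicategory B]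

theorem covers_of_section {b c : B} {l : b ⟶ c} {r : c ⟶ b} {ν : r ≫ l ⟶ 𝟙 c} {s : 𝟙 c ⟶ r ≫ l}
    (h : s ≫ ν = 𝟙 _) : Covers fun _ : Unit => l :=
  ⟨fun _ => r, fun _ => s, fun _ => ν, by simpa using h⟩

/-- Whiskering with `l` and `r` embeds the endomorphisms of `𝟙 c` in the line `End(l ≫ r)`, by the
section of the counit. They are not all zero, since otherwise `l ≫ r` would vanish. -/
theorem isSimple_of_section {b c : B} {l : b ⟶ c} {r : c ⟶ b} {ν : r ≫ l ⟶ 𝟙 c}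
    {s : 𝟙 c ⟶ r ≫ l} (h : s ≫ ν = 𝟙 _) (hT : Module.finrank ℂ (l ≫ r ⟶ l ≫ r) = 1) :
    IsSimple c := by
  let φ : (𝟙 c ⟶ 𝟙 c) →ₗ[ℂ] ((l ≫ 𝟙 c) ≫ r ⟶ (l ≫ 𝟙 c) ≫ r) :=
    { toFun := fun η => (l ◁ η) ▷ r
      map_add' := fun η θ => by
        rw [LinearBicategory.whiskerLeft_add, LinearBicategory.add_whiskerRight]
      map_smul' := fun r η => by
        rw [LinearBicategory.whiskerLeft_smul, LinearBicategory.smul_whiskerRight]; rfl }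
  have hφ : Function.Injective φ := fun η θ e =>
    (covers_of_section h).ext fun _ => whiskerRight_injective_of_section h e
  have hV : Module.finrank ℂ ((l ≫ 𝟙 c) ≫ r ⟶ (l ≫ 𝟙 c) ≫ r) = 1 :=
    (finrank_end_congr (whiskerRightIso (ρ_ l) r)).trans hT
  have : Module.Finite ℂ ((l ≫ 𝟙 c) ≫ r ⟶ (l ≫ 𝟙 c) ≫ r) :=
    Module.finite_of_finrank_eq_succ hV
  have : Module.Finite ℂ (𝟙 c ⟶ 𝟙 c) := Module.Finite.of_injective φ hφ
  have : Nontrivial (𝟙 c ⟶ 𝟙 c) := ⟨𝟙 _, 0, fun h0 => id_ne_zero_of_finrank hT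
    ((Limits.IsZero.iff_id_eq_zero _).1 ((isZero_whiskerRight (isZero_whiskerLeft l
      ((Limits.IsZero.iff_id_eq_zero _).2 h0)) r).of_iso (whiskerRightIso (ρ_ l).symm r)))⟩
  refine le_antisymm ?_ Module.finrank_pos
  rw [← hV]
  exact LinearMap.finrank_le_finrank_of_injective hφ

section IdentitySum

variable {b : B} {n : ℕ} {T : Fin n → (b ⟶ b)} {i : ∀ k, T k ⟶ 𝟙 b} {p : ∀ k, 𝟙 b ⟶ T k}
  (h₁ : ∀ k, i k ≫ p k = 𝟙 (T k)) (h₂ : ∀ k l, k ≠ l → i k ≫ p l = 0)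
  (h₃ : ∑ k, p k ≫ i k = 𝟙 (𝟙 b)) (hT : ∀ k, Module.finrank ℂ (T k ⟶ T k) = 1)

include h₁ h₂

/-- Endomorphisms of `𝟙 b` commute. Commuting `p k ≫ φ ≫ i l` past the idempotent `p k ≫ i k`, and
sandwiching between `i k` and `p l`, gives `φ` on one side and zero on the other. -/
theorem hom_eq_zero_of_sum {k l : Fin n} (hkl : k ≠ l) (φ : T k ⟶ T l) : φ = 0 := by
  have h := id_comp_comm (p k ≫ i k) (p k ≫ φ ≫ i l)
  have h' := congrArg (fun η => i k ≫ η ≫ p l) h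
  simpa [reassoc_of% h₁, h₁, reassoc_of% h₂ l k hkl.symm] using h'

include h₃ hT

/-- The composite is a summand of `T k` and of `T l`, both of which are simple. If it were non-zero
it would be isomorphic to both, but there are no non-zero 2-morphisms between them. -/
theorem isZero_comp_of_sum {k l : Fin n} (hkl : k ≠ l) : Limits.IsZero (T k ≫ T l) := by
  have hs : IsSum T (𝟙 b) := ⟨i, p, h₁, h₂, h₃⟩
  have a := ((hs.whiskerLeft (T k)).congr (fun _ => ⟨Iso.refl _⟩) ⟨ρ_ _⟩).isZero_or_iso (hT k) l
  have a' := ((hs.whiskerRight (T l)).congr (fun _ => ⟨Iso.refl _⟩) ⟨λ_ _⟩).isZero_or_iso (hT l) k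
  rcases a with a | ⟨⟨a⟩⟩
  · exact a
  rcases a' with a' | ⟨⟨a'⟩⟩
  · exact a'
  have := hom_eq_zero_of_sum h₁ h₂ hkl (a.inv ≫ a'.hom)
  exact absurd (by rw [← (a.symm ≪≫ a').hom_inv_id, Iso.trans_hom, Iso.symm_hom, this,
    Limits.zero_comp]) (id_ne_zero_of_finrank (hT k))

theorem whiskerRight_eq_id_of_sum (k : Fin n) : (p k ≫ i k) ▷ T k = 𝟙 _ := by
  have e := congrArg (· ▷ T k) h₃
  simp only [sum_whiskerRight, id_whiskerRight] at e
  rw [Finset.sum_eq_single k] at e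
  · exact e
  · intro l _ hl
    rw [comp_whiskerRight, (isZero_comp_of_sum h₁ h₂ h₃ hT hl).eq_zero_of_tgt (p l ▷ T k),
      Limits.zero_comp]
  · simp

theorem whiskerLeft_eq_id_of_sum (k : Fin n) : T k ◁ (p k ≫ i k) = 𝟙 _ := by
  have e := congrArg (T k ◁ ·) h₃
  simp only [whiskerLeft_sum, whiskerLeft_id] at e
  rw [Finset.sum_eq_single k] at e
  · exact e
  · intro l _ hl
    rw [whiskerLeft_comp, (isZero_comp_of_sum h₁ h₂ h₃ hT hl.symm).eq_zero_of_tgt (T k ◁ p l),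
      Limits.zero_comp]
  · simp

end IdentitySum

end Splitting

namespace FusionData

variable {B : Type u} [Bicategory.{w, v} B] [LinearBicategory B] [BraidedBicategory B]
  {L : Type*} [CommGroup L] (D : FusionData B L) (hB : IsStronglyFusion B)

include hB

/-- The summand `T` is a separable monad with invertible multiplication, so it splits as `l ≫ r`
through an object `c`. That object is simple because `T` is, hence equivalent to some `e_g`. -/
theorem exists_splitting {b : B} {T : b ⟶ b} {ι : T ⟶ 𝟙 b} {π : 𝟙 b ⟶ T} (hι : ι ≫ π = 𝟙 T)
    (h : (π ≫ ι) ▷ T = 𝟙 _) (h' : T ◁ (π ≫ ι) = 𝟙 _) (hT : Module.finrank ℂ (T ⟶ T) = 1) :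
    ∃ (g : L) (i : D.e g ⟶ b) (p : b ⟶ D.e g), Nonempty (i ≫ p ≅ 𝟙 _) ∧ Nonempty (p ≫ i ≅ T) := by
  obtain ⟨c, l, r, adj, θ, ⟨s, hs⟩, -, -⟩ := hB.splits _ (summandMonad_separable T ι π hι h h')
  let θ : l ≫ r ≅ T := θ
  have μ : T ≫ T ≅ T := ⟨ι ▷ T ≫ (λ_ T).hom, (λ_ T).inv ≫ π ▷ T, by
    rw [Category.assoc, Iso.hom_inv_id_assoc, ← comp_whiskerRight, hι, id_whiskerRight], by
    rw [Category.assoc, ← comp_whiskerRight_assoc, h]; simp⟩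
  have hc := isSimple_of_section hs ((finrank_end_congr θ).trans hT)
  obtain ⟨g, hg⟩ := D.complete c hc
  obtain ⟨n, hn⟩ := isMultiple_of_equivalent hg (D.isMultiple hB g) (r ≫ l)
  -- With `r ≫ l` a sum of `n` identities, `l ≫ (r ≫ l) ≫ r` is both `n` copies of `T` and `T ≫ T ≅
  -- T`, so `n = 1` and `r ≫ l` is the identity.
  have hn' : IsSum (fun _ : Fin n => T) T := ((hn.whiskerRight r).whiskerLeft l).congr
    (fun _ => ⟨whiskerLeftIso l (λ_ r) ≪≫ θ⟩)
    ⟨whiskerLeftIso l (α_ r l r) ≪≫ (α_ _ _ _).symm ≪≫ whiskerRightIso θ _ ≪≫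
      whiskerLeftIso T θ ≪≫ μ⟩
  obtain rfl := hn'.eq_one hT
  obtain ⟨ψ⟩ := hn.iso
  obtain ⟨κ, hκ⟩ := hg
  obtain ⟨κ', -, ⟨φ⟩, ⟨φ'⟩⟩ := hκ.exists_inv
  exact ⟨g, κ' ≫ r, l ≫ κ, ⟨α_ _ _ _ ≪≫ whiskerLeftIso κ' (cancelFst ψ.symm κ) ≪≫ φ'⟩,
    ⟨α_ _ _ _ ≪≫ cancelMid l φ r ≪≫ θ⟩⟩

theorem exists_decomposition (b : B) :
    ∃ (n : ℕ) (c : Fin n → L), IsObjSum (fun k => D.e (c k)) b := by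
  obtain ⟨-, N, S, hS, -, h⟩ := hB.finiteSemisimple b b
  obtain ⟨n, d, ι, π, h₁, h₂, h₃⟩ := h (𝟙 b)
  have hT := fun k => hS (d k)
  choose c i p hip hpi using fun k => D.exists_splitting hB (h₁ k)
    (whiskerRight_eq_id_of_sum h₁ h₂ h₃ hT k) (whiskerLeft_eq_id_of_sum h₁ h₂ h₃ hT k) (hT k)
  refine ⟨n, c, i, p, hip, fun k l hkl => ?_,
    IsSum.congr ⟨ι, π, h₁, h₂, h₃⟩ (fun k => ⟨(hpi k).some.symm⟩) ⟨Iso.refl _⟩⟩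
  -- Inserting cancelling pairs on both sides exhibits `i k ≫ p l` as a composite through `T k ≫ T
  -- l`, which is zero.
  have z : Limits.IsZero (i k ≫ ((p k ≫ i k) ≫ (p l ≫ i l)) ≫ p l) :=
    isZero_whiskerLeft _ (isZero_whiskerRight ((isZero_comp_of_sum h₁ h₂ h₃ hT hkl).of_iso
      (whiskerRightIso (hpi k).some _ ≪≫ whiskerLeftIso _ (hpi l).some)) _)
  refine z.of_iso ((cancelFst (hip k).some (i k ≫ p l)).symm ≪≫ ?_)
  exact whiskerLeftIso _ (whiskerLeftIso (p k) (cancelLst (i k ≫ p l) (hip l).some).symm) ≪⊗≫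
    Iso.refl _

end FusionData

/-! ### Half syllepses on simple objects -/

section SumPairs

variable {B : Type u} [Bicategory.{w, v} B] [BraidedBicategory B] [LinearBicategory B]
  (hB : TensorBilinear B) {x x' y y' : B} {m : br x y ≫ br y x ≅ 𝟙 (x ⊠ y)}
  {m' : br x' y' ≫ br y' x' ≅ 𝟙 (x' ⊠ y')}

include hB

theorem pairCompat_of_isSum_right {n : ℕ} {f : x ⟶ x'} {g : Fin n → (y ⟶ y')} {g' : y ⟶ y'}
    (hg : IsSum g g') (h : ∀ k, PairCompat f (g k) m m') : PairCompat f g' m m' := by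
  obtain ⟨i, p, -, -, e⟩ := hg
  refine pairCompat_of_sum (fun k => ten₂ (𝟙 f) (p k)) (fun _ => 𝟙 f) i ?_ h
  simp_rw [← ten₂_comp, Category.id_comp]
  rw [← hB.ten_sum, e, ten₂_id]

theorem pairCompat_of_isSum_left {n : ℕ} {f : Fin n → (x ⟶ x')} {f' : x ⟶ x'} {g : y ⟶ y'}
    (hf : IsSum f f') (h : ∀ k, PairCompat (f k) g m m') : PairCompat f' g m m' := by
  obtain ⟨i, p, -, -, e⟩ := hf
  refine pairCompat_of_sum (fun k => ten₂ (p k) (𝟙 g)) i (fun _ => 𝟙 g) ?_ h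
  simp_rw [← ten₂_comp, Category.id_comp]
  rw [← hB.sum_ten, e, ten₂_id]

theorem pairCompat_of_isZero_right {f : x ⟶ x'} {g : y ⟶ y'} (hg : Limits.IsZero g) :
    PairCompat f g m m' :=
  pairCompat_of_isSum_right hB (isSum_zero (X := fun k => k.elim0) hg) fun k => k.elim0

theorem pairCompat_of_isZero_left {f : x ⟶ x'} {g : y ⟶ y'} (hf : Limits.IsZero f) :
    PairCompat f g m m' :=
  pairCompat_of_isSum_left hB (isSum_zero (X := fun k => k.elim0) hf) fun k => k.elim0

end SumPairs

/-- A family of 2-isomorphisms that is a modification. -/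
def IsNatural {B : Type u} [Bicategory.{w, v} B] [BraidedBicategory B] {x : B} (s : SylFamily x) :
    Prop :=
  ∀ ⦃y y' : B⦄ (g : y ⟶ y'), PairCompat (𝟙 x) g (s y) (s y')

theorem pairCompat_id_eq {B : Type u} [Bicategory.{w, v} B] [BraidedBicategory B] {x y : B}
    {m m' : br x y ≫ br y x ≅ 𝟙 (x ⊠ y)} (h : PairCompat (𝟙 x) (𝟙 y) m m') : m = m' :=
  h.eq_left ((isEquiv_id x).ten (isEquiv_id y)).fullyFaithful (pairCompat_id m')

namespace FusionData

variable {B : Type u} [Bicategory.{w, v} B] [LinearBicategory B] [BraidedBicategory B]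
  {L : Type*} [CommGroup L] (D : FusionData B L) (hB : IsStronglyFusion B)

include hB

theorem exists_isObjSumVia (b : B) : ∃ (n : ℕ) (c : Fin n → L) (i : ∀ k, D.e (c k) ⟶ b)
    (p : ∀ k, b ⟶ D.e (c k)), IsObjSumVia i p := by
  obtain ⟨n, c, i, p, h⟩ := D.exists_decomposition hB b
  exact ⟨n, c, i, p, h⟩

/-- Naturality between simple objects imposes no condition: every 1-morphism there is a sum of
identities or zero. -/
theorem pairCompat_simple {x : B} (w : ∀ h, br x (D.e h) ≫ br (D.e h) x ≅ 𝟙 (x ⊠ D.e h)) {h k : L}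
    (g : D.e h ⟶ D.e k) : PairCompat (𝟙 x) g (w h) (w k) := by
  by_cases hk : h = k
  · subst hk
    obtain ⟨n, hn⟩ := D.isMultiple hB h g
    exact pairCompat_of_isSum_right hB.toIsFusion.tensorBilinear hn fun _ => pairCompat_id _
  · exact pairCompat_of_isZero_right hB.toIsFusion.tensorBilinear (D.isZero_of_ne hB hk g)

theorem natural_ext {x : B} {s s' : SylFamily x} (hs : IsNatural s) (hs' : IsNatural s')
    (h : ∀ g, s (D.e g) = s' (D.e g)) : s = s' := by
  funext y
  obtain ⟨n, c, i, p, hy⟩ := D.exists_isObjSumVia hB y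
  have hc := (hB.toIsFusion.tensorBilinear.isObjSumVia_wl hy x).covers
  exact PairCompat.eq_right hc (fun k => hs (i k)) fun k => by rw [h]; exact hs' (i k)

/-- The values are glued along a chosen decomposition of each object. -/
theorem exists_natural {x : B} (w : ∀ h, br x (D.e h) ≫ br (D.e h) x ≅ 𝟙 (x ⊠ D.e h)) :
    ∃ s : SylFamily x, IsNatural s ∧ ∀ h, s (D.e h) = w h := by
  have hT := hB.toIsFusion.tensorBilinear
  choose n c i p hy using D.exists_isObjSumVia hB
  choose s hs using fun y => exists_pairCompat_right (f := fun _ => 𝟙 x)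
    (hT.isObjSumVia_wl (hy y) x) fun k => w (c y k)
  -- Independence of the chosen decomposition: any `j` is a sum of 1-morphisms through the chosen
  -- summands, and its components between simple objects are automatically compatible.
  have key {h : L} {y : B} (j : D.e h ⟶ y) : PairCompat (𝟙 x) j (w h) (s y) := by
    refine pairCompat_of_isSum_right hT (((hy y).2.2.whiskerLeft j).congr
      (fun k => ⟨(α_ j (p y k) (i y k)).symm⟩) ⟨ρ_ j⟩) fun k => ?_
    exact pairCompat_congr (λ_ _) (Iso.refl _)
      (pairCompat_comp (D.pairCompat_simple hB w (j ≫ p y k)) (hs y k))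
  refine ⟨s, fun y y' g => ?_, fun h => (pairCompat_id_eq (key (𝟙 _))).symm⟩
  exact PairCompat.of_comp_left (hT.isObjSumVia_wl (hy y) x).covers (hs y) fun k =>
    pairCompat_congr (λ_ _).symm (Iso.refl _) (key (i y k ≫ g))

/-- Both sides of the tensor condition are natural in `y` and `z`, so they agree if they agree on
the summands. -/
theorem isHalf_of_natural {x : B} {s : SylFamily x} (hs : IsNatural s)
    (h : ∀ g k, s (D.e g ⊠ D.e k) = sylMul s (D.e g) (D.e k)) : IsHalfSyllepsis s := by
  refine ⟨fun g => hs g, fun y z => ?_⟩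
  have hT := hB.toIsFusion.tensorBilinear
  obtain ⟨n, c, i, p, hy⟩ := D.exists_isObjSumVia hB y
  obtain ⟨m, d, j, q, hz⟩ := D.exists_isObjSumVia hB z
  have hc := hT.covers_ten (isEquiv_id x).covers (hT.covers_ten hy.covers hz.covers)
  refine PairCompat.eq_right hc (fun a => hs (i a.2.1 ⊠₁ j a.2.2)) fun a => ?_
  rw [h]
  exact sylMul_natural (hs _) (hs _)

/-! ### Twists of two simple objects and their scalars. -/

omit hB

/-- The identification of the double braiding of two simple objects with the identity over their
fusion. -/
def doubleTri (g h s : L) (hs : g * h = s) (hs' : h * g = s) :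
    (br (D.e g) (D.e h) ≫ br (D.e h) (D.e g)) ≫ D.χ g h s hs ≅ D.χ g h s hs :=
  α_ _ _ _ ≪≫ whiskerLeftIso _ (D.u h g s hs' hs) ≪≫ D.u g h s hs hs'

theorem finrank_χ (g h s : L) (hs : g * h = s) :
    ∃ f : D.e s ⟶ D.e g ⊠ D.e h, IsEquiv f ∧
      Module.finrank ℂ (f ≫ D.χ g h s hs ⟶ f ≫ D.χ g h s hs) = 1 := by
  obtain ⟨f, hf, -, ⟨φ⟩⟩ := (D.χ_equiv g h s hs).exists_inv
  exact ⟨f, hf, (finrank_end_congr φ).trans (D.simple s)⟩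

theorem exists_smul_id_χ (g h s : L) (hs : g * h = s) (η : D.χ g h s hs ⟶ D.χ g h s hs) :
    ∃ r : ℂ, r • 𝟙 _ = η := by
  obtain ⟨f, hf, h₁⟩ := D.finrank_χ g h s hs
  obtain ⟨r, hr⟩ := exists_smul_id h₁ (f ◁ η)
  exact ⟨r, hf.whiskerLeft_injective (by
    rw [LinearBicategory.whiskerLeft_smul, whiskerLeft_id, hr])⟩

theorem id_χ_ne_zero (g h s : L) (hs : g * h = s) : 𝟙 (D.χ g h s hs) ≠ 0 := by
  obtain ⟨f, -, h₁⟩ := D.finrank_χ g h s hs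
  intro h0
  apply id_ne_zero_of_finrank h₁
  rw [← whiskerLeft_id, h0, whiskerLeft_zero]

variable {D}

theorem IsTwist.eq {g h s : L} {hs : g * h = s} {hs' : h * g = s}
    {v v' : br (D.e g) (D.e h) ≫ br (D.e h) (D.e g) ≅ 𝟙 (D.e g ⊠ D.e h)} {r : ℂ}
    (H : D.IsTwist g h s hs hs' v r) (H' : D.IsTwist g h s hs hs' v' r) : v = v' :=
  Iso.ext (((D.χ_equiv g h s hs).fullyFaithful _ _).1
    ((cancel_mono (λ_ (D.χ g h s hs)).hom).1 (H.trans H'.symm)))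

theorem IsTwist.scalar_eq {g h s : L} {hs : g * h = s} {hs' : h * g = s}
    {v : br (D.e g) (D.e h) ≫ br (D.e h) (D.e g) ≅ 𝟙 (D.e g ⊠ D.e h)} {r r' : ℂ}
    (H : D.IsTwist g h s hs hs' v r) (H' : D.IsTwist g h s hs hs' v r') : r = r' := by
  have e : r • (D.doubleTri g h s hs hs').hom = r' • (D.doubleTri g h s hs hs').hom := by
    simpa [doubleTri] using H.symm.trans H'
  have e' := congrArg ((D.doubleTri g h s hs hs').inv ≫ ·) e
  simp only [Linear.comp_smul, Iso.inv_hom_id] at e'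
  exact smul_left_injective ℂ (D.id_χ_ne_zero g h s hs) e'

variable (D)

theorem exists_isTwist_scalar {g h s : L} (hs : g * h = s) (hs' : h * g = s)
    (v : br (D.e g) (D.e h) ≫ br (D.e h) (D.e g) ≅ 𝟙 (D.e g ⊠ D.e h)) :
    ∃ r : ℂˣ, D.IsTwist g h s hs hs' v r := by
  let ξ := whiskerRightIso v (D.χ g h s hs) ≪≫ λ_ _
  obtain ⟨r, hr⟩ := D.exists_smul_id_χ g h s hs ((D.doubleTri g h s hs hs').inv ≫ ξ.hom)
  have hr0 : r ≠ 0 := by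
    rintro rfl
    apply D.id_χ_ne_zero g h s hs
    rw [← ((D.doubleTri g h s hs hs').symm ≪≫ ξ).inv_hom_id, Iso.trans_hom, Iso.symm_hom, ← hr]
    simp
  refine ⟨Units.mk0 r hr0, ?_⟩
  have e := congrArg ((D.doubleTri g h s hs hs').hom ≫ ·) hr
  simp only [Linear.comp_smul, Category.comp_id, Iso.hom_inv_id_assoc] at e
  unfold IsTwist
  simpa [doubleTri, ξ] using e.symm

theorem exists_isTwist {g h s : L} (hs : g * h = s) (hs' : h * g = s) (r : ℂˣ) :
    ∃ v, D.IsTwist g h s hs hs' v r := by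
  let τ := D.doubleTri g h s hs hs' ≪≫ (λ_ _).symm
  obtain ⟨v, hv⟩ := (D.χ_equiv g h s hs).fullyFaithful.exists_whiskerRightIso_eq
    (⟨(r : ℂ) • τ.hom, (r : ℂ)⁻¹ • τ.inv, by simp [smul_smul], by simp [smul_smul]⟩ :
      (br (D.e g) (D.e h) ≫ br (D.e h) (D.e g)) ≫ D.χ g h s hs ≅ 𝟙 _ ≫ D.χ g h s hs)
  refine ⟨v, ?_⟩
  unfold IsTwist
  rw [hv]
  simp [τ, doubleTri]

include hB

/-- The values with scalars `f h` extend to a natural family, and multiplicativity of `f` is exactly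
what the tensor condition on `e_h ⊗ e_k` requires. -/
theorem exists_half (hD : D.Trivialises) (f : L →* ℂˣ) (g : L) :
    ∃ s : SylFamily (D.e g), IsHalfSyllepsis s ∧
      ∀ h, D.IsTwist g h (g * h) rfl (mul_comm h g) (s (D.e h)) (f h) := by
  choose w hw using fun h => D.exists_isTwist (rfl : g * h = g * h) (mul_comm h g) (f h)
  obtain ⟨s, hs, hsw⟩ := D.exists_natural hB w
  have ht (h) : D.IsTwist g h (g * h) rfl (mul_comm h g) (s (D.e h)) (f h) := by
    rw [hsw]; exact hw h
  refine ⟨s, D.isHalf_of_natural hB hs fun h k => ?_, ht⟩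
  have hχ := D.χ_equiv h k (h * k) rfl
  -- The family `s` and `sylMul` are compared along the equivalence `χ`: each corresponds there to
  -- the value on `e_{hk}`.
  refine (hs (D.χ h k (h * k) rfl)).eq_left ((isEquiv_id _).ten hχ).fullyFaithful ?_
  refine sylMul_pairCompat hB.toIsFusion.tensorBilinear.toTensorLinear hD g h k (g * h) (h * k)
    (g * k) (g * (h * k)) rfl (mul_comm h g) rfl rfl (mul_comm k g) (mul_assoc g h k) rfl
    (mul_comm _ _) (mul_left_comm h g k) (f h).ne_zero (f k).ne_zero (ht h) (ht k) ?_ ?_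
  · have := ht (h * k)
    rwa [map_mul, Units.val_mul] at this
  · exact fun η θ e => ((D.χ_equiv g (h * k) _ rfl).fullyFaithful _ _).1 e

end FusionData

/-! ### Calculus of 1-morphisms of the sylleptic centre -/

section SylMaps

variable {B : Type u} [Bicategory.{w, v} B] [BraidedBicategory B]

theorem IsHalfSyllepsis.isNatural {x : B} {s : SylFamily x} (hs : IsHalfSyllepsis s) : IsNatural s :=
  fun _ _ g => hs.natural g

theorem isSylMap_congr {x x' : B} {s : SylFamily x} {s' : SylFamily x'} {f f' : x ⟶ x'} (e : f ≅ f')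
    (h : IsSylMap s s' f) : IsSylMap s s' f' :=
  fun y => pairCompat_congr e (Iso.refl (𝟙 y)) (h y)

theorem isSylMap_tenH {x x' y y' : B} {s : SylFamily x} {s' : SylFamily x'} {t : SylFamily y}
    {t' : SylFamily y'} {f : x ⟶ x'} {g : y ⟶ y'} (hf : IsSylMap s s' f) (hg : IsSylMap t t' g) :
    IsSylMap (tensorFamily s t) (tensorFamily s' t') (f ⊠₁ g) :=
  fun z => tensorFamily_natural (hf z) (hg z)

theorem IsNatural.tensorFamily {x y : B} {s : SylFamily x} {t : SylFamily y} (hs : IsNatural s)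
    (ht : IsNatural t) : IsNatural (tensorFamily s t) :=
  fun _ _ g => pairCompat_congr (tenId x y) (Iso.refl g) (tensorFamily_natural (hs g) (ht g))

theorem IsSylMap.of_comp_right {x x' x'' : B} {s : SylFamily x} {s' : SylFamily x'}
    {s'' : SylFamily x''} {f : x ⟶ x'} {f' : x' ⟶ x''} (hf : ∀ y, FullyFaithful (f' ▹ y))
    (h' : IsSylMap s' s'' f') (h : IsSylMap s s'' (f ≫ f')) : IsSylMap s s' f :=
  fun y => PairCompat.of_comp_right (hf y) (h' y)
    (pairCompat_congr (Iso.refl _) (λ_ (𝟙 y)).symm (h y))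

/-- Half syllepses pull back: both axioms can be checked after the fully faithful 1-morphism `f ▹
y`, where they become those of `s'`. -/
theorem isHalf_of_isSylMap {x x' : B} {s : SylFamily x} {s' : SylFamily x'} {f : x ⟶ x'}
    (hf : ∀ y, FullyFaithful (f ▹ y)) (h : IsSylMap s s' f) (hs : IsHalfSyllepsis s') :
    IsHalfSyllepsis s := by
  refine ⟨fun {y y'} g => ?_, fun y z => ?_⟩
  · exact PairCompat.of_comp_right (hf y') (h y') (pairCompat_congr (ρ_ f ≪≫ (λ_ f).symm)
      (λ_ g ≪≫ (ρ_ g).symm) (pairCompat_comp (h y) (hs.natural g)))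
  · refine PairCompat.eq_left (hf _) (h (y ⊠ z)) ?_
    rw [hs.mul]
    exact pairCompat_congr (Iso.refl f) (tenId y z) (sylMul_natural (h y) (h z))

theorem exists_isSylMap {x x' : B} {f : x ⟶ x'} (hf : ∀ y, FullyFaithful (f ▹ y))
    (s' : SylFamily x') : ∃ s : SylFamily x, IsSylMap s s' f := by
  choose s hs using fun y => exists_pairCompat_left (f := f) (g := 𝟙 y) (hf y) (s' y)
  exact ⟨s, hs⟩

theorem IsEquiv.fullyFaithful_wr {x x' : B} {f : x ⟶ x'} (hf : IsEquiv f) (y : B) :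
    FullyFaithful (f ▹ y) :=
  (hf.ten (isEquiv_id y)).fullyFaithful

variable [LinearBicategory B] (hB : TensorBilinear B)

include hB

theorem IsSylMap.of_comp_left {ι : Type*} [Fintype ι] {x : ι → B} {x' x'' : B}
    {s : ∀ k, SylFamily (x k)} {s' : SylFamily x'} {s'' : SylFamily x''} {f : ∀ k, x k ⟶ x'}
    {f' : x' ⟶ x''} (hf : Covers f) (h : ∀ k, IsSylMap (s k) s' (f k))
    (h' : ∀ k, IsSylMap (s k) s'' (f k ≫ f')) : IsSylMap s' s'' f' :=
  fun y => PairCompat.of_comp_left (hB.covers_ten hf (isEquiv_id y).covers) (fun k => h k.1 y)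
    fun k => pairCompat_congr (Iso.refl _) (λ_ (𝟙 y)).symm (h' k.1 y)

/-- Half syllepses descend: both axioms can be checked after restriction to the members of the
covering family. -/
theorem isHalf_of_covers {ι : Type*} [Fintype ι] {x : ι → B} {x' : B} {s : ∀ k, SylFamily (x k)}
    {s' : SylFamily x'} {f : ∀ k, x k ⟶ x'} (hf : Covers f) (h : ∀ k, IsSylMap (s k) s' (f k))
    (hs : ∀ k, IsHalfSyllepsis (s k)) : IsHalfSyllepsis s' := by
  refine ⟨fun {y y'} g => ?_, fun y z => ?_⟩
  · exact PairCompat.of_comp_left (hB.covers_ten hf (isEquiv_id y).covers) (fun k => h k.1 y)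
      fun k => pairCompat_congr (λ_ _ ≪≫ (ρ_ _).symm) (ρ_ g ≪≫ (λ_ g).symm)
        (pairCompat_comp ((hs k.1).natural g) (h k.1 y'))
  · refine PairCompat.eq_right (hB.covers_ten hf (isEquiv_id (y ⊠ z)).covers)
      (fun k => h k.1 (y ⊠ z)) fun k => ?_
    rw [(hs k.1).mul]
    exact pairCompat_congr (Iso.refl _) (tenId y z) (sylMul_natural (h k.1 y) (h k.1 z))

theorem isSylMap_of_isSum {n : ℕ} {x x' : B} {s : SylFamily x} {s' : SylFamily x'}
    {f : Fin n → (x ⟶ x')} {f' : x ⟶ x'} (hf : IsSum f f') (h : ∀ k, IsSylMap s s' (f k)) :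
    IsSylMap s s' f' :=
  fun y => pairCompat_of_isSum_left hB hf fun k => h k y

theorem isSylMap_of_isZero {x x' : B} {s : SylFamily x} {s' : SylFamily x'} {f : x ⟶ x'}
    (hf : Limits.IsZero f) : IsSylMap s s' f :=
  fun _ => pairCompat_of_isZero_left hB hf

omit hB in
theorem isSylMap_of_retract {x x' : B} {s : SylFamily x} {s' : SylFamily x'} {f f' : x ⟶ x'}
    (i : f ⟶ f') (p : f' ⟶ f) (hip : i ≫ p = 𝟙 f) (h : IsSylMap s s' f') : IsSylMap s s' f := by
  refine fun y => pairCompat_of_sum (ι := Unit) (fun _ => ten₂ i (𝟙 (𝟙 y))) (fun _ => p)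
    (fun _ => 𝟙 (𝟙 y)) ?_ fun _ => h y
  simp only [← ten₂_comp, hip, Category.comp_id, ten₂_id, Finset.univ_unique, Finset.sum_singleton]

/-- The equivalence `f` covers its target, and restricted along `f` the claim concerns a 1-morphism
isomorphic to the identity. -/
theorem IsSylMap.inverse {x x' : B} {s : SylFamily x} {s' : SylFamily x'} {f : x ⟶ x'} {g : x' ⟶ x}
    (hf : IsEquiv f) (θ : f ≫ g ≅ 𝟙 x) (h : IsSylMap s s' f) : IsSylMap s' s g :=
  IsSylMap.of_comp_left hB hf.covers (fun _ => h) fun _ => isSylMap_congr θ.symm (isSylMap_id s)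

section ObjSum

variable {n : ℕ} {x : Fin n → B} {x' : B} {i : ∀ k, x k ⟶ x'} {p : ∀ k, x' ⟶ x k}
  (h : IsObjSumVia i p)

include h

theorem exists_isSylMap_sum (s : ∀ k, SylFamily (x k)) :
    ∃ s' : SylFamily x', ∀ k, IsSylMap (s k) s' (i k) := by
  choose s' hs' using fun y => exists_pairCompat_right (g := fun _ => 𝟙 y)
    (hB.isObjSumVia_wr h y) fun k => s k y
  exact ⟨s', fun k y => hs' y k⟩

theorem isSylMap_projection {s : ∀ k, SylFamily (x k)} {s' : SylFamily x'}
    (hs : ∀ k, IsSylMap (s k) s' (i k)) (k : Fin n) : IsSylMap s' (s k) (p k) := by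
  refine IsSylMap.of_comp_left hB h.covers hs fun l => ?_
  by_cases hl : l = k
  · subst hl
    exact isSylMap_congr (h.1 l).some.symm (isSylMap_id _)
  · exact isSylMap_of_isZero hB (h.2.1 l k hl)

end ObjSum

end SylMaps

/-! ### Half syllepses and characters -/

namespace FusionData

variable {B : Type u} [Bicategory.{w, v} B] [LinearBicategory B] [BraidedBicategory B]
  {L : Type*} [CommGroup L] (D : FusionData B L)

/-- A half syllepsis on a simple object is given by a character. -/
structure HasCharacter {g : L} (s : SylFamily (D.e g)) (f : L →* ℂˣ) : Prop where
  isHalf : IsHalfSyllepsis s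
  isTwist (h p : L) (hp : g * h = p) (hp' : h * g = p) : D.IsTwist g h p hp hp' (s (D.e h)) (f h)

variable (hB : IsStronglyFusion B) (hD : D.Trivialises)

include hB

variable {D} in
theorem HasCharacter.unique {g : L} {s s' : SylFamily (D.e g)} {f : L →* ℂˣ}
    (h : D.HasCharacter s f) (h' : D.HasCharacter s' f) : s = s' :=
  D.natural_ext hB h.isHalf.isNatural h'.isHalf.isNatural fun k =>
    (h.isTwist k _ rfl (mul_comm k g)).eq (h'.isTwist k _ rfl (mul_comm k g))

include hD

theorem exists_hasCharacter (f : L →* ℂˣ) (g : L) : ∃ s, D.HasCharacter (g := g) s f := by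
  obtain ⟨s, hs, h⟩ := D.exists_half hB hD f g
  exact ⟨s, hs, fun k p hp hp' => by subst hp; exact h k⟩

/-- Each value on a simple object is a non-zero scalar; the tensor axiom together with naturality
along `χ_{h,k}` forces these scalars to be multiplicative. -/
theorem exists_character {g : L} {s : SylFamily (D.e g)} (hs : IsHalfSyllepsis s) :
    ∃ f, D.HasCharacter s f := by
  choose r hr using fun h => D.exists_isTwist_scalar (rfl : g * h = g * h) (mul_comm h g) (s (D.e h))
  refine ⟨MonoidHom.mk' r fun h k => ?_, hs, fun h p hp hp' => by subst hp; exact hr h⟩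
  -- A candidate with the product scalar is compared with the actual value on `e_{hk}`. Both
  -- correspond to `sylMul` along `χ`, so they are equal and have the same scalar.
  obtain ⟨v, hv⟩ := D.exists_isTwist (rfl : g * (h * k) = g * (h * k)) (mul_comm _ _) (r h * r k)
  have hχ := D.χ_equiv h k (h * k) rfl
  have c₁ := sylMul_pairCompat (v := s) (w := v) hB.toIsFusion.tensorBilinear.toTensorLinear hD g h k
    (g * h) (h * k) (g * k) (g * (h * k)) rfl (mul_comm h g) rfl rfl (mul_comm k g)
    (mul_assoc g h k) rfl (mul_comm _ _) (mul_left_comm h g k) (r h).ne_zero (r k).ne_zero (hr h)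
    (hr k) (by simpa using hv)
    fun η θ e => ((D.χ_equiv g (h * k) _ rfl).fullyFaithful _ _).1 e
  have c₂ := hs.isNatural (D.χ h k (h * k) rfl)
  rw [hs.mul] at c₂
  have e : v = s (D.e (h * k)) := Iso.ext (((isEquiv_id _).ten hχ).whiskerLeft_injective
    (c₁.whiskerLeft_eq c₂))
  rw [e] at hv
  exact Units.ext ((hr (h * k)).scalar_eq hv)

/-- On `e_k` the tensor family has scalar `f k * f' k`, by the scalar count in `Slice`. Both
families are natural, so the case of a general `y` follows by decomposing it. -/
theorem isSylMap_χ {g h a : L} (ha : g * h = a) {s : SylFamily (D.e g)} {s' : SylFamily (D.e h)}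
    {s'' : SylFamily (D.e a)} {f f' : L →* ℂˣ} (hs : D.HasCharacter s f) (hs' : D.HasCharacter s' f')
    (hs'' : D.HasCharacter s'' (f * f')) :
    IsSylMap (tensorFamily s s') s'' (D.χ g h a ha) := by
  have hT := hB.toIsFusion.tensorBilinear
  have key (k : L) : PairCompat (D.χ g h a ha) (𝟙 (D.e k)) (tensorFamily s s' (D.e k))
      (s'' (D.e k)) :=
    tensorFamily_pairCompat hT.toTensorLinear hD g h k a (g * k) (h * k) (a * k) ha rfl (mul_comm k g)
      rfl (mul_comm k h) rfl (mul_comm k a) (by rw [← ha, mul_right_comm])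
      (by rw [← ha, mul_assoc]) (f k).ne_zero (f' k).ne_zero (hs.isTwist _ _ _ _)
      (hs'.isTwist _ _ _ _) (by simpa using hs''.isTwist k _ rfl (mul_comm k a))
      fun η θ e => ((D.χ_equiv a k _ rfl).fullyFaithful _ _).1 e
  intro y
  obtain ⟨n, c, i, p, hy⟩ := D.exists_isObjSumVia hB y
  refine PairCompat.of_comp_left (hT.isObjSumVia_wl hy _).covers
    (fun k => (hs.isHalf.isNatural.tensorFamily hs'.isHalf.isNatural) (i k)) fun k => ?_
  exact pairCompat_congr (ρ_ _ ≪≫ (λ_ _).symm) (λ_ _ ≪≫ (ρ_ _).symm)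
    (pairCompat_comp (key (c k)) (hs''.isHalf.isNatural (i k)))

/-- Every object of the sylleptic centre is a direct sum of simple objects with a character. -/
theorem exists_centre_decomposition {x : B} {s : SylFamily x} (hs : IsHalfSyllepsis s) :
    ∃ (n : ℕ) (c : Fin n → L) (f : Fin n → (L →* ℂˣ)) (t : ∀ k, SylFamily (D.e (c k)))
      (i : ∀ k, D.e (c k) ⟶ x) (p : ∀ k, x ⟶ D.e (c k)), IsObjSumVia i p ∧
      (∀ k, D.HasCharacter (t k) (f k)) ∧ (∀ k, IsSylMap (t k) s (i k)) ∧
      ∀ k, IsSylMap s (t k) (p k) := by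
  have hT := hB.toIsFusion.tensorBilinear
  obtain ⟨n, c, i, p, hx⟩ := D.exists_isObjSumVia hB x
  have hi (k) (y : B) : FullyFaithful (i k ▹ y) := (hT.isObjSumVia_wr hx y).fullyFaithful k
  -- The half syllepsis of `x` is restricted to each summand, where it must come from a character.
  choose t ht using fun k => exists_isSylMap (hi k) s
  choose f hf using fun k => D.exists_character hB hD (isHalf_of_isSylMap (hi k) (ht k) hs)
  exact ⟨n, c, f, t, i, p, hx, hf, ht, isSylMap_projection hT hx ht⟩

end FusionData

/-! ### The braided monoidal structure of the sylleptic centre -/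

namespace FusionData

variable {B : Type u} [Bicategory.{w, v} B] [LinearBicategory B] [BraidedBicategory B]
  {L : Type*} [CommGroup L] (D : FusionData B L) (hB : IsStronglyFusion B) (hD : D.Trivialises)

include hB hD

/-- After decomposing both factors, the family on `e_g ⊗ e_h` is pulled back along `χ` from the half
syllepsis on `e_{gh}` with the product character. -/
theorem isHalf_tensorFamily {x y : B} {s : SylFamily x} {t : SylFamily y} (hs : IsHalfSyllepsis s)
    (ht : IsHalfSyllepsis t) : IsHalfSyllepsis (tensorFamily s t) := by
  have hT := hB.toIsFusion.tensorBilinear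
  obtain ⟨n, c, f, s', i, p, hx, hs', hi, -⟩ := D.exists_centre_decomposition hB hD hs
  obtain ⟨m, d, f', t', j, q, hy, ht', hj, -⟩ := D.exists_centre_decomposition hB hD ht
  refine isHalf_of_covers hT (hT.covers_ten hx.covers hy.covers)
    (fun k => isSylMap_tenH (hi k.1) (hj k.2)) fun k => ?_
  obtain ⟨r, hr⟩ := D.exists_hasCharacter hB hD (f k.1 * f' k.2) (c k.1 * d k.2)
  exact isHalf_of_isSylMap (D.χ_equiv _ _ _ rfl).fullyFaithful_wr
    (D.isSylMap_χ hB hD rfl (hs' k.1) (ht' k.2) hr) hr.isHalf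

/-- Naturality of the associator reduces to three simple objects. There `ω` identifies the
associator followed by one fusion equivalence with the other fusion, and both fusions are
1-morphisms of the centre, so the equivalence can be cancelled. -/
theorem isSylMap_asc {x y z : B} {s : SylFamily x} {t : SylFamily y} {r : SylFamily z}
    (hs : IsHalfSyllepsis s) (ht : IsHalfSyllepsis t) (hr : IsHalfSyllepsis r) :
    IsSylMap (tensorFamily (tensorFamily s t) r) (tensorFamily s (tensorFamily t r))
      (asc x y z) := by
  have hT := hB.toIsFusion.tensorBilinear
  obtain ⟨n₁, c₁, f₁, s', i₁, p₁, hx, hs', hi₁, -⟩ := D.exists_centre_decomposition hB hD hs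
  obtain ⟨n₂, c₂, f₂, t', i₂, p₂, hy, ht', hi₂, -⟩ := D.exists_centre_decomposition hB hD ht
  obtain ⟨n₃, c₃, f₃, r', i₃, p₃, hz, hr', hi₃, -⟩ := D.exists_centre_decomposition hB hD hr
  refine IsSylMap.of_comp_left hT (hT.covers_ten (hT.covers_ten hx.covers hy.covers) hz.covers)
    (fun k => isSylMap_tenH (isSylMap_tenH (hi₁ k.1.1) (hi₂ k.1.2)) (hi₃ k.2)) fun k => ?_
  refine isSylMap_congr (ascSq (i₁ k.1.1) (i₂ k.1.2) (i₃ k.2)).symm (isSylMap_comp ?_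
    (isSylMap_tenH (hi₁ k.1.1) (isSylMap_tenH (hi₂ k.1.2) (hi₃ k.2))))
  obtain ⟨⟨k₁, k₂⟩, k₃⟩ := k
  obtain ⟨a, ha⟩ := D.exists_hasCharacter hB hD (f₁ k₁ * f₂ k₂) (c₁ k₁ * c₂ k₂)
  obtain ⟨b, hb⟩ := D.exists_hasCharacter hB hD (f₂ k₂ * f₃ k₃) (c₂ k₂ * c₃ k₃)
  obtain ⟨d, hd⟩ := D.exists_hasCharacter hB hD (f₁ k₁ * f₂ k₂ * f₃ k₃) (c₁ k₁ * c₂ k₂ * c₃ k₃)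
  have e₁ := isSylMap_comp (isSylMap_tenH (D.isSylMap_χ hB hD rfl (hs' k₁) (ht' k₂) ha)
    (isSylMap_id (r' k₃))) (D.isSylMap_χ hB hD rfl ha (hr' k₃) hd)
  have e₂ := isSylMap_comp (isSylMap_tenH (isSylMap_id (s' k₁))
    (D.isSylMap_χ hB hD rfl (ht' k₂) (hr' k₃) hb))
    -- The same half syllepsis serves as target of both fusions, since the product of the three
    -- characters does not depend on the bracketing.
    (D.isSylMap_χ hB hD (mul_assoc _ _ _).symm (hs' k₁) hb (mul_assoc (f₁ k₁) _ _ ▸ hd))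
  exact IsSylMap.of_comp_right (((isEquiv_id _).ten (D.χ_equiv _ _ _ rfl)).comp
    (D.χ_equiv _ _ _ _)).fullyFaithful_wr e₂ (isSylMap_congr (D.ω _ _ _ _ _ _ _ _ _ _) e₁)

/-- The argument for the associator with `u` in place of `ω`; commutativity of the product of
characters makes the two fusions share a target. -/
theorem isSylMap_br {x y : B} {s : SylFamily x} {t : SylFamily y} (hs : IsHalfSyllepsis s)
    (ht : IsHalfSyllepsis t) : IsSylMap (tensorFamily s t) (tensorFamily t s) (br x y) := by
  have hT := hB.toIsFusion.tensorBilinear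
  obtain ⟨n₁, c₁, f₁, s', i₁, p₁, hx, hs', hi₁, -⟩ := D.exists_centre_decomposition hB hD hs
  obtain ⟨n₂, c₂, f₂, t', i₂, p₂, hy, ht', hi₂, -⟩ := D.exists_centre_decomposition hB hD ht
  refine IsSylMap.of_comp_left hT (hT.covers_ten hx.covers hy.covers)
    (fun k => isSylMap_tenH (hi₁ k.1) (hi₂ k.2)) fun k => ?_
  refine isSylMap_congr (brSq (i₁ k.1) (i₂ k.2)).symm (isSylMap_comp ?_
    (isSylMap_tenH (hi₂ k.2) (hi₁ k.1)))
  obtain ⟨a, ha⟩ := D.exists_hasCharacter hB hD (f₁ k.1 * f₂ k.2) (c₁ k.1 * c₂ k.2)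
  exact IsSylMap.of_comp_right (D.χ_equiv _ _ _ _).fullyFaithful_wr
    (D.isSylMap_χ hB hD (mul_comm _ _) (ht' k.2) (hs' k.1) (mul_comm (f₁ k.1) _ ▸ ha))
    (isSylMap_congr (D.u _ _ _ _ _).symm (D.isSylMap_χ hB hD rfl (hs' k.1) (ht' k.2) ha))

-- Any `f'` factors, up to isomorphism, as `f` followed by an endomorphism of `e_g`, which is a sum
-- of identities. So one equivalence in the centre puts every parallel 1-morphism in it, which
-- spares any computation with the unitors.
omit hD in
theorem isSylMap_of_isEquiv {x : B} {s : SylFamily x} {g : L} {t : SylFamily (D.e g)}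
    {f : x ⟶ D.e g} (hf : IsEquiv f) (h : IsSylMap s t f) (f' : x ⟶ D.e g) : IsSylMap s t f' := by
  obtain ⟨k, -, ⟨θ⟩, -⟩ := hf.exists_inv
  obtain ⟨n, hn⟩ := D.isMultiple hB g (k ≫ f')
  exact isSylMap_congr (cancelFst θ f') (isSylMap_comp h
    (isSylMap_of_isSum hB.toIsFusion.tensorBilinear hn fun _ => isSylMap_id t))

theorem exists_unit : ∃ s : SylFamily (tunit B), IsHalfSyllepsis s ∧
    ∀ {x : B} {t : SylFamily x}, IsHalfSyllepsis t →
      IsSylMap (tensorFamily s t) t (lun x) ∧ IsSylMap (tensorFamily t s) t (run x) := by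
  have hT := hB.toIsFusion.tensorBilinear
  obtain ⟨g, q, hq⟩ := D.complete (tunit B) hB.unit_simple
  -- Fusing and using the left unitor, `e_{g * g}` is equivalent to `e_g`, so `g` is idempotent.
  obtain rfl : g = 1 := by
    obtain ⟨q', hq', -⟩ := hq.exists_inv
    obtain ⟨χ', hχ', -⟩ := (D.χ_equiv g g (g * g) rfl).exists_inv
    have := D.injective (g * g) g ⟨_, hχ'.comp ((hq'.ten (isEquiv_id (D.e g))).comp
      (AdjointInverse.isEquiv (TensorBicategory.leftInverse (D.e g))))⟩
    exact mul_eq_left.1 this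
  -- The half syllepsis of the unit object is pulled back from the trivial character on `e_1`.
  obtain ⟨r, hr⟩ := D.exists_hasCharacter hB hD 1 1
  obtain ⟨s, hs⟩ := exists_isSylMap hq.fullyFaithful_wr r
  refine ⟨s, isHalf_of_isSylMap hq.fullyFaithful_wr hs hr.isHalf, fun {x t} ht => ?_⟩
  obtain ⟨n, c, f, t', i, p, hx, ht', hi, -⟩ := D.exists_centre_decomposition hB hD ht
  constructor
  · refine IsSylMap.of_comp_left hT (hT.covers_ten (isEquiv_id (tunit B)).covers hx.covers)
      (fun k => isSylMap_tenH (isSylMap_id s) (hi k.2)) fun k => ?_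
    refine isSylMap_congr (lunSq (i k.2)).symm (isSylMap_comp ?_ (hi k.2))
    exact D.isSylMap_of_isEquiv hB ((hq.ten (isEquiv_id _)).comp (D.χ_equiv 1 _ _ (one_mul _)))
      (isSylMap_comp (isSylMap_tenH hs (isSylMap_id (t' k.2)))
        (D.isSylMap_χ hB hD _ hr (ht' k.2) ((one_mul (f k.2)).symm ▸ ht' k.2))) _
  · refine IsSylMap.of_comp_left hT (hT.covers_ten hx.covers (isEquiv_id (tunit B)).covers)
      (fun k => isSylMap_tenH (hi k.1) (isSylMap_id s)) fun k => ?_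
    refine isSylMap_congr (runSq (i k.1)).symm (isSylMap_comp ?_ (hi k.1))
    exact D.isSylMap_of_isEquiv hB (((isEquiv_id _).ten hq).comp (D.χ_equiv _ 1 _ (mul_one _)))
      (isSylMap_comp (isSylMap_tenH (isSylMap_id (t' k.1)) hs)
        (D.isSylMap_χ hB hD _ (ht' k.1) hr ((mul_one (f k.1)).symm ▸ ht' k.1))) _

theorem centreIsBraided : CentreIsBraided B where
  isHalf_ten X Y := D.isHalf_tensorFamily hB hD X.isHalf Y.isHalf
  isSylMap_ten f g := isSylMap_tenH f.isSylMap g.isSylMap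
  isSylMap_asc X Y Z := D.isSylMap_asc hB hD X.isHalf Y.isHalf Z.isHalf
  isSylMap_br X Y := D.isSylMap_br hB hD X.isHalf Y.isHalf
  exists_unit := by
    obtain ⟨s, hs, h⟩ := D.exists_unit hB hD
    exact ⟨s, hs, fun X => h X.isHalf⟩

end FusionData

/-! ### The linear structure of the sylleptic centre -/

namespace Centre

variable {B : Type u} [Bicategory.{w, v} B] [BraidedBicategory B] [LinearBicategory B]

theorem isSum_of_hom {X Y : Centre B} {n : ℕ} {f : Fin n → (X ⟶ Y)} {g : X ⟶ Y}
    (h : IsSum (fun k => (f k).hom) g.hom) : IsSum f g := by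
  obtain ⟨i, p, h₁, h₂, h₃⟩ := h
  exact ⟨i, p, h₁, h₂, h₃⟩

theorem isZero_of_hom {X Y : Centre B} {f : X ⟶ Y} (h : Limits.IsZero f.hom) : Limits.IsZero f :=
  (Limits.IsZero.iff_id_eq_zero f).2 ((Limits.IsZero.iff_id_eq_zero f.hom).1 h)

theorem isObjSum_of_isSylMap {n : ℕ} {X : Fin n → Centre B} {Y : Centre B}
    {i : ∀ k, (X k).obj ⟶ Y.obj} {p : ∀ k, Y.obj ⟶ (X k).obj} (h : IsObjSumVia i p)
    (hi : ∀ k, IsSylMap (X k).syl Y.syl (i k)) (hp : ∀ k, IsSylMap Y.syl (X k).syl (p k)) :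
    IsObjSum X Y :=
  ⟨fun k => ⟨i k, hi k⟩, fun k => ⟨p k, hp k⟩, fun k => ⟨mkIso (h.1 k).some⟩,
    fun k l hkl => isZero_of_hom (h.2.1 k l hkl), isSum_of_hom h.2.2⟩

theorem isEquiv_of_hom (hB : TensorBilinear B) {X Y : Centre B} {f : X ⟶ Y} (h : IsEquiv f.hom) :
    IsEquiv f := by
  obtain ⟨g, ⟨θ⟩, ⟨φ⟩⟩ := h
  exact ⟨⟨g, IsSylMap.inverse hB ⟨g, ⟨θ⟩, ⟨φ⟩⟩ θ f.isSylMap⟩, ⟨mkIso θ⟩, ⟨mkIso φ⟩⟩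

theorem hasSums (hB : TensorBilinear B) (h : ∀ x y : B, HasSums (x ⟶ y)) (X Y : Centre B) :
    HasSums (X ⟶ Y) := by
  intro n f
  obtain ⟨g, hg⟩ := h X.obj Y.obj n fun k => (f k).hom
  exact ⟨⟨g, isSylMap_of_isSum hB hg fun k => (f k).isSylMap⟩, isSum_of_hom hg⟩

theorem hasObjSums (hB : TensorBilinear B) (h : HasObjSums B) : HasObjSums (Centre B) := by
  intro n X
  obtain ⟨y, i, p, hy⟩ := h n fun k => (X k).obj
  have hy : IsObjSumVia i p := hy
  obtain ⟨s, hs⟩ := exists_isSylMap_sum hB hy fun k => (X k).syl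
  exact ⟨⟨y, s, isHalf_of_covers hB hy.covers hs fun k => (X k).isHalf⟩,
    isObjSum_of_isSylMap hy hs (isSylMap_projection hB hy hs)⟩

end Centre

/-- Over a fully faithful structure 1-morphism a cell is determined by its scalar, so parallel cells
are proportional with the ratio of their scalars. -/
theorem Slice.cell_eq_smul {B : Type u} [Bicategory.{w, v} B] [LinearBicategory B] {e : B} {X Y : Slice e} {F G : X ⟶ Y} (η θ : F ⟶ G)
    (hY : FullyFaithful Y.str) (hθ : θ.scalar ≠ 0) :
    η.cell = (η.scalar * θ.scalar⁻¹) • θ.cell := by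
  apply (hY _ _).1
  change η.cell ▷ Y.str = (_ • θ.cell) ▷ Y.str
  rw [← cancel_mono G.tri.hom, η.w, LinearBicategory.smul_whiskerRight, Linear.smul_comp, θ.w,
    smul_smul, mul_assoc, inv_mul_cancel₀ hθ, mul_one]

namespace FusionData

variable {B : Type u} [Bicategory.{w, v} B] [LinearBicategory B] [BraidedBicategory B]
  {L : Type*} [CommGroup L] {D : FusionData B L} (hB : IsStronglyFusion B)

include hB

/-- For different group elements this is Schur's lemma. For the same one, a non-zero 1-morphism
contains the identity as a retract; if the identity is a 1-morphism of the centre then the two half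
syllepses agree on simple objects, and so do their characters. -/
theorem HasCharacter.isZero_of_ne {g h : L} {s : SylFamily (D.e g)} {s' : SylFamily (D.e h)}
    {f f' : L →* ℂˣ} (hs : D.HasCharacter s f) (hs' : D.HasCharacter s' f') (hne : (f, g) ≠ (f', h))
    {F : D.e g ⟶ D.e h} (hF : IsSylMap s s' F) : Limits.IsZero F := by
  by_cases hg : g = h
  · subst hg
    obtain ⟨n, hn⟩ := D.isMultiple hB g F
    cases n with
    | zero => exact hn.isZero
    | succ n =>
      obtain ⟨i, p, h₁, -, -⟩ := hn
      have hid := isSylMap_of_retract (i 0) (p 0) (h₁ 0) hF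
      refine absurd ?_ hne
      congr 1
      ext k
      have hk := hs'.isTwist k _ rfl (mul_comm k g)
      rw [← pairCompat_id_eq (hid (D.e k))] at hk
      exact (hs.isTwist k _ rfl (mul_comm k g)).scalar_eq hk
  · exact D.isZero_of_ne hB hg F

theorem isTwoVec_centre (hD : D.Trivialises) {s : ∀ m : (L →* ℂˣ) × L, SylFamily (D.e m.2)}
    (hs : ∀ m, D.HasCharacter (s m) m.1) :
    IsTwoVec (fun m => (⟨D.e m.2, s m, (hs m).isHalf⟩ : Centre B)) where
  hasSums X Y := Centre.hasSums hB.toIsFusion.tensorBilinear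
    (fun x y => (hB.finiteSemisimple x y).1) X Y
  hasObjSums := Centre.hasObjSums hB.toIsFusion.tensorBilinear hB.hasObjSums
  simple m := D.simple m.2
  endo m F := by
    obtain ⟨n, hn⟩ := D.isMultiple hB m.2 F.hom
    exact ⟨n, Centre.isSum_of_hom hn⟩
  disjoint m n hmn F := Centre.isZero_of_hom ((hs m).isZero_of_ne hB (hs n) hmn F.isSylMap)
  generate X := by
    obtain ⟨n, c, f, t, i, p, hX, ht, hi, hp⟩ := D.exists_centre_decomposition hB hD X.isHalf
    -- A half syllepsis on a simple object is determined by its character, so each summand is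
    -- literally one of the chosen objects.
    have e (k : Fin n) : t k = s (f k, c k) := (ht k).unique hB (hs (f k, c k))
    obtain rfl : t = fun k => s (f k, c k) := funext e
    exact ⟨n, fun k => (f k, c k), Centre.isObjSum_of_isSylMap hX hi hp⟩

omit hB in
/-- The antisymmetric pairing of simple objects with characters. -/
theorem HasCharacter.sylForm {g h : L} {s : SylFamily (D.e g)} {s' : SylFamily (D.e h)}
    {f f' : L →* ℂˣ} (hs : D.HasCharacter s f) (hs' : D.HasCharacter s' f') :
    SylForm (⟨D.e g, s, hs.isHalf⟩ : Centre B) ⟨D.e h, s', hs'.isHalf⟩ (f h * (f' g)⁻¹ : ℂˣ) := by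
  let b := D.brHom g h (g * h) rfl (mul_comm h g)
  let κ := (hs.isTwist h (g * h) rfl (mul_comm h g)).iso (f h).ne_zero
  let κ' := (hs'.isTwist g (g * h) (mul_comm h g) rfl).iso (f' g).ne_zero
  -- Both sides of the pairing are lifted to `Slice` over the fused object; whiskering with the
  -- braiding leaves the scalars `f h` and `f' g` unchanged.
  let η := κ.hom ▷ b ≫ (λ_ b).hom
  let θ := (α_ _ _ _).hom ≫ b ◁ κ'.hom ≫ (ρ_ b).hom
  have hη : η.scalar = f h := by simp [η, κ, IsTwist.iso]; rfl
  have hθ : θ.scalar = f' g := by simp [θ, κ', IsTwist.iso]; rfl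
  have e := Slice.cell_eq_smul η θ (D.χ_equiv h g (g * h) (mul_comm h g)).fullyFaithful
    (by rw [hθ]; exact (f' g).ne_zero)
  rw [hη, hθ] at e
  rw [← Units.val_inv_eq_inv_val, ← Units.val_mul] at e
  exact e

end FusionData

end SylCentre

theorem proposition3 {B : Type u} [Bicategory.{w, v} B] [LinearBicategory B] [BraidedBicategory B]
    (hB : IsStronglyFusion B) {L : Type*} [CommGroup L] (D : FusionData B L) (hD : D.Trivialises) :
    ∃ (hZ : CentreIsBraided B) (s : ∀ m : (L →* ℂˣ) × L, SylFamily (D.e m.2))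
      (hs : ∀ m, IsHalfSyllepsis (s m)),
      IsTwoVec (fun m => (⟨D.e m.2, s m, hs m⟩ : Centre B)) ∧
      (∀ m n : (L →* ℂˣ) × L,
        ∃ F : hZ.tensor ⟨D.e m.2, s m, hs m⟩ ⟨D.e n.2, s n, hs n⟩ ⟶
            (⟨D.e (m * n).2, s (m * n), hs (m * n)⟩ : Centre B),
          F.hom = D.χ m.2 n.2 (m * n).2 rfl ∧ IsEquiv F) ∧
      (∀ (m : (L →* ℂˣ) × L) (h p : L) (hp : m.2 * h = p) (hp' : h * m.2 = p),
        (s m (D.e h)).hom ▷ D.χ m.2 h p hp ≫ (λ_ _).hom =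
          (m.1 h : ℂ) • ((α_ _ _ _).hom ≫ br (D.e m.2) (D.e h) ◁ (D.u h m.2 p hp' hp).hom ≫
            (D.u m.2 h p hp hp').hom)) ∧
      ∀ m n : (L →* ℂˣ) × L,
        SylForm (⟨D.e m.2, s m, hs m⟩ : Centre B) ⟨D.e n.2, s n, hs n⟩ (canonicalPairing m n) := by
  have hT := hB.toIsFusion.tensorBilinear
  have hZ := D.centreIsBraided hB hD
  -- This choice determines all the objects `E_m`; the four assertions then follow from the
  -- characters alone.
  choose s hs using fun m : (L →* ℂˣ) × L => D.exists_hasCharacter hB hD m.1 m.2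
  refine ⟨hZ, s, fun m => (hs m).isHalf, FusionData.isTwoVec_centre hB hD hs, fun m n => ?_,
    fun m h p hp hp' => (hs m).isTwist h p hp hp', fun m n => (hs m).sylForm (hs n)⟩
  exact ⟨⟨D.χ m.2 n.2 (m * n).2 rfl, D.isSylMap_χ hB hD rfl (hs m) (hs n) (hs (m * n))⟩, rfl,
    Centre.isEquiv_of_hom hT (D.χ_equiv _ _ _ _)⟩
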